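/- Notation: $n\in\mathbb N$, $n\ge 1$; $\langle\xi\rangle=(1+|\xi|^2)^{1/2}$; $\bar d\xi=(2\pi)^{-n}d\xi$; $\hat u(\xi)=\int e^{-iy\cdot\xi}u(y)\,dy$; for $k\in\mathbb N_0$ and $0<s<1$, $$\|g\|_{C^{k,s}}=\max_{|\beta|\le k}\sup_{x}|\partial^\beta g(x)|+\max_{|\beta|\le k}\sup_{x\ne y}\frac{|\partial^\beta g(x)-\partial^\beta g(y)|}{|x-y|^s},$$ and $C^{k,s}(\mathbb R^n)$ is the space of all $g\in C^k(\mathbb R^n;\mathbb C)$ with $\|g\|_{C^{k,s}}<\infty$. Let $\tilde m\in\mathbb N_0$, $m\in\mathbb R$, $0<s<1$ and $M,N\in\mathbb N_0\cup\{\infty\}$. * Single symbols. $C^{\tilde m,s}S^m_{0,0}(\mathbb R^n\times\mathbb R^n;M)$ is the set of all $p:\mathbb R^n_x\times\mathbb R^n_\xi\to\mathbb C$ such that, for all multi-indices $|\beta|\le\tilde m$, $|\alpha|\le M$: $\partial_x^\beta p(x,\cdot)\in C^M(\mathbb R^n)$ for every $x$; $\partial_\xi^\alpha p(\cdot,\xi)\in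 C^{\tilde m,s}(\mathbb R^n)$ for every $\xi$; $\partial_x^\beta\partial_\xi^\alpha p\in C^0(\mathbb R^n\times\mathbb R^n)$; and $\|\partial_\xi^\alpha p(\cdot,\xi)\|_{C^{\tilde m,s}}\le C_\alpha\langle\xi\rangle^m$ for all $\xi$. The associated operator is $p(x,D_x)u(x)=\int e^{ix\cdot\xi}p(x,\xi)\hat u(\xi)\,\bar d\xi$ for $u\in\mathcal S(\mathbb R^n)$. * Double symbols. $C^{\tilde m,s}S^m_{0,0}(\mathbb R^n\times\mathbb R^n\times\mathbb R^n;N)$ is the set of all $a:\mathbb R^n_x\times\mathbb R^n_\xi\times\mathbb R^n_{x'}\to\mathbb C$ such that, for all multi-indices $|\beta|\le\tilde m$, $|\alpha|\le N$ and all $\beta'\in\mathbb N_0^n$, the derivative $\partial_x^\beta\partial_\xi^\alpha\partial_{x'}^{\beta'}a$ exists and is continuous on $\mathbb R^n\times\mathbb R^n\times\mathbb R^n$, $\partial_\xi^\alpha\partial_{x'}^{\beta'}a(\cdot,\xi,x')\in C^{\tilde m,s}(\mathbb R^n)$, and $\|\partial_\xi^\alpha\partial_{x'}^{\beta'}a(\cdot,\xi,x')\|_{C^{\tilde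 m,s}}\le C_{\alpha,\beta'}\langle\xi\rangle^m$ for all $\xi,x'$. * Oscillatory integrals. $\mathrm{Os}\text{-}\iint e^{-iy\cdot\eta}b(y,\eta)\,dy\,\bar d\eta:=\lim_{\varepsilon\to0^+}\iint\chi(\varepsilon y,\varepsilon\eta)e^{-iy\cdot\eta}b(y,\eta)\,dy\,\bar d\eta$; it exists if, for every Schwartz function $\chi$ with $\chi(0,0)=1$, the integrals on the right converge absolutely for all $\varepsilon>0$ and have a limit that does not depend on $\chi$. The same definition is used for $(y,y'),(\xi,\xi')\in\mathbb R^{2n}$ with phase $y\cdot\xi+y'\cdot\xi'$. * The operator of a double symbol is, for $u\in\mathcal S(\mathbb R^n)$, $$a(x,D_x,x')u(x)=\mathrm{Os}\text{-}\iiiint e^{-i(y\cdot\xi+y'\cdot\xi')}a(x,\xi,x+y)\,u(x+y+y')\,dy\,dy'\,\bar d\xi\,\bar d\xi'.$$ **Theorem.** Let $N\in\mathbb N_0\cup\{\infty\}$ with $N>n$, put $\tilde N:=N-(n+1)$ (so $\tilde N=\infty$ if $N=\infty$), and let $a\in C^{\tilde m,s}S^m_{0,0}(\mathbb R^n\times\mathbb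 R^n\times\mathbb R^n;N)$ with $\tilde m\in\mathbb N_0$, $m\in\mathbb R$, $0<s<1$. Then the oscillatory integral $$a_L(x,\xi):=\mathrm{Os}\text{-}\iint e^{-iy\cdot\eta}a(x,\xi+\eta,x+y)\,dy\,\bar d\eta$$ exists for all $x,\xi\in\mathbb R^n$, and $a_L\in C^{\tilde m,s}S^m_{0,0}(\mathbb R^n\times\mathbb R^n;\tilde N)$. Moreover, for every $u\in\mathcal S(\mathbb R^n)$ and every $x\in\mathbb R^n$, the oscillatory integral defining $a(x,D_x,x')u(x)$ exists, the integral defining $a_L(x,D_x)u(x)$ converges absolutely, and $$a(x,D_x,x')u(x)=a_L(x,D_x)u(x).$$ -/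

import Mathlib

open scoped NNReal ENNReal SchwartzMap Topology
open Filter MeasureTheory

noncomputable section

namespace PsiDO

/-- `ℝⁿ` with its Euclidean norm. -/
abbrev E (n : ℕ) : Type := EuclideanSpace ℝ (Fin n)

/-- The Japanese bracket `⟨ξ⟩ = (1 + |ξ|²)^{1/2}`. -/
def japanese {n : ℕ} (ξ : E n) : ℝ := Real.sqrt (1 + ‖ξ‖ ^ 2)

/-! ### Partial derivatives and Hölder spaces on `ℝⁿ` -/

/-- The partial derivative `∂_j f`. -/
def partialDeriv {n : ℕ} (j : Fin n) (f : E n → ℂ) : E n → ℂ :=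
  fun x => lineDeriv ℝ f x (EuclideanSpace.single j (1 : ℝ))

/-- The length `|α|` of a multi-index. -/
def multiLength {n : ℕ} (α : Fin n → ℕ) : ℕ := ∑ j, α j

/-- `∂^α f = ∂_1^{α_1} ⋯ ∂_n^{α_n} f`. It is only used for functions `f` of class `C^{|α|}`. -/
def multiDeriv {n : ℕ} (α : Fin n → ℕ) (f : E n → ℂ) : E n → ℂ :=
  (List.finRange n).foldr (fun j g => (partialDeriv j)^[α j] g) f

/-- The norm of `C^{k,s}(ℝⁿ)`, with values in `[0, ∞]`:
`max_{|β| ≤ k} sup_x |∂^β g(x)| + max_{|β| ≤ k} sup_{x ≠ y} |∂^β g(x) - ∂^β g(y)| / |x - y|^s`. -/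
def holderSpaceNorm {n : ℕ} (k : ℕ) (s : ℝ≥0) (g : E n → ℂ) : ℝ≥0∞ :=
  (⨆ (β : Fin n → ℕ) (_ : multiLength β ≤ k) (x : E n), ‖multiDeriv β g x‖ₑ) +
    ⨆ (β : Fin n → ℕ) (_ : multiLength β ≤ k), eHolderNorm s (multiDeriv β g)

/-- Membership in the Hölder space `C^{k,s}(ℝⁿ)`. -/
def MemHolderSpace {n : ℕ} (k : ℕ) (s : ℝ≥0) (g : E n → ℂ) : Prop :=
  ContDiff ℝ k g ∧ holderSpaceNorm k s g < ∞

/-! ### Symbol classes -/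

/-- The mixed derivative `∂_x^β ∂_ξ^α p(x, ξ)`. -/
def symbolDeriv {n : ℕ} (β α : Fin n → ℕ) (p : E n → E n → ℂ) (x ξ : E n) : ℂ :=
  multiDeriv β (fun x₁ => multiDeriv α (p x₁) ξ) x

/-- The class `C^{k,s} S^m_{0,0}(ℝⁿ × ℝⁿ; M)` of non-smooth single symbols `p(x, ξ)`. -/
structure IsSingleSymbol {n : ℕ} (k : ℕ) (s : ℝ≥0) (m : ℝ) (M : ℕ∞)
    (p : E n → E n → ℂ) : Prop where
  /-- `∂_x^β p(x, ·) ∈ C^M` for all `x` and all `|β| ≤ k`; -/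
  contDiff_snd : ∀ β : Fin n → ℕ, multiLength β ≤ k → ∀ x : E n,
    ContDiff ℝ (M : WithTop ℕ∞) (fun ξ => multiDeriv β (fun x₁ => p x₁ ξ) x)
  /-- `∂_ξ^α p(·, ξ) ∈ C^{k,s}` for all `ξ` and all `|α| ≤ M`; -/
  memHolderSpace : ∀ α : Fin n → ℕ, (multiLength α : ℕ∞) ≤ M → ∀ ξ : E n,
    MemHolderSpace k s (fun x => multiDeriv α (p x) ξ)
  /-- `∂_x^β ∂_ξ^α p` is continuous on `ℝⁿ × ℝⁿ` for all `|β| ≤ k`, `|α| ≤ M`; -/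
  continuous_deriv : ∀ β α : Fin n → ℕ, multiLength β ≤ k → (multiLength α : ℕ∞) ≤ M →
    Continuous (fun z : E n × E n => symbolDeriv β α p z.1 z.2)
  /-- `‖∂_ξ^α p(·, ξ)‖_{C^{k,s}} ≤ C_α ⟨ξ⟩^m`. -/
  bound : ∀ α : Fin n → ℕ, (multiLength α : ℕ∞) ≤ M → ∃ C : ℝ, ∀ ξ : E n,
    holderSpaceNorm k s (fun x => multiDeriv α (p x) ξ) ≤ ENNReal.ofReal (C * japanese ξ ^ m)

/-- The mixed derivative `∂_ξ^α ∂_{x'}^{β'} a(x, ξ, x')`. -/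
def doubleSymbolDeriv {n : ℕ} (α β' : Fin n → ℕ) (a : E n → E n → E n → ℂ)
    (x ξ x' : E n) : ℂ :=
  multiDeriv α (fun ξ₁ => multiDeriv β' (a x ξ₁) x') ξ

/-- The class `C^{k,s} S^m_{0,0}(ℝⁿ × ℝⁿ × ℝⁿ; N)` of non-smooth double symbols `a(x, ξ, x')`
(those which do not depend on the fourth variable `ξ'`). -/
structure IsDoubleSymbol {n : ℕ} (k : ℕ) (s : ℝ≥0) (m : ℝ) (N : ℕ∞)
    (a : E n → E n → E n → ℂ) : Prop where
  /-- `a(x, ξ, ·)` is smooth; -/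
  contDiff_third : ∀ x ξ : E n, ContDiff ℝ ((⊤ : ℕ∞) : WithTop ℕ∞) (a x ξ)
  /-- `∂_{x'}^{β'} a(x, ·, x') ∈ C^N` for all `β'`; -/
  contDiff_snd : ∀ (β' : Fin n → ℕ) (x x' : E n),
    ContDiff ℝ (N : WithTop ℕ∞) (fun ξ => multiDeriv β' (a x ξ) x')
  /-- `∂_ξ^α ∂_{x'}^{β'} a(·, ξ, x') ∈ C^{k,s}` for all `|α| ≤ N` and all `β'`; -/
  memHolderSpace : ∀ α β' : Fin n → ℕ, (multiLength α : ℕ∞) ≤ N → ∀ ξ x' : E n,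
    MemHolderSpace k s (fun x => doubleSymbolDeriv α β' a x ξ x')
  /-- `∂_x^β ∂_ξ^α ∂_{x'}^{β'} a` is continuous on `ℝⁿ × ℝⁿ × ℝⁿ`
  for all `|β| ≤ k`, `|α| ≤ N` and all `β'`; -/
  continuous_deriv : ∀ β α β' : Fin n → ℕ, multiLength β ≤ k → (multiLength α : ℕ∞) ≤ N →
    Continuous (fun z : E n × E n × E n =>
      multiDeriv β (fun x => doubleSymbolDeriv α β' a x z.2.1 z.2.2) z.1)
  /-- `‖∂_ξ^α ∂_{x'}^{β'} a(·, ξ, x')‖_{C^{k,s}} ≤ C_{α,β'} ⟨ξ⟩^m`. -/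
  bound : ∀ α β' : Fin n → ℕ, (multiLength α : ℕ∞) ≤ N → ∃ C : ℝ, ∀ ξ x' : E n,
    holderSpaceNorm k s (fun x => doubleSymbolDeriv α β' a x ξ x') ≤
      ENNReal.ofReal (C * japanese ξ ^ m)

/-! ### Oscillatory integrals -/

/-- `b` has the oscillatory integral `I = Os-∬ e^{-iφ(y,η)} b(y,η) dy đη` over `V × V`, where
`đη = (2π)^{-dim V} dη`: for every Schwartz function `χ` with `χ(0,0) = 1` the regularised
integrands `χ(εy, εη) e^{-iφ(y,η)} b(y,η)` are integrable for all `ε > 0`, and their integrals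
converge to `I` as `ε → 0`. -/
def HasOscIntegral {V : Type*} [NormedAddCommGroup V] [NormedSpace ℝ V] [MeasureSpace V]
    (φ : V → V → ℝ) (b : V → V → ℂ) (I : ℂ) : Prop :=
  ∀ χ : 𝓢(V × V, ℂ), χ 0 = 1 →
    (∀ ε : ℝ, 0 < ε → Integrable (fun z : V × V =>
      χ (ε • z) * Complex.exp (-(Complex.I * (φ z.1 z.2 : ℂ))) * b z.1 z.2)) ∧
    Tendsto (fun ε : ℝ => (((2 * Real.pi) ^ Module.finrank ℝ V)⁻¹ : ℝ) *
      ∫ z : V × V, χ (ε • z) * Complex.exp (-(Complex.I * (φ z.1 z.2 : ℂ))) * b z.1 z.2)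
      (𝓝[>] 0) (𝓝 I)

/-- The value of an oscillatory integral is unique. -/
theorem HasOscIntegral.unique {V : Type*} [NormedAddCommGroup V] [NormedSpace ℝ V]
    [FiniteDimensional ℝ V] [MeasureSpace V] {φ : V → V → ℝ} {b : V → V → ℂ} {I J : ℂ}
    (hI : HasOscIntegral φ b I) (hJ : HasOscIntegral φ b J) : I = J := by
  obtain ⟨f⟩ : Nonempty (ContDiffBump (0 : V × V)) := inferInstance
  have h2 : HasCompactSupport (fun z => ((f z : ℝ) : ℂ)) :=
    f.hasCompactSupport.comp_left (g := Complex.ofReal) (by simp)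
  have h1 : ContDiff ℝ ((⊤ : ℕ∞) : WithTop ℕ∞) (fun z => ((f z : ℝ) : ℂ)) :=
    Complex.ofRealCLM.contDiff.comp f.contDiff
  have hχ : (h2.toSchwartzMap h1) 0 = 1 := by
    have := f.one_of_mem_closedBall (x := 0) (by simp [f.rIn_pos.le])
    simp [this]
  exact tendsto_nhds_unique (hI _ hχ).2 (hJ _ hχ).2

/-- The phase `y · η` on `ℝⁿ × ℝⁿ`. -/
def phase {n : ℕ} (y η : E n) : ℝ := inner ℝ y η

/-- The phase `y · ξ + y' · ξ'` for `(y, y'), (ξ, ξ') ∈ ℝ²ⁿ`. -/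
def phase₂ {n : ℕ} (y η : E n × E n) : ℝ := inner ℝ y.1 η.1 + inner ℝ y.2 η.2

/-! ### Pseudodifferential operators -/

/-- `v = (p(x, D_x, x', D_{x'}) u)(x)`, where the operator with double symbol `p(x, ξ, x', ξ')` is
`Os-∬∬ e^{-i(y·ξ + y'·ξ')} p(x, ξ, x+y, ξ') u(x+y+y') dy dy' đξ đξ'`. -/
def HasDoubleOpValue {n : ℕ} (p : E n → E n → E n → E n → ℂ) (u : 𝓢(E n, ℂ)) (x : E n)
    (v : ℂ) : Prop :=
  HasOscIntegral (V := E n × E n) phase₂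
    (fun y ξ => p x ξ.1 (x + y.1) ξ.2 * u (x + y.1 + y.2)) v

/-- The Fourier transform `û(ξ) = ∫ e^{-iy·ξ} u(y) dy`. -/
def fourierHat {n : ℕ} (u : 𝓢(E n, ℂ)) (ξ : E n) : ℂ :=
  ∫ y : E n, Complex.exp (-(Complex.I * (inner ℝ y ξ : ℝ))) * u y

/-- The integrand `e^{ix·ξ} p(x, ξ) û(ξ)` of the operator with single symbol `p`. -/
def singleOpIntegrand {n : ℕ} (p : E n → E n → ℂ) (u : 𝓢(E n, ℂ)) (x ξ : E n) : ℂ :=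
  Complex.exp (Complex.I * (inner ℝ x ξ : ℝ)) * p x ξ * fourierHat u ξ

/-- The operator `(p(x, D_x) u)(x) = ∫ e^{ix·ξ} p(x, ξ) û(ξ) đξ`, `đξ = (2π)^{-n} dξ`. -/
def singleOp {n : ℕ} (p : E n → E n → ℂ) (u : 𝓢(E n, ℂ)) (x : E n) : ℂ :=
  (((2 * Real.pi) ^ n)⁻¹ : ℝ) * ∫ ξ : E n, singleOpIntegrand p u x ξ

end PsiDO

end

noncomputable section

set_option linter.unusedSectionVars false

namespace PsiDO

/-! ### Line derivatives -/

section LineDerivatives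

variable {Z : Type*} [NormedAddCommGroup Z] [NormedSpace ℝ Z]

/-! The oscillatory integrals are turned into absolutely convergent ones by a first-order operator.
If `∂_j osc = -i π_j osc` and `π` is constant along these directions, then `⟨π⟩⁻² (1 + i π·∂)`
reproduces `osc`. Its transpose costs one derivative of the amplitude and gains one factor `⟨π⟩⁻¹`.
For the phase `y·η`, `n + 1` steps in `η` yield the integrable weight `⟨y⟩^{-(n+1)}`. With `μ =
⌈|m|⌉`, `μ + n + 1` steps in `y` absorb the growth given by Peetre's inequality, `⟨ξ+η⟩^m ≤ 2^μ
⟨ξ⟩^m ⟨η⟩^μ`, and leave `⟨η⟩^{-(n+1)}`. Exactly one power per derivative is what makes the loss in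
`ξ` equal to `n + 1` for every parity of `n`.

Existence is continuity of a parameter integral: the scale `ε` of the cutoff is a parameter, `ε = 0`
included (`IsOsc.tendsto_regularisation`).

For the symbol estimates put `f(x, ξ, y) = a(x, ξ, x + y)`. An `x`-derivative falls on the first and
third slots of `a`, and one more `x'`-derivative controls the Hölder quotient (`Reg.shift`); this is
harmless, since `a` is smooth in `x'`. Then `a_L` is differentiated under the integral
(`reg_leftSymbol`), and its Hölder quotient is estimated by regarding the difference of two
amplitudes as one amplitude with the small weight `|x₁ - x₂|^s` (`reg_amplitude_sub`).

For the operator identity set `η = ξ - ξ'` and `w = y + y'`. The phase becomes `y·η + w·ξ'` and the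
amplitude `f(x, ξ' + η, y) u(x + w)`. The integrations by parts respect this splitting, so by Fubini
the `(y, η)`-integral gives `a_L(x, ξ')` and the `w`-integral gives `e^{ix·ξ'} û(ξ')`
(`opIntegrand_opCoord`, `integral_opAmplitude`).

The symbols have finite and different regularity in their variables, so derivatives are counted
separately for each family of directions (`Reg`), and they are reordered by `hasLineDerivAt_swap`,
which needs no joint differentiability. -/

theorem hasDerivAt_line {f : Z → ℂ} {f' : ℂ} {z v : Z} {t : ℝ}
    (h : HasLineDerivAt ℝ f f' (z + t • v) v) : HasDerivAt (fun τ : ℝ => f (z + τ • v)) f' t := by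
  have h1 : HasDerivAt (fun τ : ℝ => f (z + t • v + τ • v)) f' (t - t) := by
    rw [sub_self]; exact h
  have h2 := h1.comp_sub_const t t
  refine h2.congr_of_eventuallyEq (Eventually.of_forall fun τ => ?_)
  have : z + τ • v = z + t • v + (τ - t) • v := by rw [sub_smul]; abel
  simp only [this]

theorem eq_add_integral_line {f g : Z → ℂ} {v : Z} (hf : ∀ z, HasLineDerivAt ℝ f (g z) z v)
    (hg : Continuous g) (z : Z) (t : ℝ) :
    f (z + t • v) = f z + ∫ τ in (0 : ℝ)..t, g (z + τ • v) := by
  have h := intervalIntegral.integral_eq_sub_of_hasDerivAt (a := 0) (b := t)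
    (f := fun τ : ℝ => f (z + τ • v)) (f' := fun τ => g (z + τ • v))
    (fun τ _ => hasDerivAt_line (hf _))
    (Continuous.intervalIntegrable (by fun_prop) _ _)
  rw [h]; simp

/-- Interchange of two line derivatives, the existence of one of the mixed derivatives being part
of the conclusion. -/
theorem hasLineDerivAt_swap {f g h k : Z → ℂ} {v w : Z}
    (hf : ∀ z, HasLineDerivAt ℝ f (g z) z v) (hfw : ∀ z, HasLineDerivAt ℝ f (h z) z w)
    (hgw : ∀ z, HasLineDerivAt ℝ g (k z) z w) (hg : Continuous g) (hk : Continuous k) (z : Z) :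
    HasLineDerivAt ℝ h (k z) z v := by
  -- Differentiate `f(z + tv + rw) = f(z + rw) + ∫₀ᵗ g(z + τv + rw) dτ` at `r = 0`. This exhibits
  -- `h` along `v` as a primitive of the continuous `k`, so no continuity of `h` has to be assumed.
  have key : ∀ t : ℝ, h (z + t • v) = h z + ∫ τ in (0 : ℝ)..t, k (z + τ • v) := by
    intro t
    have h1 : HasDerivAt (fun r : ℝ => f (z + t • v + r • w)) (h (z + t • v)) 0 := hfw _
    have hcont : Continuous fun q : ℝ × ℝ => k (z + q.2 • v + q.1 • w) := by fun_prop
    obtain ⟨C, hC⟩ := (isCompact_Icc.prod isCompact_uIcc :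
      IsCompact (Set.Icc (-1 : ℝ) 1 ×ˢ Set.uIcc 0 t)).exists_bound_of_continuousOn
        hcont.continuousOn
    have h2 := (intervalIntegral.hasDerivAt_integral_of_dominated_loc_of_deriv_le
      (μ := volume) (a := 0) (b := t) (x₀ := (0 : ℝ)) (s := Set.Icc (-1 : ℝ) 1)
      (F := fun r τ => g (z + τ • v + r • w)) (F' := fun r τ => k (z + τ • v + r • w))
      (bound := fun _ => C)
      (Icc_mem_nhds (by norm_num) (by norm_num))
      (Eventually.of_forall fun r => Continuous.aestronglyMeasurable (by fun_prop))
      (Continuous.intervalIntegrable (by fun_prop) _ _)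
      (Continuous.aestronglyMeasurable (by fun_prop))
      (Eventually.of_forall fun τ hτ r hr => hC (r, τ) ⟨hr, Set.uIoc_subset_uIcc hτ⟩)
      (by simp)
      (Eventually.of_forall fun τ _ r _ => hasDerivAt_line (hgw _))).2
    have h3 : HasDerivAt (fun r : ℝ => f (z + r • w)) (h z) 0 := hfw z
    have h4 := h3.add h2
    have h5 : HasDerivAt (fun r : ℝ => f (z + t • v + r • w))
        (h z + ∫ τ in (0 : ℝ)..t, k (z + τ • v)) 0 := by
      simp only [zero_smul, add_zero] at h4
      refine h4.congr_of_eventuallyEq (Eventually.of_forall fun r => ?_)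
      have := eq_add_integral_line hf hg (z + r • w) t
      simp only [Pi.add_apply]
      rw [show z + t • v + r • w = z + r • w + t • v by abel, this]
      congr 1
      refine intervalIntegral.integral_congr fun τ _ => ?_
      simp only [show z + r • w + τ • v = z + τ • v + r • w by abel]
    exact h1.unique h5
  have h6 : HasDerivAt (fun t : ℝ => h z + ∫ τ in (0 : ℝ)..t, k (z + τ • v)) (k (z + (0 : ℝ) • v)) 0 :=
    (intervalIntegral.integral_hasDerivAt_right
      (Continuous.intervalIntegrable (by fun_prop) _ _)
      (Continuous.stronglyMeasurableAtFilter (by fun_prop) _ _)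
      (by fun_prop : Continuous fun τ : ℝ => k (z + τ • v)).continuousAt).const_add _
  rw [zero_smul, add_zero] at h6
  exact h6.congr_of_eventuallyEq (Eventually.of_forall key)

/-- Move along `t w` first and along `t v` afterwards. The second increment is `t` times an average
of `g` over a segment that shrinks to `z`, so continuity of one of the two derivatives is enough. -/
theorem hasLineDerivAt_add_direction {f g h : Z → ℂ} {v w : Z}
    (hf : ∀ z, HasLineDerivAt ℝ f (g z) z v) (hfw : ∀ z, HasLineDerivAt ℝ f (h z) z w)
    (hg : Continuous g) (z : Z) : HasLineDerivAt ℝ f (g z + h z) z (v + w) := by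
  have h1 : ∀ t : ℝ, f (z + t • (v + w)) =
      t * (∫ σ in (0 : ℝ)..1, g (z + t • w + (t * σ) • v)) + f (z + t • w) := by
    intro t
    rw [show z + t • (v + w) = z + t • w + t • v by rw [smul_add]; abel,
      eq_add_integral_line hf hg, add_comm]
    congr 1
    have := intervalIntegral.smul_integral_comp_mul_left (a := (0 : ℝ)) (b := 1)
      (fun τ => g (z + t • w + τ • v)) t
    simp only [mul_zero, mul_one] at this
    rw [← this, Complex.real_smul]
  have hG : Continuous fun t : ℝ => ∫ σ in (0 : ℝ)..1, g (z + t • w + (t * σ) • v) :=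
    intervalIntegral.continuous_parametric_intervalIntegral_of_continuous' (by fun_prop) _ _
  have h2 : HasDerivAt (fun t : ℝ => (t : ℂ) * ∫ σ in (0 : ℝ)..1, g (z + t • w + (t * σ) • v))
      (g z) 0 := by
    rw [hasDerivAt_iff_tendsto_slope]
    have h3 := hG.tendsto 0
    simp only [zero_smul, add_zero, zero_mul, intervalIntegral.integral_const, sub_zero,
      one_smul] at h3
    refine (h3.mono_left nhdsWithin_le_nhds).congr' ?_
    filter_upwards [self_mem_nhdsWithin] with t ht
    have ht' : (t : ℂ) ≠ 0 := by exact_mod_cast ht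
    simp only [slope_def_module, sub_zero, Complex.ofReal_zero, zero_mul, Complex.real_smul,
      Complex.ofReal_inv]
    field_simp
  have h4 : HasDerivAt (fun t : ℝ => f (z + t • w)) (h z) 0 := hfw z
  exact (h2.add h4).congr_of_eventuallyEq (Eventually.of_forall h1)

theorem hasLineDerivAt_sum_direction {ι : Type*} (s : Finset ι) {f : Z → ℂ} {g : ι → Z → ℂ}
    {d : ι → Z} (hf : ∀ i ∈ s, ∀ z, HasLineDerivAt ℝ f (g i z) z (d i))
    (hg : ∀ i ∈ s, Continuous (g i)) (c : ι → ℝ) (z : Z) :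
    HasLineDerivAt ℝ f (∑ i ∈ s, c i * g i z) z (∑ i ∈ s, c i • d i) := by
  classical
  induction s using Finset.induction_on generalizing z with
  | empty => simpa using hasLineDerivAt_zero
  | insert i s hi ih =>
    simp only [Finset.sum_insert hi]
    refine hasLineDerivAt_add_direction (g := fun z => c i * g i z)
      (h := fun z => ∑ i ∈ s, c i * g i z) (fun z => ?_) (ih (fun j hj => hf j (by simp [hj]))
        (fun j hj => hg j (by simp [hj]))) (continuous_const.mul (hg i (by simp))) z
    have := (hf i (by simp) z).smul (c i)
    rwa [Complex.real_smul] at this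

/-- A function with continuous directional derivatives is Fréchet differentiable. -/
theorem hasFDerivAt_of_hasLineDerivAt {f : Z → ℂ} {L : Z → Z →L[ℝ] ℂ} (hL : Continuous L)
    (hf : ∀ z v, HasLineDerivAt ℝ f (L z v) z v) (z : Z) : HasFDerivAt f (L z) z := by
  rw [hasFDerivAt_iff_isLittleO_nhds_zero, Asymptotics.isLittleO_iff]
  intro c hc
  obtain ⟨δ, hδ, h⟩ := Metric.continuousAt_iff.1 (hL.continuousAt (x := z)) c hc
  filter_upwards [Metric.ball_mem_nhds (0 : Z) hδ] with v hv
  -- The mean value inequality for the function with its linear part removed: its derivative at `t`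
  -- is `(L (z + tv) - L z) v`, which continuity of `L` makes at most `c ‖v‖`.
  have h1 := norm_image_sub_le_of_norm_deriv_le_segment_01'
    (f := fun t : ℝ => f (z + t • v) - t • L z v) (f' := fun t => L (z + t • v) v - L z v)
    (C := c * ‖v‖) (fun t _ => by
      have := (hasDerivAt_line (hf (z + t • v) v)).sub ((hasDerivAt_id t).smul_const (L z v))
      simpa [Pi.sub_def] using this.hasDerivWithinAt) (fun t ht => by
      rw [← sub_apply]
      refine (ContinuousLinearMap.le_opNorm _ _).trans ?_
      gcongr
      rw [← dist_eq_norm]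
      refine (h ?_).le
      rw [dist_eq_norm, add_sub_cancel_left, norm_smul, Real.norm_eq_abs, abs_of_nonneg ht.1]
      rw [mem_ball_zero_iff] at hv
      nlinarith [ht.2, norm_nonneg v])
  simpa [sub_right_comm] using h1

end LineDerivatives

/-- Additivity in the direction assembles the partial derivatives into a continuous candidate for
the Fréchet derivative, which is as smooth as they are. This is the way back from `Reg` to
`ContDiff`. -/
theorem contDiff_one_add_of_partial {n : ℕ} {r : ℕ} {f : E n → ℂ} {g : Fin n → E n → ℂ}
    (hf : ∀ j x, HasLineDerivAt ℝ f (g j x) x (EuclideanSpace.single j 1))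
    (hg : ∀ j, ContDiff ℝ r (g j)) : ContDiff ℝ (r + 1 : ℕ) f := by
  let L : E n → E n →L[ℝ] ℂ := fun x =>
    ∑ j, (EuclideanSpace.proj j : E n →L[ℝ] ℝ).smulRight (g j x)
  have hL : ContDiff ℝ r L := by
    refine ContDiff.sum fun j _ => ?_
    exact (ContinuousLinearMap.smulRightL ℝ (E n) ℂ (EuclideanSpace.proj j)).contDiff.comp (hg j)
  have h1 : ∀ x, HasFDerivAt f (L x) x := by
    refine hasFDerivAt_of_hasLineDerivAt hL.continuous fun x v => ?_
    have := hasLineDerivAt_sum_direction Finset.univ (fun j _ => hf j)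
      (fun j _ => (hg j).continuous) (fun j => v j) x
    convert! this using 1
    · simp [L]
    · ext i; simp [Finset.sum_apply, Pi.single_apply]
  rw [show ((r + 1 : ℕ) : WithTop ℕ∞) = (r : WithTop ℕ∞) + 1 by simp, contDiff_succ_iff_fderiv]
  refine ⟨fun x => (h1 x).differentiableAt, by simp, ?_⟩
  rwa [show fderiv ℝ f = L from funext fun x => (h1 x).fderiv]

/-! ### Functions with iterated directional derivatives -/

section Regularity

variable {ι κ Z : Type*} [DecidableEq ι] [NormedAddCommGroup Z] [NormedSpace ℝ Z]

/-- `Reg d B c f`: all iterated derivatives of `f` which contain at most `c i` derivatives in the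
directions `d i j` of the family `i` exist and satisfy `B`. -/
inductive Reg (d : ι → κ → Z) (B : (Z → ℂ) → Prop) : (ι → ℕ) → (Z → ℂ) → Prop
  | intro {c : ι → ℕ} {f : Z → ℂ} (base : B f)
      (diff : ∀ i j, 0 < c i → ∀ z, LineDifferentiableAt ℝ f z (d i j))
      (step : ∀ i j, 0 < c i → Reg d B (c - Pi.single i 1) (fun z => lineDeriv ℝ f z (d i j))) :
      Reg d B c f

/-- Induction on the derivation of `Reg` follows a single function. Statements about several
functions at once, such as the Leibniz rule, need induction on the total number of derivatives. -/
theorem count_induction [Fintype ι] {P : (ι → ℕ) → Prop}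
    (h : ∀ c, (∀ i, 0 < c i → P (c - Pi.single i 1)) → P c) (c : ι → ℕ) : P c := by
  induction hN : ∑ i, c i using Nat.strong_induction_on generalizing c with
  | _ N ih =>
    refine h c fun i hi => ih _ ?_ _ rfl
    rw [← hN]
    refine Finset.sum_lt_sum (fun k _ => Nat.sub_le _ _) ⟨i, Finset.mem_univ _, ?_⟩
    simp only [Pi.sub_apply, Pi.single_eq_same]
    omega

namespace Reg

variable {d : ι → κ → Z} {B B' B'' : (Z → ℂ) → Prop} {c c' : ι → ℕ} {f g : Z → ℂ}

theorem base (h : Reg d B c f) : B f := by cases h; assumption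

theorem hasLineDerivAt (h : Reg d B c f) {i : ι} (hi : 0 < c i) (j : κ) (z : Z) :
    HasLineDerivAt ℝ f (lineDeriv ℝ f z (d i j)) z (d i j) := by
  cases h with
  | intro _ diff _ => exact (diff i j hi z).hasLineDerivAt

theorem step (h : Reg d B c f) {i : ι} (hi : 0 < c i) (j : κ) :
    Reg d B (c - Pi.single i 1) (fun z => lineDeriv ℝ f z (d i j)) := by
  cases h with
  | intro _ _ step => exact step i j hi

theorem of_hasLineDerivAt (hb : B f) (h : ∀ i j, 0 < c i → ∃ g : Z → ℂ,
    (∀ z, HasLineDerivAt ℝ f (g z) z (d i j)) ∧ Reg d B (c - Pi.single i 1) g) : Reg d B c f := by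
  refine ⟨hb, fun i j hi z => ?_, fun i j hi => ?_⟩ <;> obtain ⟨g, hg, hr⟩ := h i j hi
  · exact (hg z).lineDifferentiableAt
  · rwa [show (fun z => lineDeriv ℝ f z (d i j)) = g from funext fun z => (hg z).lineDeriv]

theorem mono_count (h : Reg d B c f) (hc : c' ≤ c) : Reg d B c' f := by
  induction h generalizing c' with
  | intro base diff step ih =>
    exact ⟨base, fun i j hi => diff i j (hi.trans_le (hc i)),
      fun i j hi => ih i j (hi.trans_le (hc i)) (tsub_le_tsub_right hc _)⟩

theorem mono_base (h : Reg d B c f) (hB : ∀ f, B f → B' f) : Reg d B' c f := by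
  induction h with
  | intro base diff step ih => exact ⟨hB _ base, diff, ih⟩

/-- Operators which commute with the derivatives preserve regularity. -/
theorem map {ι' κ' Z' : Type*} [DecidableEq ι'] [NormedAddCommGroup Z'] [NormedSpace ℝ Z']
    {d' : ι' → κ' → Z'} {B' : (Z' → ℂ) → Prop} (Φ : (Z → ℂ) → Z' → ℂ) {σ : ι' → ι}
    (hσ : Function.Injective σ) {τ : ι' → κ' → κ} (hB : ∀ f, B f → B' (Φ f))
    (hD : ∀ f g i j, 0 < c (σ i) → B f → B g → (∀ z, HasLineDerivAt ℝ f (g z) z (d (σ i) (τ i j))) →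
      ∀ z, HasLineDerivAt ℝ (Φ f) (Φ g z) z (d' i j))
    (h : Reg d B c f) : Reg d' B' (c ∘ σ) (Φ f) := by
  induction h with
  | @intro c f base diff step ih =>
    refine of_hasLineDerivAt (hB _ base) fun i j hi => ⟨_,
      hD f _ i j hi base (step (σ i) (τ i j) hi).base
        (fun z => (diff (σ i) (τ i j) hi z).hasLineDerivAt), ?_⟩
    convert ih (σ i) (τ i j) hi (fun f g i' j' hi' => hD f g i' j' (hi'.trans_le (Nat.sub_le _ _)))
      using 1
    ext k
    by_cases hk : k = i
    · subst hk; simp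
    · simp [hk, hσ.ne hk]

theorem add (hf : Reg d B c f) (hg : Reg d B' c g)
    (hB : ∀ f g, B f → B' g → B'' (fun z => f z + g z)) : Reg d B'' c (fun z => f z + g z) := by
  induction hf generalizing g with
  | @intro c f base diff step ih =>
    exact of_hasLineDerivAt (hB _ _ base hg.base) fun i j hi => ⟨_,
      fun z => (diff i j hi z).hasLineDerivAt.add (hg.hasLineDerivAt hi j z),
      ih i j hi (hg.step hi j)⟩

theorem mul [Fintype ι] (hf : Reg d B c f) (hg : Reg d B' c g)
    (hmul : ∀ f g, B f → B' g → B'' (fun z => f z * g z))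
    (hadd : ∀ f g, B'' f → B'' g → B'' (fun z => f z + g z)) :
    Reg d B'' c (fun z => f z * g z) := by
  induction c using count_induction generalizing f g with
  | _ c ih =>
    refine of_hasLineDerivAt (hmul _ _ hf.base hg.base) fun i j hi => ⟨
      fun z => lineDeriv ℝ f z (d i j) * g z + f z * lineDeriv ℝ g z (d i j), fun z => ?_,
      (ih i hi (hf.step hi j) (hg.mono_count tsub_le_self)).add
        (ih i hi (hf.mono_count tsub_le_self) (hg.step hi j)) hadd⟩
    have := (hf.hasLineDerivAt hi j z).mul (hg.hasLineDerivAt hi j z)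
    simp only [zero_smul, add_zero] at this
    exact this

theorem of_invariant [Fintype ι] (hf : B f) (h0 : B fun _ => 0)
    (hinv : ∀ z i j (t : ℝ), f (z + t • d i j) = f z) (c : ι → ℕ) : Reg d B c f := by
  have hzero : ∀ c, Reg d B c fun _ => 0 := fun c => by
    induction c using count_induction with
    | _ c ih => exact of_hasLineDerivAt h0 fun i j hi => ⟨fun _ => 0,
        fun z => hasDerivAt_const _ _, ih i hi⟩
  refine of_hasLineDerivAt hf fun i j hi => ⟨fun _ => 0, fun z => ?_, hzero _⟩
  simp only [HasLineDerivAt, hinv]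
  exact hasDerivAt_const _ _

/-- The part `c₀` of the budget becomes a base property, to be spent by an integral operator; the
part `c` remains for the derivatives that `Reg.map` carries through that operator. -/
theorem nest {c₀ : ι → ℕ} (h : Reg d B (c + c₀) f) : Reg d (Reg d B c₀) c f := by
  generalize hc : c + c₀ = c₁ at h
  induction h generalizing c with
  | @intro c₁ f base diff step ih =>
    have hle : ∀ {i}, 0 < c i → 0 < c₁ i := fun hi => by
      rw [← hc]; exact Nat.add_pos_left hi _
    refine ⟨(Reg.intro base diff step).mono_count (hc ▸ le_add_self),
      fun i j hi => diff i j (hle hi), fun i j hi => ih i j (hle hi) ?_⟩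
    rw [← hc]
    ext k
    by_cases hk : k = i
    · subst hk; simp; omega
    · simp [hk]

end Reg

end Regularity

/-! ### Continuous functions dominated by a weight -/

section Bounds

variable {Z : Type*} [TopologicalSpace Z]

/-- `f` is continuous and bounded by a multiple of `W`. -/
def Bd (W : Z → ℝ) (f : Z → ℂ) : Prop :=
  Continuous f ∧ ∃ C : ℝ, 0 ≤ C ∧ ∀ z, ‖f z‖ ≤ C * W z

namespace Bd

variable {W W' : Z → ℝ} {f g : Z → ℂ}

theorem add (hf : Bd W f) (hg : Bd W g) : Bd W fun z => f z + g z := by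
  obtain ⟨hf, C, hC, h⟩ := hf
  obtain ⟨hg, C', hC', h'⟩ := hg
  refine ⟨hf.add hg, C + C', add_nonneg hC hC', fun z => ?_⟩
  rw [add_mul]
  exact (norm_add_le _ _).trans (add_le_add (h z) (h' z))

theorem mul (hf : Bd W f) (hg : Bd W' g) : Bd (fun z => W z * W' z) fun z => f z * g z := by
  obtain ⟨hf, C, hC, h⟩ := hf
  obtain ⟨hg, C', hC', h'⟩ := hg
  refine ⟨hf.mul hg, C * C', mul_nonneg hC hC', fun z => ?_⟩
  rw [norm_mul, mul_mul_mul_comm]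
  exact mul_le_mul (h z) (h' z) (norm_nonneg _) ((norm_nonneg _).trans (h z))

theorem const_mul (hf : Bd W f) (a : ℂ) : Bd W fun z => a * f z := by
  obtain ⟨hf, C, hC, h⟩ := hf
  refine ⟨continuous_const.mul hf, ‖a‖ * C, by positivity, fun z => ?_⟩
  rw [norm_mul, mul_assoc]
  exact mul_le_mul_of_nonneg_left (h z) (norm_nonneg _)

theorem mono (hf : Bd W f) {K : ℝ} (hK : 0 ≤ K) (h : ∀ z, W z ≤ K * W' z) : Bd W' f := by
  obtain ⟨hf, C, hC, hb⟩ := hf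
  refine ⟨hf, C * K, by positivity, fun z => (hb z).trans ?_⟩
  rw [mul_assoc]
  exact mul_le_mul_of_nonneg_left (h z) hC

theorem zero (hW : ∀ z, 0 ≤ W z) : Bd W fun _ => 0 :=
  ⟨continuous_const, 1, zero_le_one, fun z => by simpa using hW z⟩

end Bd

end Bounds

/-! ### Weighted bounds on all counted derivatives -/

section Regularity

variable {ι κ Z : Type*} [DecidableEq ι] [NormedAddCommGroup Z] [NormedSpace ℝ Z]

namespace Reg

variable {d : ι → κ → Z} {W W' : Z → ℝ} {c : ι → ℕ} {f g : Z → ℂ}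

theorem bd_add (hf : Reg d (Bd W) c f) (hg : Reg d (Bd W) c g) :
    Reg d (Bd W) c fun z => f z + g z :=
  hf.add hg fun _ _ => Bd.add

theorem bd_mono (hf : Reg d (Bd W) c f) {K : ℝ} (hK : 0 ≤ K) (h : ∀ z, W z ≤ K * W' z) :
    Reg d (Bd W') c f :=
  hf.mono_base fun _ hf => hf.mono hK h

theorem bd_const_mul (hf : Reg d (Bd W) c f) (a : ℂ) : Reg d (Bd W) c fun z => a * f z :=
  hf.map (d' := d) (fun f z => a * f z) (σ := id) Function.injective_id (τ := fun _ => id)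
    (fun _ hf => hf.const_mul a) fun _ _ _ _ _ _ _ h z => (h z).const_mul a

variable [Fintype ι]

theorem bd_mul (hf : Reg d (Bd W) c f) (hg : Reg d (Bd W') c g) :
    Reg d (Bd fun z => W z * W' z) c fun z => f z * g z :=
  hf.mul hg (fun _ _ => Bd.mul) fun _ _ => Bd.add

theorem bd_sum {α : Type*} (s : Finset α) {F : α → Z → ℂ} (hW : ∀ z, 0 ≤ W z)
    (hF : ∀ a ∈ s, Reg d (Bd W) c (F a)) : Reg d (Bd W) c fun z => ∑ a ∈ s, F a z := by
  classical
  induction s using Finset.induction_on with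
  | empty => simpa using of_invariant (Bd.zero hW) (Bd.zero hW) (by simp) c
  | insert a s ha ih =>
    simp only [Finset.sum_insert ha]
    exact (hF a (by simp)).bd_add (ih fun b hb => hF b (by simp [hb]))

end Reg

end Regularity

/-! ### The Japanese bracket -/

section Japanese

variable {n : ℕ}

theorem japanese_sq (ξ : E n) : japanese ξ ^ 2 = 1 + ‖ξ‖ ^ 2 := Real.sq_sqrt (by positivity)

theorem one_le_japanese (ξ : E n) : 1 ≤ japanese ξ := by
  rw [japanese, Real.one_le_sqrt]; nlinarith [sq_nonneg ‖ξ‖]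

theorem japanese_pos (ξ : E n) : 0 < japanese ξ := zero_lt_one.trans_le (one_le_japanese ξ)

theorem continuous_japanese : Continuous (japanese : E n → ℝ) := by
  unfold japanese; fun_prop

theorem norm_le_japanese (ξ : E n) : ‖ξ‖ ≤ japanese ξ :=
  Real.le_sqrt_of_sq_le (by linarith)

theorem japanese_inv_le_one (ξ : E n) : (japanese ξ)⁻¹ ≤ 1 := inv_le_one_of_one_le₀ (one_le_japanese ξ)

theorem japanese_inv_nonneg (ξ : E n) : 0 ≤ (japanese ξ)⁻¹ := inv_nonneg.2 (japanese_pos ξ).le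

end Japanese

/-! ### Integration by parts in oscillatory integrals -/

section IntegrationByParts

variable {n : ℕ}

/-- `⟨y⟩⁻²` -/
def bracketInv (y : E n) : ℂ := (((japanese y ^ 2)⁻¹ : ℝ) : ℂ)

/-- `y_j ⟨y⟩⁻²` -/
def coordInv (j : Fin n) (y : E n) : ℂ := ((y j * (japanese y ^ 2)⁻¹ : ℝ) : ℂ)

theorem bracketInv_add_sum (y : E n) : bracketInv y + ∑ j, (y j : ℂ) * coordInv j y = 1 := by
  have h : (japanese y ^ 2)⁻¹ + ∑ j, y j * (y j * (japanese y ^ 2)⁻¹) = 1 := by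
    have h1 : ∑ j, y j * (y j * (japanese y ^ 2)⁻¹) = ‖y‖ ^ 2 * (japanese y ^ 2)⁻¹ := by
      rw [EuclideanSpace.real_norm_sq_eq, Finset.sum_mul]
      exact Finset.sum_congr rfl fun j _ => by ring
    rw [h1, ← one_add_mul, ← japanese_sq]
    exact mul_inv_cancel₀ (pow_pos (japanese_pos y) 2).ne'
  simp only [bracketInv, coordInv]
  exact_mod_cast congrArg (fun r : ℝ => (r : ℂ)) h

theorem continuous_bracketInv : Continuous (bracketInv : E n → ℂ) :=
  Complex.continuous_ofReal.comp ((continuous_japanese.pow 2).inv₀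
    fun y => (pow_pos (japanese_pos y) 2).ne')

theorem continuous_coordInv (j : Fin n) : Continuous (coordInv j : E n → ℂ) :=
  Complex.continuous_ofReal.comp ((by fun_prop : Continuous fun y : E n => y j).mul
    ((continuous_japanese.pow 2).inv₀ fun y => (pow_pos (japanese_pos y) 2).ne'))

theorem norm_bracketInv_le (y : E n) : ‖bracketInv y‖ ≤ (japanese y)⁻¹ := by
  rw [bracketInv, Complex.norm_real, Real.norm_eq_abs, abs_of_nonneg (by positivity)]
  exact inv_anti₀ (japanese_pos y) (by nlinarith [one_le_japanese y])

theorem norm_coordInv_le (j : Fin n) (y : E n) : ‖coordInv j y‖ ≤ (japanese y)⁻¹ := by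
  rw [coordInv, Complex.norm_real, norm_mul, Real.norm_eq_abs (_⁻¹),
    abs_of_nonneg (by positivity : (0 : ℝ) ≤ (japanese y ^ 2)⁻¹)]
  have := japanese_pos y
  calc ‖y j‖ * (japanese y ^ 2)⁻¹ ≤ japanese y * (japanese y ^ 2)⁻¹ := by
        gcongr; exact (PiLp.norm_apply_le y j).trans (norm_le_japanese y)
    _ = (japanese y)⁻¹ := by field_simp

theorem hasLineDerivAt_bracketInv (y e : E n) : HasLineDerivAt ℝ bracketInv
    (∑ l, (-2 * e l : ℂ) * (coordInv l y * bracketInv y)) y e := by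
  have h1 : HasFDerivAt (fun y : E n => japanese y ^ 2) (2 • innerSL ℝ y) y := by
    simp only [japanese_sq]
    exact (hasStrictFDerivAt_norm_sq y).hasFDerivAt.const_add 1
  have h2 := (h1.hasLineDerivAt e).inv (by simpa using (pow_pos (japanese_pos y) 2).ne')
  have h3 := h2.ofReal_comp
  simp only [zero_smul, add_zero] at h3
  refine HasDerivAt.congr_deriv h3 ?_
  simp only [coordInv, bracketInv]
  have h4 : inner ℝ y e = ∑ l, e l * y l := by simp [PiLp.inner_apply]
  simp only [smul_apply, innerSL_apply_apply, h4, nsmul_eq_mul]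
  push_cast
  simp only [neg_div, mul_div_assoc, Finset.sum_div, Finset.mul_sum, ← Finset.sum_neg_distrib]
  refine Finset.sum_congr rfl fun l _ => ?_
  rw [div_eq_mul_inv, ← inv_pow]
  ring

theorem hasLineDerivAt_coordInv (j : Fin n) (y e : E n) : HasLineDerivAt ℝ (coordInv j)
    ((e j : ℂ) * bracketInv y + ∑ l, (-2 * e l : ℂ) * (coordInv l y * coordInv j y)) y e := by
  have h1 : HasDerivAt (fun t : ℝ => (((y + t • e) j : ℝ) : ℂ)) (e j : ℂ) 0 := by
    have : HasDerivAt (fun t : ℝ => (y + t • e) j) (e j) 0 := by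
      simpa using ((hasDerivAt_id (0 : ℝ)).mul_const (e j)).const_add (y j)
    exact this.ofReal_comp
  have h2 := h1.mul (hasLineDerivAt_bracketInv y e)
  have h3 : (coordInv j : E n → ℂ) = fun y => ((y j : ℝ) : ℂ) * bracketInv y := by
    ext y; simp [coordInv, bracketInv]
  rw [h3]
  refine HasDerivAt.congr_deriv h2 ?_
  simp only [zero_smul, add_zero, Finset.mul_sum]
  congr 1
  exact Finset.sum_congr rfl fun l _ => by ring

variable {ι Z : Type*} [NormedAddCommGroup Z] [NormedSpace ℝ Z]

/-- `π` is continuous, and affine in the directions `d`. -/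
def AffineAlong (d : ι → Fin n → Z) (π : Z → E n) : Prop :=
  Continuous π ∧ ∀ i j, ∃ e, ∀ (z : Z) (t : ℝ), π (z + t • d i j) = π z + t • e

variable [DecidableEq ι]

/-- The derivatives of `⟨π⟩⁻²` and `π_l ⟨π⟩⁻²` along affine directions are polynomials in these same
functions, so both families are handled by one induction. Only one power of decay is recorded, and
differentiation does not destroy it. -/
theorem AffineAlong.reg_weights [Fintype ι] {d : ι → Fin n → Z} {π : Z → E n}
    (h : AffineAlong d π) (c : ι → ℕ) :
    Reg d (Bd fun z => (japanese (π z))⁻¹) c (fun z => bracketInv (π z)) ∧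
      ∀ l, Reg d (Bd fun z => (japanese (π z))⁻¹) c (fun z => coordInv l (π z)) := by
  have hn : ∀ z, 0 ≤ (japanese (π z))⁻¹ := fun z => japanese_inv_nonneg _
  have hm : ∀ z, (japanese (π z))⁻¹ * (japanese (π z))⁻¹ ≤ 1 * (japanese (π z))⁻¹ := fun z =>
    mul_le_mul_of_nonneg_right (japanese_inv_le_one _) (hn z)
  induction c using count_induction with
  | _ c ih =>
    constructor
    · refine Reg.of_hasLineDerivAt ⟨continuous_bracketInv.comp h.1, 1, zero_le_one, fun z => by
        simpa using norm_bracketInv_le (π z)⟩ fun i j hi => ?_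
      obtain ⟨e, he⟩ := h.2 i j
      refine ⟨_, fun z => ?_, Reg.bd_sum Finset.univ hn (F := fun l z =>
        (-2 * e l : ℂ) * (coordInv l (π z) * bracketInv (π z))) fun l _ =>
          Reg.bd_const_mul ((((ih i hi).2 l).bd_mul (ih i hi).1).bd_mono zero_le_one hm) _⟩
      simp only [HasLineDerivAt, he]
      exact hasLineDerivAt_bracketInv (π z) e
    · intro k
      refine Reg.of_hasLineDerivAt ⟨(continuous_coordInv k).comp h.1, 1, zero_le_one, fun z => by
        simpa using norm_coordInv_le k (π z)⟩ fun i j hi => ?_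
      obtain ⟨e, he⟩ := h.2 i j
      refine ⟨_, fun z => ?_, ((ih i hi).1.bd_const_mul (e k : ℂ)).bd_add
        (Reg.bd_sum Finset.univ hn (F := fun l z =>
        (-2 * e l : ℂ) * (coordInv l (π z) * coordInv k (π z))) fun l _ =>
          Reg.bd_const_mul ((((ih i hi).2 l).bd_mul ((ih i hi).2 k)).bd_mono zero_le_one hm) _)⟩
      simp only [HasLineDerivAt, he]
      exact hasLineDerivAt_coordInv k (π z) e

/-- The transpose of the operator `⟨π⟩⁻² (1 + i π · ∂)`, where `∂ = (∂_{d j})_j`. -/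
def ibpOp (π : Z → E n) (d : Fin n → Z) (F : Z → ℂ) (z : Z) : ℂ :=
  bracketInv (π z) * F z +
    ∑ j, -Complex.I * (coordInv j (π z) * lineDeriv ℝ F z (d j))

theorem Reg.ibpOp [Fintype ι] {d : ι → Fin n → Z} {π : Z → E n} {W : Z → ℝ} {c : ι → ℕ}
    {F : Z → ℂ} (hF : Reg d (Bd W) c F) (hπ : AffineAlong d π) (hW : ∀ z, 0 ≤ W z) {i : ι}
    (hi : 0 < c i) :
    Reg d (Bd fun z => (japanese (π z))⁻¹ * W z) (c - Pi.single i 1) (ibpOp π (d i) F) := by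
  obtain ⟨h1, h2⟩ := hπ.reg_weights (c - Pi.single i 1)
  exact (h1.bd_mul (hF.mono_count tsub_le_self)).bd_add (Reg.bd_sum _
    (fun z => mul_nonneg (japanese_inv_nonneg _) (hW z))
    fun j _ => ((h2 j).bd_mul (hF.step hi j)).bd_const_mul _)

/-- Iterated integration by parts. -/
def ibpOps (d : ι → Fin n → Z) : List ((Z → E n) × ι) → (Z → ℂ) → Z → ℂ
  | [], F => F
  | o :: l, F => ibpOp o.1 (d o.2) (ibpOps d l F)

/-- The number of derivatives of each family which are used by `ibpOps`. -/
def ibpCount : List ((Z → E n) × ι) → ι → ℕ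
  | [] => 0
  | o :: l => Pi.single o.2 1 + ibpCount l

/-- The decay which is gained by `ibpOps`. -/
def ibpWeight : List ((Z → E n) × ι) → Z → ℝ
  | [], _ => 1
  | o :: l, z => (japanese (o.1 z))⁻¹ * ibpWeight l z

theorem ibpWeight_nonneg {Z ι : Type*} (l : List ((Z → E n) × ι)) (z : Z) : 0 ≤ ibpWeight l z := by
  induction l with
  | nil => exact zero_le_one
  | cons o l ih => exact mul_nonneg (japanese_inv_nonneg _) ih

theorem ibpWeight_le_one {Z ι : Type*} (l : List ((Z → E n) × ι)) (z : Z) : ibpWeight l z ≤ 1 := by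
  induction l with
  | nil => exact le_rfl
  | cons o l ih => exact mul_le_one₀ (japanese_inv_le_one _) (ibpWeight_nonneg _ _) ih

theorem Reg.ibpOps [Fintype ι] {d : ι → Fin n → Z} {W : Z → ℝ} {c : ι → ℕ} {F : Z → ℂ}
    (l : List ((Z → E n) × ι)) (hl : ∀ o ∈ l, AffineAlong d o.1) (hW : ∀ z, 0 ≤ W z)
    (hF : Reg d (Bd W) (c + ibpCount l) F) :
    Reg d (Bd fun z => ibpWeight l z * W z) c (ibpOps d l F) := by
  induction l generalizing c with
  | nil => simpa [ibpWeight, PsiDO.ibpOps, ibpCount] using hF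
  | cons o l ih =>
    have h1 := ih (c := c + Pi.single o.2 1) (fun o ho => hl o (by simp [ho]))
      (by rwa [ibpCount, ← add_assoc] at hF)
    have h2 := h1.ibpOp (hl o (by simp)) (fun z => mul_nonneg (ibpWeight_nonneg _ _) (hW z))
      (i := o.2) (by simp)
    rw [add_tsub_cancel_right] at h2
    exact h2.bd_mono zero_le_one fun z => by simp [ibpWeight, mul_assoc]

/-- `osc` is an oscillatory factor for which the integrations by parts `l` are exact. -/
structure IsOsc (d : ι → Fin n → Z) (l : List ((Z → E n) × ι)) (osc : Z → ℂ) : Prop where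
  continuous : Continuous osc
  norm_eq : ∀ z, ‖osc z‖ = 1
  deriv : ∀ o ∈ l, ∀ j z,
    HasLineDerivAt ℝ osc (-Complex.I * (o.1 z j : ℂ) * osc z) z (d o.2 j)
  inv : ∀ o ∈ l, ∀ j z (t : ℝ), o.1 (z + t • d o.2 j) = o.1 z
  affine : ∀ o ∈ l, AffineAlong d o.1

end IntegrationByParts

/-! ### Exactness of integration by parts for integrable amplitudes -/

section Integrals

theorem Bd.integrable {V : Type*} [TopologicalSpace V] [MeasurableSpace V]
    [OpensMeasurableSpace V] {μ : Measure V} {W : V → ℝ} {f : V → ℂ} (hf : Bd W f) (hW : Integrable W μ) :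
    Integrable f μ := by
  obtain ⟨hf, C, -, h⟩ := hf
  exact (hW.const_mul C).mono' hf.aestronglyMeasurable (Eventually.of_forall h)

theorem Bd.bounded_mul {V : Type*} [TopologicalSpace V] {W : V → ℝ} {f g : V → ℂ} (hf : Bd W f) (hg : Continuous g)
    (hg1 : ∀ z, ‖g z‖ ≤ 1) : Bd W fun z => g z * f z := by
  obtain ⟨hf, C, hC, h⟩ := hf
  refine ⟨hg.mul hf, C, hC, fun z => ?_⟩
  rw [norm_mul]
  exact (mul_le_of_le_one_left (norm_nonneg _) (hg1 z)).trans (h z)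

variable {n : ℕ} {ι V : Type*} [DecidableEq ι] [NormedAddCommGroup V]
  [NormedSpace ℝ V] [FiniteDimensional ℝ V] [MeasurableSpace V] [BorelSpace V] {μ : Measure V}

variable [μ.IsAddHaarMeasure]

/-- Split `F` by the identity `⟨π⟩⁻² + ∑ π_j · π_j ⟨π⟩⁻² = 1`. In the `j`-th summand `π_j osc = i
∂_j osc`, and the derivative is moved to `F` alone because the weight is constant in this direction.
The bound by the integrable `W` excludes boundary terms. -/
theorem IsOsc.integral_ibpOp {d : ι → Fin n → V} {l : List ((V → E n) × ι)} {osc : V → ℂ}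
    (ho : IsOsc d l osc) {o : (V → E n) × ι} (hol : o ∈ l) {W : V → ℝ} (hW : Integrable W μ)
    {c : ι → ℕ} {F : V → ℂ} (hF : Reg d (Bd W) c F) (hc : 0 < c o.2) :
    ∫ z, osc z * F z ∂μ = ∫ z, osc z * ibpOp o.1 (d o.2) F z ∂μ := by
  obtain ⟨π, i⟩ := o
  have hπ : Continuous π := (ho.affine _ hol).1
  have hosc1 : ∀ z, ‖osc z‖ ≤ 1 := fun z => (ho.norm_eq z).le
  have hw : ∀ j, Continuous fun z => coordInv j (π z) := fun j => (continuous_coordInv j).comp hπ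
  have hw1 : ∀ j z, ‖coordInv j (π z)‖ ≤ 1 := fun j z =>
    (norm_coordInv_le j _).trans (japanese_inv_le_one _)
  have hpw1 : ∀ j z, ‖(π z j : ℂ) * coordInv j (π z)‖ ≤ 1 := fun j z => by
    rw [norm_mul, Complex.norm_real]
    have h1 := (PiLp.norm_apply_le (π z) j).trans (norm_le_japanese (π z))
    calc _ ≤ japanese (π z) * (japanese (π z))⁻¹ :=
          mul_le_mul h1 (norm_coordInv_le j _) (norm_nonneg _) (japanese_pos _).le
      _ = 1 := mul_inv_cancel₀ (japanese_pos _).ne'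
  have hpw : ∀ j, Continuous fun z => (π z j : ℂ) * coordInv j (π z) := fun j =>
    (by fun_prop : Continuous fun z => (π z j : ℂ)).mul (hw j)
  have hIF : ∀ j, Integrable (fun z => osc z * ((π z j : ℂ) * coordInv j (π z) * F z)) μ :=
    fun j => ((hF.base.bounded_mul (hpw j) (hpw1 j)).bounded_mul ho.continuous hosc1).integrable hW
  have hID : ∀ j, Integrable (fun z => osc z * (coordInv j (π z) * lineDeriv ℝ F z (d i j))) μ :=
    fun j => (((hF.step hc j).base.bounded_mul (hw j) (hw1 j)).bounded_mul ho.continuous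
      hosc1).integrable hW
  have hI0 : ∀ j, Integrable (fun z => osc z * coordInv j (π z) * F z) μ := fun j => by
    simpa only [mul_assoc] using
      ((hF.base.bounded_mul (hw j) (hw1 j)).bounded_mul ho.continuous hosc1).integrable hW
  have hparts : ∀ j, ∫ z, osc z * (coordInv j (π z) * lineDeriv ℝ F z (d i j)) ∂μ =
      Complex.I * ∫ z, osc z * ((π z j : ℂ) * coordInv j (π z) * F z) ∂μ := by
    intro j
    have hL : ∀ z, HasLineDerivAt ℝ (fun z => osc z * coordInv j (π z))
        (-Complex.I * (π z j : ℂ) * osc z * coordInv j (π z)) z (d i j) := fun z => by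
      have hinv := ho.inv _ hol j z
      simp only at hinv
      simp only [HasLineDerivAt, hinv]
      exact HasDerivAt.mul_const (ho.deriv _ hol j z) _
    have h := integral_bilinear_hasLineDerivAt_right_eq_neg_left_of_integrable (μ := μ)
      (B := ContinuousLinearMap.mul ℝ ℂ) (v := d i j) (f := fun z => osc z * coordInv j (π z))
      (f' := fun z => -Complex.I * (π z j : ℂ) * osc z * coordInv j (π z))
      (g := F) (g' := fun z => lineDeriv ℝ F z (d i j))
      (by simpa [mul_assoc, mul_left_comm] using ((hIF j).const_mul (-Complex.I)))
      (by simpa [mul_assoc] using hID j) (by simpa [mul_assoc] using hI0 j)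
      (fun z _ => hL z) (fun z _ => hF.hasLineDerivAt hc j z)
    simp only [ContinuousLinearMap.mul_apply', mul_assoc] at h
    rw [h, ← integral_const_mul, ← integral_neg]
    refine integral_congr_ae (Eventually.of_forall fun z => ?_)
    simp only
    ring
  have hv : Integrable (fun z => osc z * (bracketInv (π z) * F z)) μ :=
    ((hF.base.bounded_mul (continuous_bracketInv.comp hπ) fun z =>
      (norm_bracketInv_le _).trans (japanese_inv_le_one _)).bounded_mul ho.continuous
        hosc1).integrable hW
  calc ∫ z, osc z * F z ∂μ
      = ∫ z, (osc z * (bracketInv (π z) * F z) +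
          ∑ j, osc z * ((π z j : ℂ) * coordInv j (π z) * F z)) ∂μ := by
        refine integral_congr_ae (Eventually.of_forall fun z => ?_)
        simp only
        rw [← Finset.mul_sum, ← Finset.sum_mul, ← mul_add, ← add_mul, bracketInv_add_sum, one_mul]
    _ = ∫ z, osc z * (bracketInv (π z) * F z) ∂μ +
          ∑ j, -Complex.I * ∫ z, osc z * (coordInv j (π z) * lineDeriv ℝ F z (d i j)) ∂μ := by
        rw [integral_add hv (integrable_finsetSum _ fun j _ => hIF j),
          integral_finsetSum _ fun j _ => hIF j]
        congr 1
        refine Finset.sum_congr rfl fun j _ => ?_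
        rw [hparts, ← mul_assoc, neg_mul, Complex.I_mul_I, neg_neg, one_mul]
    _ = ∫ z, (osc z * (bracketInv (π z) * F z) +
          ∑ j, -Complex.I * (osc z * (coordInv j (π z) * lineDeriv ℝ F z (d i j)))) ∂μ := by
        rw [integral_add hv (integrable_finsetSum _ fun j _ => (hID j).const_mul _),
          integral_finsetSum _ fun j _ => (hID j).const_mul _]
        simp only [integral_const_mul]
    _ = ∫ z, osc z * ibpOp π (d i) F z ∂μ := by
        refine integral_congr_ae (Eventually.of_forall fun z => ?_)
        simp only [ibpOp, mul_add, Finset.mul_sum]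
        congr 1
        exact Finset.sum_congr rfl fun j _ => by ring

theorem IsOsc.integral_ibpOps [Fintype ι] {d : ι → Fin n → V} {l : List ((V → E n) × ι)} {osc : V → ℂ}
    (ho : IsOsc d l osc) {W : V → ℝ} (hW : Integrable W μ) (hW0 : ∀ z, 0 ≤ W z)
    {F : V → ℂ} (hF : Reg d (Bd W) (ibpCount l) F) :
    ∫ z, osc z * F z ∂μ = ∫ z, osc z * ibpOps d l F z ∂μ := by
  induction l with
  | nil => rfl
  | cons o l ih =>
    have ho' : IsOsc d l osc := ⟨ho.continuous, ho.norm_eq, fun o h => ho.deriv o (by simp [h]),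
      fun o h => ho.inv o (by simp [h]), fun o h => ho.affine o (by simp [h])⟩
    rw [ih ho' (hF.mono_count le_add_self)]
    -- The gained decay is discarded here: all weights are at most `1`, so the same integrable `W`
    -- dominates at every stage.
    have h1 : Reg d (Bd W) (Pi.single o.2 1) (ibpOps d l F) :=
      (hF.ibpOps l (fun o h => ho'.affine o h) hW0).bd_mono zero_le_one fun z => by
        rw [one_mul]
        exact mul_le_of_le_one_left (hW0 z) (ibpWeight_le_one l z)
    exact ho.integral_ibpOp (by simp) hW h1 (by simp)

end Integrals

/-! ### Oscillatory integrals with parameters -/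

section Pullback

variable {n : ℕ} {ι Z Z' : Type*} [DecidableEq ι] [NormedAddCommGroup Z] [NormedSpace ℝ Z]
  [NormedAddCommGroup Z'] [NormedSpace ℝ Z']

/-- The pullback of a list of integrations by parts. -/
def pullOps {ι Z Z' : Type*} (φ : Z' → Z) (l : List ((Z → E n) × ι)) : List ((Z' → E n) × ι) :=
  l.map fun o => (o.1 ∘ φ, o.2)

theorem ibpCount_pullOps (φ : Z' → Z) (l : List ((Z → E n) × ι)) :
    ibpCount (pullOps φ l) = ibpCount l := by
  induction l with
  | nil => rfl
  | cons o l ih => simp only [pullOps, List.map_cons, ibpCount] at ih ⊢; rw [ih]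

theorem ibpWeight_pullOps (φ : Z' → Z) (l : List ((Z → E n) × ι)) (z : Z') :
    ibpWeight (pullOps φ l) z = ibpWeight l (φ z) := by
  induction l with
  | nil => rfl
  | cons o l ih =>
    simp only [pullOps, List.map_cons, ibpWeight, Function.comp_apply] at ih ⊢; rw [ih]

/-- Compatibility is required only for the directions that occur in `l`. This covers both the
inclusion of a slice and the projections that separate the factors of an integrand. -/
theorem ibpOps_pullOps {d : ι → Fin n → Z} {d' : ι → Fin n → Z'} {φ : Z' → Z}
    {l : List ((Z → E n) × ι)}
    (hφ : ∀ o ∈ l, ∀ j z (t : ℝ), φ (z + t • d' o.2 j) = φ z + t • d o.2 j) (F : Z → ℂ) (z : Z') :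
    ibpOps d' (pullOps φ l) (fun z => F (φ z)) z = ibpOps d l F (φ z) := by
  induction l generalizing z with
  | nil => rfl
  | cons o l ih =>
    have ih' := funext (ih fun o ho => hφ o (by simp [ho]))
    simp only [pullOps, List.map_cons, ibpOps] at ih' ⊢
    rw [ih']
    simp only [ibpOp, Function.comp_apply, lineDeriv, hφ o (by simp)]

theorem IsOsc.comp {d : ι → Fin n → Z} {d' : ι → Fin n → Z'} {φ : Z' → Z} {osc : Z → ℂ}
    {l : List ((Z → E n) × ι)} (h : IsOsc d l osc) (hφc : Continuous φ)
    (hφ : ∀ i j z (t : ℝ), φ (z + t • d' i j) = φ z + t • d i j) :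
    IsOsc d' (pullOps φ l) (fun z => osc (φ z)) where
  continuous := h.continuous.comp hφc
  norm_eq z := h.norm_eq _
  deriv := by
    simp only [pullOps, List.mem_map, forall_exists_index, and_imp, forall_apply_eq_imp_iff₂]
    intro o ho j z
    simp only [HasLineDerivAt, hφ]
    exact h.deriv o ho j (φ z)
  inv := by
    simp only [pullOps, List.mem_map, forall_exists_index, and_imp, forall_apply_eq_imp_iff₂]
    intro o ho j z t
    simp only [Function.comp_apply, hφ]
    exact h.inv o ho j (φ z) t
  affine := by
    simp only [pullOps, List.mem_map, forall_exists_index, and_imp, forall_apply_eq_imp_iff₂]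
    intro o ho
    refine ⟨(h.affine o ho).1.comp hφc, fun i j => ?_⟩
    obtain ⟨e, he⟩ := (h.affine o ho).2 i j
    exact ⟨e, fun z t => by simp only [Function.comp_apply, hφ, he]⟩

theorem Reg.comp {d : ι → Fin n → Z} {d' : ι → Fin n → Z'} {φ : Z' → Z} {B : (Z → ℂ) → Prop}
    {B' : (Z' → ℂ) → Prop} {c : ι → ℕ} {F : Z → ℂ} (h : Reg d B c F)
    (hφ : ∀ i, 0 < c i → ∀ j z (t : ℝ), φ (z + t • d' i j) = φ z + t • d i j)
    (hB : ∀ f, B f → B' fun z => f (φ z)) : Reg d' B' c fun z => F (φ z) :=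
  h.map (d' := d') (fun f z => f (φ z)) (σ := id) Function.injective_id (τ := fun _ => id) hB
    fun f g i j hi _ _ hfg z => by
      simp only [HasLineDerivAt, hφ i hi]; exact hfg (φ z)

theorem Bd.comp {Z Z' : Type*} [TopologicalSpace Z] [TopologicalSpace Z'] {W : Z → ℝ} {f : Z → ℂ}
    (h : Bd W f) {φ : Z' → Z} (hφ : Continuous φ) : Bd (fun z => W (φ z)) fun z => f (φ z) :=
  ⟨h.1.comp hφ, h.2.imp fun _ hC => ⟨hC.1, fun z => hC.2 (φ z)⟩⟩

/-- Integrations by parts commute with derivatives in the directions of the parameters. -/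
theorem hasLineDerivAt_ibpOps [Fintype ι] {d : ι → Fin n → Z} {l : List ((Z → E n) × ι)}
    (hl : ∀ o ∈ l, AffineAlong d o.1) {v : Z} (hv : ∀ o ∈ l, ∀ z (t : ℝ), o.1 (z + t • v) = o.1 z)
    {W W' : Z → ℝ} (hW : ∀ z, 0 ≤ W z) (hW' : ∀ z, 0 ≤ W' z) {F G : Z → ℂ}
    (hF : Reg d (Bd W) (ibpCount l) F)
    (hG : Reg d (Bd W') (ibpCount l) G) (hFG : ∀ z, HasLineDerivAt ℝ F (G z) z v) (z : Z) :
    HasLineDerivAt ℝ (ibpOps d l F) (ibpOps d l G z) z v := by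
  induction l generalizing z with
  | nil => exact hFG z
  | cons o l ih =>
    have hl' : ∀ o ∈ l, AffineAlong d o.1 := fun o ho => hl o (by simp [ho])
    have ih' := ih hl' (fun o ho => hv o (by simp [ho])) (hF.mono_count le_add_self)
      (hG.mono_count le_add_self)
    have hF' := hF.ibpOps l hl' hW
    have hG' := hG.ibpOps l hl' hW'
    have ho : 0 < (Pi.single o.2 1 : ι → ℕ) o.2 := by simp
    simp only [ibpOps, ibpOp, HasLineDerivAt, hv o (by simp)]
    refine HasDerivAt.add ((ih' z).const_mul _) (HasDerivAt.fun_sum fun j _ => ?_)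
    refine HasDerivAt.const_mul _ (HasDerivAt.const_mul _ ?_)
    -- Differentiability in the direction `v` of a derivative of `ibpOps d l F` is not assumed; it
    -- is part of the conclusion of the interchange.
    exact hasLineDerivAt_swap ih' (fun z => hF'.hasLineDerivAt ho j z)
      (fun z => hG'.hasLineDerivAt ho j z) hG'.base.1 (hG'.step ho j).base.1 z

theorem ibpOps_sub [Fintype ι] {d : ι → Fin n → Z} {l : List ((Z → E n) × ι)}
    (hl : ∀ o ∈ l, AffineAlong d o.1) {W W' : Z → ℝ} (hW : ∀ z, 0 ≤ W z) (hW' : ∀ z, 0 ≤ W' z)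
    {F G : Z → ℂ} (hF : Reg d (Bd W) (ibpCount l) F) (hG : Reg d (Bd W') (ibpCount l) G) (z : Z) :
    ibpOps d l (fun z => F z - G z) z = ibpOps d l F z - ibpOps d l G z := by
  induction l generalizing z with
  | nil => rfl
  | cons o l ih =>
    have hl' : ∀ o ∈ l, AffineAlong d o.1 := fun o ho => hl o (by simp [ho])
    have ih' := funext (ih hl' (hF.mono_count le_add_self) (hG.mono_count le_add_self))
    have hF' := hF.ibpOps l hl' hW
    have hG' := hG.ibpOps l hl' hW'
    have ho : 0 < (Pi.single o.2 1 : ι → ℕ) o.2 := by simp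
    have hsub : ∀ j, lineDeriv ℝ (fun z => ibpOps d l F z - ibpOps d l G z) z (d o.2 j) =
        lineDeriv ℝ (ibpOps d l F) z (d o.2 j) - lineDeriv ℝ (ibpOps d l G) z (d o.2 j) :=
      fun j => HasLineDerivAt.lineDeriv
        (HasDerivAt.sub (hF'.hasLineDerivAt ho j z) (hG'.hasLineDerivAt ho j z))
    simp only [ibpOps, ibpOp, ih', hsub, mul_sub, Finset.sum_sub_distrib]
    ring

end Pullback

/-! ### Continuity and differentiation of parameter integrals -/

section Parameters

variable {P V : Type*} [NormedAddCommGroup P] [NormedSpace ℝ P] [NormedAddCommGroup V]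
  [NormedSpace ℝ V] [MeasurableSpace V] [BorelSpace V] [SecondCountableTopology V]
  {μ : Measure V} {ω : P → ℝ} {W : V → ℝ}

theorem Bd.integrable_slice {G : P × V → ℂ} (hG : Bd (fun z => ω z.1 * W z.2) G)
    (hW : Integrable W μ) (p : P) : Integrable (fun w => G (p, w)) μ :=
  (hG.comp (φ := fun w => (p, w)) (by fun_prop)).integrable (hW.const_mul (ω p))

/-- With a bound in product form, dominated convergence is immediate: continuity of `ω` gives `ω q <
ω p + 1` near `p`, and a multiple of `W` dominates. -/
theorem Bd.integral {G : P × V → ℂ} (hG : Bd (fun z => ω z.1 * W z.2) G) (hω : Continuous ω)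
    (hW : Integrable W μ) (hW0 : ∀ w, 0 ≤ W w) : Bd ω fun p => ∫ w, G (p, w) ∂μ := by
  have hint := hG.integrable_slice hW
  obtain ⟨hG, C, hC, h⟩ := hG
  refine ⟨continuous_iff_continuousAt.2 fun p => ?_, C * ∫ w, W w ∂μ, mul_nonneg hC
    (integral_nonneg hW0), fun p => ?_⟩
  · refine continuousAt_of_dominated (bound := fun w => C * ((ω p + 1) * W w))
      (Eventually.of_forall fun q => (hint q).1) ?_ ((hW.const_mul _).const_mul _)
      (Eventually.of_forall fun w => by fun_prop)
    filter_upwards [hω.continuousAt.eventually_lt continuousAt_const (lt_add_one (ω p))] with q hq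
    refine Eventually.of_forall fun w => (h (q, w)).trans ?_
    have := hW0 w
    dsimp only
    gcongr
  · refine (norm_integral_le_of_norm_le ((hW.const_mul (ω p)).const_mul C)
      (Eventually.of_forall fun w => h (p, w))).trans (le_of_eq ?_)
    rw [integral_const_mul, integral_const_mul]
    ring

theorem Bd.hasLineDerivAt_integral {G G' : P × V → ℂ} (hG : Bd (fun z => ω z.1 * W z.2) G)
    (hG' : Bd (fun z => ω z.1 * W z.2) G') (hω : Continuous ω) (hW : Integrable W μ)
    (hW0 : ∀ w, 0 ≤ W w) {v : P} (h : ∀ z, HasLineDerivAt ℝ G (G' z) z (v, 0)) (p : P) :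
    HasLineDerivAt ℝ (fun p => ∫ w, G (p, w) ∂μ) (∫ w, G' (p, w) ∂μ) p v := by
  have hint := hG.integrable_slice hW
  have hint' := hG'.integrable_slice hW
  obtain ⟨-, C, hC, hb⟩ := hG'
  have hs : {t : ℝ | ω (p + t • v) < ω p + 1} ∈ 𝓝 (0 : ℝ) := by
    have : Continuous fun t : ℝ => ω (p + t • v) := by fun_prop
    exact this.continuousAt.eventually_lt continuousAt_const (by simp)
  have := (hasDerivAt_integral_of_dominated_loc_of_deriv_le (μ := μ) hs
    (F := fun t w => G (p + t • v, w)) (F' := fun t w => G' (p + t • v, w))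
    (bound := fun w => C * ((ω p + 1) * W w))
    (Eventually.of_forall fun t => (hint _).1) (hint _) (hint' _).1
    (Eventually.of_forall fun w t ht => (hb _).trans (by
      have := hW0 w
      have : ω (p + t • v) < ω p + 1 := ht
      dsimp only
      gcongr)) ((hW.const_mul _).const_mul _)
    (Eventually.of_forall fun w t _ => by
      have h1 := hasDerivAt_line (z := (p, w)) (t := t) (h _)
      simpa using h1)).2
  simp only [zero_smul, add_zero] at this
  exact this

end Parameters

/-! ### Regularised oscillatory integrals -/

section Regularisation

variable {n : ℕ} {ι P V : Type*} [DecidableEq ι] [Fintype ι] [NormedAddCommGroup V]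
  [NormedSpace ℝ V] [NormedAddCommGroup P] [NormedSpace ℝ P]

/-- The directions `d` on a space with additional parameters. -/
def liftDir (P : Type*) [NormedAddCommGroup P] (d : ι → Fin n → V) : ι → Fin n → P × V :=
  fun i j => (0, d i j)

theorem snd_add_liftDir (d : ι → Fin n → V) (i : ι) (j : Fin n) (z : P × V) (t : ℝ) :
    (z + t • liftDir P d i j).2 = z.2 + t • d i j := by simp [liftDir]

theorem fst_add_liftDir (d : ι → Fin n → V) (i : ι) (j : Fin n) (z : P × V) (t : ℝ) :
    (z + t • liftDir P d i j).1 = z.1 := by simp [liftDir]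

theorem slice_add (d : ι → Fin n → V) (p : P) (i : ι) (j : Fin n) (w : V) (t : ℝ) :
    (p, w + t • d i j) = (p, w) + t • liftDir P d i j := by
  simp [liftDir]

theorem pullOps_slice_snd (p : P) (l : List ((V → E n) × ι)) :
    pullOps (fun w => (p, w)) (pullOps (Prod.snd : P × V → V) l) = l := by
  simp [pullOps, Function.comp_def]

theorem ibpOps_slice (d : ι → Fin n → V) (l : List ((V → E n) × ι)) (F : P × V → ℂ) (p : P)
    (w : V) : ibpOps (liftDir P d) (pullOps Prod.snd l) F (p, w) =
      ibpOps d l (fun w => F (p, w)) w := by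
  have := ibpOps_pullOps (d := liftDir P d) (d' := d) (φ := fun w => (p, w))
    (l := pullOps Prod.snd l) (fun o _ j z t => slice_add d p o.2 j z t) F w
  rw [← this, pullOps_slice_snd]

theorem hasLineDerivAt_schwartz_scaled (χ : 𝓢(V, ℂ)) (v w : V) (ε : ℝ) :
    HasLineDerivAt ℝ (fun w => χ (ε • w)) (ε * LineDeriv.lineDerivOp v χ (ε • w)) w v := by
  have h1 : HasLineDerivAt ℝ χ (LineDeriv.lineDerivOp v χ (ε • w)) (ε • w) v := by
    rw [SchwartzMap.lineDerivOp_apply]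
    exact (χ.differentiableAt).lineDifferentiableAt.hasLineDerivAt
  have h2 := h1.smul ε
  simp only [HasLineDerivAt, Complex.real_smul] at h2 ⊢
  refine h2.congr_of_eventuallyEq (Eventually.of_forall fun t => ?_)
  simp only [smul_add, smul_comm ε t v]

theorem schwartz_le_one_add_norm (χ : 𝓢(V, ℂ)) (R : ℕ) :
    ∃ C : ℝ, 0 ≤ C ∧ ∀ w, ‖χ w‖ ≤ C * ((1 + ‖w‖) ^ R)⁻¹ := by
  refine ⟨2 ^ R * (Finset.Iic (R, 0)).sup (fun m => SchwartzMap.seminorm ℝ m.1 m.2) χ,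
    by positivity, fun w => ?_⟩
  have := SchwartzMap.one_add_le_sup_seminorm_apply (𝕜 := ℝ) (m := (R, 0)) (k := R) (n := 0) le_rfl
    le_rfl χ w
  rw [norm_iteratedFDeriv_zero] at this
  rwa [← div_eq_mul_inv, le_div_iff₀ (by positivity), mul_comm]

theorem reg_schwartz_scaled (d : ι → Fin n → V) {ε : ℝ} (hε : 0 < ε) (R : ℕ) (c : ι → ℕ)
    (χ : 𝓢(V, ℂ)) : Reg d (Bd fun w => ((1 + ‖w‖) ^ R)⁻¹) c fun w => χ (ε • w) := by
  induction c using count_induction generalizing χ with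
  | _ c ih =>
    refine Reg.of_hasLineDerivAt ?_ fun i j hi => ⟨_, fun w =>
      hasLineDerivAt_schwartz_scaled χ _ w ε, (ih i hi _).bd_const_mul _⟩
    obtain ⟨C, hC, h⟩ := schwartz_le_one_add_norm χ R
    refine ⟨χ.continuous.comp (continuous_const_smul ε), C * (max 1 ε⁻¹) ^ R, by positivity,
      fun w => (h _).trans ?_⟩
    rw [mul_assoc]
    gcongr
    rw [← inv_inv (max 1 ε⁻¹ ^ R), ← mul_inv]
    refine inv_anti₀ (by positivity) ?_
    rw [← inv_pow, ← mul_pow]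
    gcongr
    rw [inv_mul_le_iff₀ (by positivity), mul_add, mul_one]
    refine add_le_add (le_max_left _ _) ?_
    rw [norm_smul, Real.norm_eq_abs, abs_of_pos hε, ← mul_assoc]
    refine le_mul_of_one_le_left (norm_nonneg _) ?_
    calc 1 = ε⁻¹ * ε := (inv_mul_cancel₀ hε.ne').symm
      _ ≤ _ := by gcongr; exact le_max_right _ _

/-- Here `ε` is a variable that may vanish. Each derivative in `w` produces a factor `ε`, absorbed
in `1 + ε²`. The bound is locally uniform in `ε` but has no decay in `w`; `reg_schwartz_scaled` has
decay, with constants that depend on `ε`. -/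
theorem reg_schwartz_family (d : ι → Fin n → V) (c : ι → ℕ) (χ : 𝓢(V, ℂ)) :
    Reg (liftDir ℝ d) (Bd fun z : ℝ × V => (1 + z.1 ^ 2) ^ ∑ i, c i) c
      fun z => χ (z.1 • z.2) := by
  induction c using count_induction generalizing χ with
  | _ c ih =>
    refine Reg.of_hasLineDerivAt ?_ fun i j hi => ⟨fun z => z.1 *
      LineDeriv.lineDerivOp (d i j) χ (z.1 • z.2), fun z => ?_, ?_⟩
    · obtain ⟨C, hC, h⟩ := schwartz_le_one_add_norm χ 0
      refine ⟨χ.continuous.comp (by fun_prop), C, hC, fun z => (h _).trans ?_⟩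
      gcongr
      rw [pow_zero, inv_one]
      exact one_le_pow₀ (by nlinarith [sq_nonneg z.1])
    · simp only [HasLineDerivAt, snd_add_liftDir, fst_add_liftDir]
      exact hasLineDerivAt_schwartz_scaled χ _ z.2 z.1
    · have h1 : Reg (liftDir ℝ d) (Bd fun z : ℝ × V => 1 + z.1 ^ 2) (c - Pi.single i 1)
          fun z => (z.1 : ℂ) := by
        refine Reg.of_invariant ⟨by fun_prop, 1, zero_le_one, fun z => ?_⟩
          (Bd.zero fun z => by positivity) (fun z i j t => by rw [fst_add_liftDir]) _
        rw [Complex.norm_real, Real.norm_eq_abs, one_mul, abs_le]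
        constructor <;> nlinarith [sq_nonneg (z.1 + 1), sq_nonneg (z.1 - 1)]
      refine (h1.bd_mul (ih i hi _)).bd_mono zero_le_one fun z => ?_
      rw [one_mul, ← pow_succ']
      refine pow_le_pow_right₀ (by nlinarith [sq_nonneg z.1]) ?_
      refine Finset.sum_lt_sum (fun k _ => Nat.sub_le _ _) ⟨i, Finset.mem_univ _, ?_⟩
      simp only [Pi.single_eq_same]
      omega

variable [FiniteDimensional ℝ V] [MeasurableSpace V] [BorelSpace V] {μ : Measure V}
  [μ.IsAddHaarMeasure]

theorem integrable_inv_one_add_norm_pow {R : ℕ} (hR : Module.finrank ℝ V < R) :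
    Integrable (fun w : V => ((1 + ‖w‖) ^ R)⁻¹) μ := by
  have := integrable_one_add_norm (μ := μ) (E := V) (r := R) (by exact_mod_cast hR)
  refine this.congr (Eventually.of_forall fun w => ?_)
  dsimp only
  rw [Real.rpow_neg (by positivity), Real.rpow_natCast]

/-- For `ε > 0` the cutoff makes the amplitude integrable and the integrations by parts exact. The
transformed integrand is dominated, locally uniformly in `ε`, by the integrable `ibpWeight l * W`.
Its integral is thus continuous at `ε = 0`, where `χ 0 = 1` leaves the integral without cutoff. -/
theorem IsOsc.tendsto_regularisation {d : ι → Fin n → V} {l : List ((V → E n) × ι)} {osc : V → ℂ}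
    (ho : IsOsc d l osc) {W : V → ℝ} (hW0 : ∀ w, 0 ≤ W w) {A : ℝ} {ρ : ℕ} (hA : 0 ≤ A)
    (hWρ : ∀ w, W w ≤ A * (1 + ‖w‖) ^ ρ) (hW : Integrable (fun w => ibpWeight l w * W w) μ)
    {b : V → ℂ} (hb : Reg d (Bd W) (ibpCount l) b) (χ : 𝓢(V, ℂ)) (hχ : χ 0 = 1) :
    (∀ ε : ℝ, 0 < ε → Integrable (fun w => χ (ε • w) * osc w * b w) μ) ∧
      Tendsto (fun ε : ℝ => ∫ w, χ (ε • w) * osc w * b w ∂μ) (𝓝[>] 0)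
        (𝓝 (∫ w, osc w * ibpOps d l b w ∂μ)) := by
  -- Of the Schwartz decay, `ρ` powers cancel the growth of `W` and `finrank + 1` powers ensure
  -- integrability.
  have hreg : ∀ ε : ℝ, 0 < ε → Reg d (Bd fun w => ((1 + ‖w‖) ^ (Module.finrank ℝ V + 1))⁻¹)
      (ibpCount l) fun w => χ (ε • w) * b w := fun ε hε => by
    refine ((reg_schwartz_scaled d hε (Module.finrank ℝ V + 1 + ρ) _ χ).bd_mul hb).bd_mono hA
      fun w => ?_
    calc _ ≤ ((1 + ‖w‖) ^ (Module.finrank ℝ V + 1 + ρ))⁻¹ * (A * (1 + ‖w‖) ^ ρ) := by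
          gcongr; exact hWρ w
      _ = _ := by rw [pow_add]; field_simp
  have hint := integrable_inv_one_add_norm_pow (μ := μ) (V := V) (Nat.lt_succ_self _)
  have hcomm : ∀ ε : ℝ, (fun w => χ (ε • w) * osc w * b w) =
      fun w => osc w * (χ (ε • w) * b w) := fun ε => by ext w; ring
  simp only [hcomm]
  refine ⟨fun ε hε => ((hreg ε hε).base.bounded_mul ho.continuous
    fun w => (ho.norm_eq w).le).integrable hint, ?_⟩
  let F : ℝ × V → ℂ := fun z => χ (z.1 • z.2) * b z.2
  let l' := pullOps (Prod.snd : ℝ × V → V) l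
  have hF : Reg (liftDir ℝ d) (Bd fun z : ℝ × V => (1 + z.1 ^ 2) ^ (∑ i, ibpCount l i) * W z.2)
      (ibpCount l') F := by
    rw [ibpCount_pullOps]
    exact (reg_schwartz_family d _ χ).bd_mul
      (hb.comp (fun i _ => snd_add_liftDir d i) fun f hf => hf.comp continuous_snd)
  have ho' : IsOsc (liftDir ℝ d) l' fun z => osc z.2 :=
    ho.comp continuous_snd (snd_add_liftDir d)
  have hG : Bd (fun z : ℝ × V => (1 + z.1 ^ 2) ^ (∑ i, ibpCount l i) * (ibpWeight l z.2 * W z.2))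
      fun z => osc z.2 * ibpOps (liftDir ℝ d) l' F z := by
    refine Bd.bounded_mul ?_ ho'.continuous fun z => (ho'.norm_eq z).le
    refine (Reg.ibpOps (c := 0) l' ho'.affine
      (W := fun z : ℝ × V => (1 + z.1 ^ 2) ^ (∑ i, ibpCount l i) * W z.2) (fun z => mul_nonneg (by positivity) (hW0 _))
      (by rwa [zero_add])).base.mono zero_le_one fun z => ?_
    rw [ibpWeight_pullOps, one_mul]
    exact (by ring : _ = _).le
  have hslice : ∀ (ε : ℝ) w, ibpOps (liftDir ℝ d) l' F (ε, w) =
      ibpOps d l (fun w => χ (ε • w) * b w) w := fun ε w => ibpOps_slice d l F ε w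
  have hcont := (hG.integral (μ := μ) (ω := fun ε : ℝ => (1 + ε ^ 2) ^ (∑ i, ibpCount l i))
    (W := fun w => ibpWeight l w * W w) (by fun_prop) hW
    (fun w => mul_nonneg (ibpWeight_nonneg _ _) (hW0 w))).1
  have h0 := hcont.tendsto 0
  simp only [hslice, zero_smul, hχ, one_mul] at h0
  refine (h0.mono_left nhdsWithin_le_nhds).congr' ?_
  filter_upwards [self_mem_nhdsWithin] with ε hε
  exact (ho.integral_ibpOps hint (fun w => by positivity) (hreg ε hε)).symm

end Regularisation

/-! ### Multi-index derivatives -/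

section MultiIndex

variable {n : ℕ}

theorem multiLength_add_single (β : Fin n → ℕ) (j : Fin n) :
    multiLength (β + Pi.single j 1) = multiLength β + 1 := by
  simp [multiLength, Finset.sum_add_distrib, Pi.single_apply]

theorem multiLength_zero : multiLength (0 : Fin n → ℕ) = 0 := by simp [multiLength]

theorem multiIndex_induction {P : (Fin n → ℕ) → Prop} (h0 : P 0)
    (hs : ∀ β j, P β → P (β + Pi.single j 1)) (β : Fin n → ℕ) : P β := by
  induction hN : multiLength β generalizing β with
  | zero =>
    have : β = 0 := by
      ext j
      simpa using (Finset.sum_eq_zero_iff.1 hN) j (Finset.mem_univ j)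
    rwa [this]
  | succ N ih =>
    obtain ⟨j, hj⟩ : ∃ j, 0 < β j := by
      by_contra! h
      have : multiLength β = 0 := Finset.sum_eq_zero fun j _ => Nat.le_zero.1 (h j)
      omega
    have hβ : β = (β - Pi.single j 1) + Pi.single j 1 := by
      ext i
      by_cases hi : i = j
      · subst hi; simp; omega
      · simp [hi]
    rw [hβ] at hN ⊢
    rw [multiLength_add_single] at hN
    exact hs _ _ (ih _ (by omega))

theorem partialDeriv_eq_fderiv {g : E n → ℂ} (hg : Differentiable ℝ g) (j : Fin n) :
    partialDeriv j g = fun x => fderiv ℝ g x (EuclideanSpace.single j 1) :=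
  funext fun x => (hg x).lineDeriv_eq_fderiv

theorem contDiff_partialDeriv {g : E n → ℂ} {r : ℕ} (hg : ContDiff ℝ (r + 1 : ℕ) g) (j : Fin n) :
    ContDiff ℝ r (partialDeriv j g) := by
  rw [partialDeriv_eq_fderiv (hg.differentiable (by simp))]
  exact (hg.fderiv_right (m := r) (by norm_cast)).clm_apply contDiff_const

theorem hasLineDerivAt_partialDeriv {g : E n → ℂ} {r : ℕ} (hg : ContDiff ℝ (r + 1 : ℕ) g)
    (j : Fin n) (x : E n) :
    HasLineDerivAt ℝ g (partialDeriv j g x) x (EuclideanSpace.single j 1) :=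
  ((hg.differentiable (by simp)) x).lineDifferentiableAt.hasLineDerivAt

theorem partialDeriv_comm {g : E n → ℂ} (hg : ContDiff ℝ (2 : ℕ) g) (i j : Fin n) :
    partialDeriv i (partialDeriv j g) = partialDeriv j (partialDeriv i g) := by
  have hi := contDiff_partialDeriv (r := 1) hg i
  have hij := contDiff_partialDeriv (r := 0) hi j
  exact funext fun x => (hasLineDerivAt_swap (hasLineDerivAt_partialDeriv hg i)
    (hasLineDerivAt_partialDeriv hg j) (hasLineDerivAt_partialDeriv hi j) hi.continuous
    hij.continuous x).lineDeriv

theorem contDiff_partialDeriv_iterate {g : E n → ℂ} {r k : ℕ} (hg : ContDiff ℝ (r + k : ℕ) g)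
    (j : Fin n) : ContDiff ℝ r ((partialDeriv j)^[k] g) := by
  induction k generalizing r with
  | zero => exact hg
  | succ k ih =>
    rw [Function.iterate_succ_apply']
    exact contDiff_partialDeriv (ih (by rwa [add_right_comm, add_assoc])) j

theorem partialDeriv_iterate_comm {g : E n → ℂ} {k : ℕ} (hg : ContDiff ℝ (1 + k : ℕ) g)
    (i j : Fin n) :
    (partialDeriv i)^[k] (partialDeriv j g) = partialDeriv j ((partialDeriv i)^[k] g) := by
  induction k with
  | zero => rfl
  | succ k ih =>
    rw [Function.iterate_succ_apply', Function.iterate_succ_apply',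
      ih (hg.of_le (by norm_cast; omega)), partialDeriv_comm]
    exact contDiff_partialDeriv_iterate (k := k) (hg.of_le (by norm_cast; omega)) i

theorem contDiff_foldr {g : E n → ℂ} (β : Fin n → ℕ) (l : List (Fin n)) {r : ℕ}
    (hg : ContDiff ℝ (r + (l.map β).sum : ℕ) g) :
    ContDiff ℝ r (l.foldr (fun j g => (partialDeriv j)^[β j] g) g) := by
  induction l generalizing r with
  | nil => simpa using hg
  | cons i l ih =>
    rw [List.foldr_cons]
    refine contDiff_partialDeriv_iterate (ih ?_) i
    rwa [List.map_cons, List.sum_cons, ← add_assoc] at hg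

/-- `multiDeriv` composes the partial derivatives in a fixed order, so the additional `∂_j` must be
commuted to the outside. Absence of repetitions guarantees that it appears only once. -/
theorem foldr_add_single {g : E n → ℂ} (β : Fin n → ℕ) (j : Fin n) (l : List (Fin n))
    (hl : l.Nodup) (hg : ContDiff ℝ (1 + (l.map β).sum : ℕ) g) :
    l.foldr (fun i g => (partialDeriv i)^[(β + Pi.single j 1 : Fin n → ℕ) i] g) g =
      if j ∈ l then partialDeriv j (l.foldr (fun i g => (partialDeriv i)^[β i] g) g)
      else l.foldr (fun i g => (partialDeriv i)^[β i] g) g := by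
  induction l with
  | nil => simp
  | cons i l ih =>
    rw [List.map_cons, List.sum_cons, ← add_assoc] at hg
    have ih' := ih hl.of_cons (hg.of_le (by norm_cast; omega))
    simp only [List.foldr_cons] at ih' ⊢
    rw [ih']
    by_cases hij : j = i
    · subst hij
      have : j ∉ l := (List.nodup_cons.1 hl).1
      simp only [this, if_false, List.mem_cons_self, if_true, Pi.add_apply, Pi.single_eq_same]
      rw [Function.iterate_succ_apply']
    · have hs : (β + Pi.single j 1 : Fin n → ℕ) i = β i := by simp [Ne.symm hij]
      rw [hs]
      simp only [List.mem_cons, hij, false_or]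
      split_ifs
      · exact partialDeriv_iterate_comm (contDiff_foldr β l hg) i j
      · rfl

theorem sum_map_finRange (β : Fin n → ℕ) : ((List.finRange n).map β).sum = multiLength β := by
  simp [multiLength, ← List.ofFn_eq_map, List.sum_ofFn]

theorem contDiff_multiDeriv {g : E n → ℂ} {β : Fin n → ℕ} {r : ℕ}
    (hg : ContDiff ℝ (r + multiLength β : ℕ) g) : ContDiff ℝ r (multiDeriv β g) :=
  contDiff_foldr β _ (by rwa [sum_map_finRange])

theorem multiDeriv_add_single {g : E n → ℂ} {β : Fin n → ℕ}
    (hg : ContDiff ℝ (1 + multiLength β : ℕ) g) (j : Fin n) :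
    multiDeriv (β + Pi.single j 1) g = partialDeriv j (multiDeriv β g) := by
  have := foldr_add_single β j (List.finRange n) (List.nodup_finRange n)
    (by rwa [sum_map_finRange])
  rwa [if_pos (List.mem_finRange j)] at this

theorem hasLineDerivAt_multiDeriv {g : E n → ℂ} {β : Fin n → ℕ}
    (hg : ContDiff ℝ (1 + multiLength β : ℕ) g) (j : Fin n) (x : E n) :
    HasLineDerivAt ℝ (multiDeriv β g) (multiDeriv (β + Pi.single j 1) g x) x
      (EuclideanSpace.single j 1) := by
  rw [multiDeriv_add_single hg]
  exact hasLineDerivAt_partialDeriv (r := 0) (contDiff_multiDeriv hg) j x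

theorem multiDeriv_zero (g : E n → ℂ) : multiDeriv 0 g = g := by
  have : ∀ l : List (Fin n), l.foldr (fun j g => (partialDeriv j)^[(0 : Fin n → ℕ) j] g) g = g := by
    intro l
    induction l with
    | nil => rfl
    | cons i l ih => rw [List.foldr_cons, ih]; rfl
  exact this _

end MultiIndex

/-! ### Hölder bounds -/

section Holder

variable {n : ℕ} {Q : Type*} [TopologicalSpace Q]

/-- Bounds for a function and for its Hölder quotients in the first variable. -/
def HolderBd (s : ℝ≥0) (w : Q → ℝ) (f : E n × Q → ℂ) : Prop :=
  Continuous f ∧ ∃ C : ℝ, 0 ≤ C ∧ (∀ z, ‖f z‖ ≤ C * w z.2) ∧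
    ∀ x₁ x₂ q, ‖f (x₁, q) - f (x₂, q)‖ ≤ C * (w q * ‖x₁ - x₂‖ ^ (s : ℝ))

theorem HolderBd.add {s : ℝ≥0} {w : Q → ℝ} {f g : E n × Q → ℂ} (hf : HolderBd s w f)
    (hg : HolderBd s w g) : HolderBd s w fun z => f z + g z := by
  obtain ⟨hfc, C, hC, h1, h2⟩ := hf
  obtain ⟨hgc, C', hC', h1', h2'⟩ := hg
  refine ⟨hfc.add hgc, C + C', add_nonneg hC hC', fun z => ?_, fun x₁ x₂ q => ?_⟩
  · rw [add_mul]
    exact (norm_add_le _ _).trans (add_le_add (h1 z) (h1' z))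
  · rw [add_mul, add_sub_add_comm]
    exact (norm_add_le _ _).trans (add_le_add (h2 _ _ _) (h2' _ _ _))

theorem norm_multiDeriv_le_of_holderSpaceNorm_le {k : ℕ} {s : ℝ≥0} {g : E n → ℂ} {r : ℝ}
    (hr : 0 ≤ r) (h : holderSpaceNorm k s g ≤ ENNReal.ofReal r) {β : Fin n → ℕ}
    (hβ : multiLength β ≤ k) (x : E n) : ‖multiDeriv β g x‖ ≤ r := by
  have h1 : ‖multiDeriv β g x‖ₑ ≤ ENNReal.ofReal r := le_trans
    (le_iSup_of_le β (le_iSup_of_le hβ (le_iSup (fun x => ‖multiDeriv β g x‖ₑ) x)))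
    (le_self_add.trans h)
  rwa [← ofReal_norm, ENNReal.ofReal_le_ofReal_iff hr] at h1

theorem norm_sub_le_of_holderSpaceNorm_le {k : ℕ} {s : ℝ≥0} {g : E n → ℂ} {r : ℝ}
    (hr : 0 ≤ r) (h : holderSpaceNorm k s g ≤ ENNReal.ofReal r) {β : Fin n → ℕ}
    (hβ : multiLength β ≤ k) (x y : E n) :
    ‖multiDeriv β g x - multiDeriv β g y‖ ≤ r * ‖x - y‖ ^ (s : ℝ) := by
  have h1 : eHolderNorm s (multiDeriv β g) ≤ ENNReal.ofReal r := le_trans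
    (le_iSup_of_le β (le_iSup (fun _ => eHolderNorm s (multiDeriv β g)) hβ))
    (le_add_self.trans h)
  have h2 : MemHolder s (multiDeriv β g) :=
    eHolderNorm_lt_top.1 (h1.trans_lt ENNReal.ofReal_lt_top)
  rw [← h2.coe_nnHolderNorm_eq_eHolderNorm, ENNReal.ofReal, ENNReal.coe_le_coe,
    ← NNReal.coe_le_coe, Real.coe_toNNReal r hr] at h1
  have h3 := h2.holderWith.dist_le x y
  rw [dist_eq_norm, dist_eq_norm] at h3
  exact h3.trans (by gcongr)

theorem holderSpaceNorm_le {k : ℕ} {s : ℝ≥0} {g : E n → ℂ} {r : ℝ} (hr : 0 ≤ r)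
    (h1 : ∀ β : Fin n → ℕ, multiLength β ≤ k → ∀ x, ‖multiDeriv β g x‖ ≤ r)
    (h2 : ∀ β : Fin n → ℕ, multiLength β ≤ k → ∀ x y,
      ‖multiDeriv β g x - multiDeriv β g y‖ ≤ r * ‖x - y‖ ^ (s : ℝ)) :
    holderSpaceNorm k s g ≤ ENNReal.ofReal (2 * r) := by
  rw [two_mul, ENNReal.ofReal_add hr hr]
  refine add_le_add (iSup_le fun β => iSup_le fun hβ => iSup_le fun x => ?_)
    (iSup_le fun β => iSup_le fun hβ => ?_)
  · rw [← ofReal_norm]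
    exact ENNReal.ofReal_le_ofReal (h1 β hβ x)
  · have : HolderWith r.toNNReal s (multiDeriv β g) := fun x y => by
      rw [edist_dist, edist_dist, dist_eq_norm, dist_eq_norm,
        ENNReal.ofReal_rpow_of_nonneg (norm_nonneg _) s.coe_nonneg]
      change _ ≤ ENNReal.ofReal r * _
      rw [← ENNReal.ofReal_mul hr]
      exact ENNReal.ofReal_le_ofReal (h2 β hβ x y)
    exact this.eHolderNorm_le

end Holder

/-! ### Regularity of double symbols -/

section DoubleSymbol

variable {n : ℕ}

/-- The coordinate directions of `(x, ξ, x')`. -/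
def symbolDir (n : ℕ) : Fin 3 → Fin n → E n × E n × E n :=
  ![fun j => (EuclideanSpace.single j 1, 0, 0), fun j => (0, EuclideanSpace.single j 1, 0),
    fun j => (0, 0, EuclideanSpace.single j 1)]

/-- The symbol class supplies the mixed derivatives in one order only. Interchanging line
derivatives shows that a derivative in any of the three variables just raises the corresponding
multi-index, after which the bounds of the class apply. -/
theorem IsDoubleSymbol.reg {k : ℕ} {s : ℝ≥0} {m : ℝ} {N : ℕ∞} {a : E n → E n → E n → ℂ}
    (ha : IsDoubleSymbol k s m N a) {c : Fin 3 → ℕ} (hk : c 0 ≤ k) (hN : (c 1 : ℕ∞) ≤ N) :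
    Reg (symbolDir n) (HolderBd s fun q : E n × E n => japanese q.1 ^ m) c
      fun z => a z.1 z.2.1 z.2.2 := by
  let A : (Fin n → ℕ) → (Fin n → ℕ) → (Fin n → ℕ) → E n × E n × E n → ℂ := fun β α β' z =>
    multiDeriv β (fun x => doubleSymbolDeriv α β' a x z.2.1 z.2.2) z.1
  have hcont : ∀ {β α} β', multiLength β ≤ k → (multiLength α : ℕ∞) ≤ N → Continuous (A β α β') :=
    fun β' h1 h2 => ha.continuous_deriv _ _ β' h1 h2
  have hle : ∀ {α : Fin n → ℕ} {j}, (multiLength (α + Pi.single j 1) : ℕ∞) ≤ N →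
      (multiLength α : ℕ∞) ≤ N := fun h => le_trans (by rw [multiLength_add_single]; simp) h
  have hx : ∀ β α β' j, multiLength (β + Pi.single j 1) ≤ k → (multiLength α : ℕ∞) ≤ N → ∀ z,
      HasLineDerivAt ℝ (A β α β') (A (β + Pi.single j 1) α β' z) z
        (EuclideanSpace.single j 1, 0, 0) := by
    intro β α β' j hβ hα z
    have := hasLineDerivAt_multiDeriv (β := β)
      (((ha.memHolderSpace α β' hα z.2.1 z.2.2).1).of_le (by
        rw [multiLength_add_single] at hβ; norm_cast; omega)) j z.1
    simpa [HasLineDerivAt, A] using this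
  have hξ : ∀ β, multiLength β ≤ k → ∀ α β' j, (multiLength (α + Pi.single j 1) : ℕ∞) ≤ N → ∀ z,
      HasLineDerivAt ℝ (A β α β') (A β (α + Pi.single j 1) β' z) z
        (0, EuclideanSpace.single j 1, 0) := by
    intro β
    induction β using multiIndex_induction with
    | h0 =>
      intro _ α β' j hα z
      have hN' : ((1 + multiLength α : ℕ) : ℕ∞) ≤ N := by
        rwa [multiLength_add_single, add_comm] at hα
      have := hasLineDerivAt_multiDeriv (β := α)
        ((ha.contDiff_snd β' z.1 z.2.2).of_le (by exact_mod_cast hN')) j z.2.1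
      simpa [HasLineDerivAt, A, multiDeriv_zero, doubleSymbolDeriv] using this
    | hs β i ih =>
      intro hβ α β' j hα z
      have hβ' : multiLength β ≤ k := by rw [multiLength_add_single] at hβ; omega
      -- The outer derivative in `x` is direct from the class; the inner `ξ`-derivative is moved
      -- past one `x`-derivative at a time. The arguments for `x'` below proceed in the same way.
      exact hasLineDerivAt_swap (ih hβ' α β' j hα) (hx β α β' i hβ (hle hα))
        (hx β _ β' i hβ hα) (hcont β' hβ' hα) (hcont β' hβ hα) z
  have hy0 : ∀ α, (multiLength α : ℕ∞) ≤ N → ∀ β' j z,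
      HasLineDerivAt ℝ (A 0 α β') (A 0 α (β' + Pi.single j 1) z) z
        (0, 0, EuclideanSpace.single j 1) := by
    have h0 : multiLength (0 : Fin n → ℕ) ≤ k := by rw [multiLength_zero]; exact Nat.zero_le _
    intro α
    induction α using multiIndex_induction with
    | h0 =>
      intro _ β' j z
      have := hasLineDerivAt_multiDeriv (β := β')
        ((ha.contDiff_third z.1 z.2.1).of_le (by exact_mod_cast le_top)) j z.2.2
      simpa [HasLineDerivAt, A, multiDeriv_zero, doubleSymbolDeriv] using this
    | hs α i ih =>
      intro hα β' j z
      exact hasLineDerivAt_swap (ih (hle hα) β' j) (hξ 0 h0 α β' i hα)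
        (hξ 0 h0 α _ i hα) (hcont _ h0 (hle hα)) (hcont _ h0 hα) z
  have hy : ∀ β, multiLength β ≤ k → ∀ α β' j, (multiLength α : ℕ∞) ≤ N → ∀ z,
      HasLineDerivAt ℝ (A β α β') (A β α (β' + Pi.single j 1) z) z
        (0, 0, EuclideanSpace.single j 1) := by
    intro β
    induction β using multiIndex_induction with
    | h0 => exact fun _ α β' j hα => hy0 α hα β' j
    | hs β i ih =>
      intro hβ α β' j hα z
      have hβ' : multiLength β ≤ k := by rw [multiLength_add_single] at hβ; omega
      exact hasLineDerivAt_swap (ih hβ' α β' j hα) (hx β α β' i hβ hα)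
        (hx β α _ i hβ hα) (hcont _ hβ' hα) (hcont _ hβ hα) z
  have hB : ∀ β α β', multiLength β ≤ k → (multiLength α : ℕ∞) ≤ N →
      HolderBd s (fun q : E n × E n => japanese q.1 ^ m) (A β α β') := by
    intro β α β' hβ hα
    obtain ⟨C, hC⟩ := ha.bound α β' hα
    have hC' : ∀ ξ x', holderSpaceNorm k s (fun x => doubleSymbolDeriv α β' a x ξ x') ≤
        ENNReal.ofReal (|C| * japanese ξ ^ m) := fun ξ x' => (hC ξ x').trans
      (ENNReal.ofReal_le_ofReal (mul_le_mul_of_nonneg_right (le_abs_self C)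
        (Real.rpow_nonneg (japanese_pos ξ).le m)))
    have hpos : ∀ ξ : E n, 0 ≤ |C| * japanese ξ ^ m := fun ξ =>
      mul_nonneg (abs_nonneg C) (Real.rpow_nonneg (japanese_pos ξ).le m)
    refine ⟨hcont β' hβ hα, |C|, abs_nonneg C, fun z => ?_, fun x₁ x₂ q => ?_⟩
    · exact norm_multiDeriv_le_of_holderSpaceNorm_le (hpos _) (hC' _ _) hβ _
    · rw [← mul_assoc]
      exact norm_sub_le_of_holderSpaceNorm_le (hpos _) (hC' _ _) hβ _ _
  have key : ∀ (c : Fin 3 → ℕ) β α β', multiLength β + c 0 ≤ k →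
      ((multiLength α + c 1 : ℕ) : ℕ∞) ≤ N →
      Reg (symbolDir n) (HolderBd s fun q : E n × E n => japanese q.1 ^ m) c (A β α β') := by
    intro c
    induction c using count_induction with
    | _ c ih =>
      intro β α β' hβ hα
      have hβ' : multiLength β ≤ k := by omega
      have hα' : (multiLength α : ℕ∞) ≤ N := le_trans (by simp) hα
      refine Reg.of_hasLineDerivAt (hB _ _ _ hβ' hα') fun i j hi => ?_
      fin_cases i
      · simp only [Fin.zero_eta] at hi
        refine ⟨A (β + Pi.single j 1) α β', hx β α β' j (by rw [multiLength_add_single]; omega) hα',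
          ih 0 hi _ _ _ ?_ (by simpa using hα)⟩
        simp [multiLength_add_single]; omega
      · simp only [Fin.mk_one] at hi
        have hα2 : ((multiLength α + 1 + (c 1 - 1) : ℕ) : ℕ∞) ≤ N := by
          rwa [show multiLength α + 1 + (c 1 - 1) = multiLength α + c 1 by omega]
        refine ⟨A β (α + Pi.single j 1) β', hξ β hβ' α β' j ?_,
          ih 1 hi _ _ _ (by simpa using hβ) (by simpa [multiLength_add_single] using hα2)⟩
        rw [multiLength_add_single]
        exact le_trans (by norm_cast; omega) hα2
      · exact ⟨A β α (β' + Pi.single j 1), hy β hβ' α β' j hα',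
          ih 2 hi _ _ _ (by simpa using hβ) (by simpa using hα)⟩
  have := key c 0 0 0 (by rw [multiLength_zero]; omega) (by rwa [multiLength_zero, zero_add])
  simpa only [A, multiDeriv_zero, doubleSymbolDeriv] using this

end DoubleSymbol

/-! ### Translation of the third variable of a double symbol -/

section Shift

variable {n : ℕ}

theorem reg_lipschitz_third {s : ℝ≥0} {m : ℝ} {c : Fin 3 → ℕ} {f : E n × E n × E n → ℂ}
    (h : Reg (symbolDir n) (HolderBd s fun q : E n × E n => japanese q.1 ^ m) c f) (hc : 0 < c 2) :
    ∃ C : ℝ, 0 ≤ C ∧ ∀ x ξ y₁ y₂, ‖f (x, ξ, y₁) - f (x, ξ, y₂)‖ ≤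
      C * (japanese ξ ^ m * ‖y₁ - y₂‖) := by
  choose hcont C hC hb _ using fun j => (h.step hc j).base
  refine ⟨∑ j, C j, Finset.sum_nonneg fun j _ => hC j, fun x ξ y₁ y₂ => ?_⟩
  set v := y₁ - y₂
  have hd : ∀ z, HasLineDerivAt ℝ f (∑ j, v j * lineDeriv ℝ f z (symbolDir n 2 j)) z
      ((0, 0, v) : E n × E n × E n) := fun z => by
    convert! hasLineDerivAt_sum_direction Finset.univ (fun j _ z => h.hasLineDerivAt hc j z)
      (fun j _ => hcont j) (fun j => v j) z using 1
    have hv : v = ∑ j, v j • EuclideanSpace.single j (1 : ℝ) := by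
      ext i; simp [Finset.sum_apply, Pi.single_apply]
    refine Prod.ext ?_ (Prod.ext ?_ ?_)
    · simp [symbolDir, Prod.fst_sum]
    · simp [symbolDir, Prod.fst_sum, Prod.snd_sum]
    · simpa [symbolDir, Prod.snd_sum] using hv
  have h1 := norm_image_sub_le_of_norm_deriv_le_segment_01'
    (f := fun t : ℝ => f ((x, ξ, y₂) + t • ((0, 0, v) : E n × E n × E n)))
    (C := (∑ j, C j) * (japanese ξ ^ m * ‖v‖))
    (fun t _ => (hasDerivAt_line (hd _)).hasDerivWithinAt) (fun t _ => by
      rw [Finset.sum_mul]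
      refine norm_sum_le_of_le _ fun j _ => ?_
      have h2 := hb j ((x, ξ, y₂) + t • ((0, 0, v) : E n × E n × E n))
      simp only [Prod.snd_add, Prod.fst_add, Prod.smul_snd, Prod.smul_fst, smul_zero,
        add_zero] at h2
      rw [norm_mul, Complex.norm_real, mul_comm, ← mul_assoc]
      exact mul_le_mul h2 (PiLp.norm_apply_le v j) (norm_nonneg _) ((norm_nonneg _).trans h2))
  simpa [v] using h1

/-- Vary the first and the third slot separately. In the third slot `f` is Lipschitz: for `|x₁ - x₂|
≤ 1` use `|x₁ - x₂| ≤ |x₁ - x₂|^s`, and for larger distances the sup bound. -/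
theorem holderBd_shift {s : ℝ≥0} (hs : s < 1) {m : ℝ} {c : Fin 3 → ℕ}
    {f : E n × E n × E n → ℂ}
    (h : Reg (symbolDir n) (HolderBd s fun q : E n × E n => japanese q.1 ^ m) c f) (hc : 0 < c 2) :
    HolderBd s (fun q : E n × E n => japanese q.1 ^ m) fun z => f (z.1, z.2.1, z.1 + z.2.2) := by
  obtain ⟨D, hD, hlip⟩ := reg_lipschitz_third h hc
  obtain ⟨hcont, C, hC, hb, hh⟩ := h.base
  refine ⟨by fun_prop, C + (2 * C + D), by positivity, fun z => ?_, fun x₁ x₂ q => ?_⟩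
  · refine (hb _).trans ?_
    have := Real.rpow_nonneg (japanese_pos z.2.1).le m
    gcongr
    linarith
  · have hw := Real.rpow_nonneg (japanese_pos q.1).le m
    have h1 := hh x₁ x₂ (q.1, x₁ + q.2)
    have hr := Real.rpow_nonneg (norm_nonneg (x₁ - x₂)) s
    have h2 : ‖f (x₂, q.1, x₁ + q.2) - f (x₂, q.1, x₂ + q.2)‖ ≤
        (2 * C + D) * (japanese q.1 ^ m * ‖x₁ - x₂‖ ^ (s : ℝ)) := by
      rcases le_total 1 ‖x₁ - x₂‖ with h3 | h3
      · have h4 := Real.one_le_rpow h3 s.coe_nonneg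
        refine (norm_sub_le _ _).trans ((add_le_add (hb _) (hb _)).trans ?_)
        dsimp only
        nlinarith [mul_nonneg hD (mul_nonneg hw hr), mul_nonneg hC hw,
          mul_le_mul_of_nonneg_left h4 (mul_nonneg hC hw)]
      · have h4 : ‖x₁ - x₂‖ ≤ ‖x₁ - x₂‖ ^ (s : ℝ) :=
          Real.self_le_rpow_of_le_one (norm_nonneg _) h3 (by exact_mod_cast hs.le)
        refine (hlip _ _ _ _).trans ?_
        rw [add_sub_add_right_eq_sub]
        nlinarith [mul_nonneg hC (mul_nonneg hw hr), mul_nonneg hD hw,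
          mul_le_mul_of_nonneg_left h4 (mul_nonneg hD hw)]
    rw [add_mul]
    calc _ = ‖(f (x₁, q.1, x₁ + q.2) - f (x₂, q.1, x₁ + q.2)) +
          (f (x₂, q.1, x₁ + q.2) - f (x₂, q.1, x₂ + q.2))‖ := by rw [sub_add_sub_cancel]
      _ ≤ _ := (norm_add_le _ _).trans (add_le_add h1 h2)

/-- By the chain rule each of the `c 0` derivatives in `x` may fall on the third slot; the
additional `1` pays for the Lipschitz bound in the Hölder estimate. -/
theorem Reg.shift {s : ℝ≥0} (hs : s < 1) {m : ℝ} {c : Fin 3 → ℕ} {f : E n × E n × E n → ℂ}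
    (h : Reg (symbolDir n) (HolderBd s fun q : E n × E n => japanese q.1 ^ m)
      (c + Pi.single 2 (c 0 + 1)) f) :
    Reg (symbolDir n) (HolderBd s fun q : E n × E n => japanese q.1 ^ m) c
      fun z => f (z.1, z.2.1, z.1 + z.2.2) := by
  induction c using count_induction generalizing f with
  | _ c ih =>
    refine of_hasLineDerivAt (holderBd_shift hs h (by simp)) fun i j hi => ?_
    have hi' : 0 < (c + Pi.single 2 (c 0 + 1) : Fin 3 → ℕ) i := Nat.add_pos_left hi _
    have h2 : 0 < (c + Pi.single 2 (c 0 + 1) : Fin 3 → ℕ) 2 := by simp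
    have hs1 := h.step hi' j
    fin_cases i
    · have hs2 := h.step h2 j
      refine ⟨fun z => lineDeriv ℝ f (z.1, z.2.1, z.1 + z.2.2) (symbolDir n 0 j) +
        lineDeriv ℝ f (z.1, z.2.1, z.1 + z.2.2) (symbolDir n 2 j), fun z => ?_,
        (ih 0 hi (hs1.mono_count ?_)).add (ih 0 hi (hs2.mono_count ?_)) fun _ _ => HolderBd.add⟩
      · have := hasLineDerivAt_add_direction (fun z => h.hasLineDerivAt hi' j z)
          (fun z => h.hasLineDerivAt h2 j z) hs1.base.1 (z.1, z.2.1, z.1 + z.2.2)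
        simp only [HasLineDerivAt, symbolDir] at this ⊢
        convert! this using 2
        simp [add_right_comm]
      · intro k
        fin_cases k <;> simp
      · simp only [Fin.zero_eta] at hi
        intro k
        fin_cases k <;> simp; omega
    · refine ⟨_, fun z => ?_, ih 1 hi (hs1.mono_count fun k => by fin_cases k <;> simp)⟩
      have := h.hasLineDerivAt hi' j (z.1, z.2.1, z.1 + z.2.2)
      simpa [HasLineDerivAt, symbolDir] using this
    · simp only [Fin.reduceFinMk] at hi
      refine ⟨_, fun z => ?_, ih 2 hi (hs1.mono_count fun k => by
        fin_cases k <;> simp; omega)⟩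
      have := h.hasLineDerivAt hi' j (z.1, z.2.1, z.1 + z.2.2)
      simpa [HasLineDerivAt, symbolDir, add_assoc] using this

end Shift

/-! ### Single symbols from regular functions -/

section SingleSymbol

variable {n : ℕ} {Z : Type*} [NormedAddCommGroup Z] [NormedSpace ℝ Z]

/-- The multi-index derivative in the directions `d`. -/
def multiDerivAlong (d : Fin n → Z) (α : Fin n → ℕ) (f : Z → ℂ) : Z → ℂ :=
  (List.finRange n).foldr (fun j g => (fun h z => lineDeriv ℝ h z (d j))^[α j] g) f

theorem multiDeriv_comp {d : Fin n → Z} {φ : E n → Z}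
    (hφ : ∀ x j (t : ℝ), φ (x + t • EuclideanSpace.single j 1) = φ x + t • d j)
    (α : Fin n → ℕ) (f : Z → ℂ) (x : E n) :
    multiDeriv α (fun x => f (φ x)) x = multiDerivAlong d α f (φ x) := by
  have h1 : ∀ j (g : Z → ℂ), partialDeriv j (fun x => g (φ x)) =
      fun x => lineDeriv ℝ g (φ x) (d j) := fun j g => by
    ext x; simp only [partialDeriv, lineDeriv, hφ]
  have h2 : ∀ j r (g : Z → ℂ), (partialDeriv j)^[r] (fun x => g (φ x)) =
      fun x => ((fun h z => lineDeriv ℝ h z (d j))^[r] g) (φ x) := fun j r => by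
    induction r with
    | zero => exact fun g => rfl
    | succ r ih =>
      intro g
      rw [Function.iterate_succ_apply, h1, ih fun z => lineDeriv ℝ g z (d j),
        Function.iterate_succ_apply]
  have h3 : ∀ l : List (Fin n), l.foldr (fun j g => (partialDeriv j)^[α j] g) (fun x => f (φ x)) =
      fun x => l.foldr (fun j g => (fun h z => lineDeriv ℝ h z (d j))^[α j] g) f (φ x) := by
    intro l
    induction l with
    | nil => rfl
    | cons i l ih => rw [List.foldr_cons, ih, h2, List.foldr_cons]
  exact congrFun (h3 _) x

theorem Reg.multiDerivAlong {ι : Type*} [DecidableEq ι] {d : ι → Fin n → Z}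
    {B : (Z → ℂ) → Prop} {c : ι → ℕ} {f : Z → ℂ} {i : ι} {α : Fin n → ℕ}
    (h : Reg d B (c + Pi.single i (multiLength α)) f) :
    Reg d B c (multiDerivAlong (d i) α f) := by
  have h1 : ∀ r j c (g : Z → ℂ), Reg d B (c + Pi.single i r) g →
      Reg d B c ((fun h z => lineDeriv ℝ h z (d i j))^[r] g) := by
    intro r j
    induction r with
    | zero => intro c g hg; simpa using hg
    | succ r ih =>
      intro c g hg
      rw [Function.iterate_succ_apply]
      refine ih _ _ ((hg.step (i := i) (by simp) j).mono_count fun k => ?_)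
      by_cases hk : k = i
      · subst hk; simp
      · simp [hk]
  have h2 : ∀ (l : List (Fin n)) c, Reg d B (c + Pi.single i (l.map α).sum) f →
      Reg d B c (l.foldr (fun j g => (fun h z => lineDeriv ℝ h z (d i j))^[α j] g) f) := by
    intro l
    induction l with
    | nil => intro c hc; simpa using hc
    | cons j l ih =>
      intro c hc
      rw [List.foldr_cons]
      refine h1 _ _ _ _ (ih _ ?_)
      rwa [add_assoc, ← Pi.single_add, ← List.sum_cons, ← List.map_cons]
  exact h2 _ _ (by rwa [sum_map_finRange])

theorem Reg.contDiff_slice {ι : Type*} [DecidableEq ι] {d : ι → Fin n → Z}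
    {B : (Z → ℂ) → Prop} (hB : ∀ f, B f → Continuous f) {f : Z → ℂ} {i : ι} {r : ℕ} {c : ι → ℕ}
    (h : Reg d B c f) (hr : r ≤ c i) {φ : E n → Z} (hφc : Continuous φ)
    (hφ : ∀ x j (t : ℝ), φ (x + t • EuclideanSpace.single j 1) = φ x + t • d i j) :
    ContDiff ℝ r fun x => f (φ x) := by
  induction r generalizing c f with
  | zero =>
    rw [Nat.cast_zero, contDiff_zero]
    exact (hB _ h.base).comp hφc
  | succ r ih =>
    have hi : 0 < c i := by omega
    refine contDiff_one_add_of_partial (g := fun j x => lineDeriv ℝ f (φ x) (d i j))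
      (fun j x => ?_) fun j => ih (h.step hi j) (by simp; omega)
    simp only [HasLineDerivAt, hφ]
    exact h.hasLineDerivAt hi j (φ x)

/-- The coordinate directions of `(x, ξ)`. -/
def singleDir (n : ℕ) : Fin 3 → Fin n → E n × E n :=
  ![fun j => (EuclideanSpace.single j 1, 0), fun j => (0, EuclideanSpace.single j 1), fun _ => 0]

theorem finite_multiLength_le (k : ℕ) : {β : Fin n → ℕ | multiLength β ≤ k}.Finite := by
  refine (Set.finite_Iic (fun _ : Fin n => k)).subset fun β hβ j => ?_
  exact (Finset.single_le_sum (fun _ _ => Nat.zero_le _) (Finset.mem_univ j)).trans hβ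

/-- The third family of `singleDir` is a dummy, kept so that the index type agrees with that of
`symbolDir`; `c 2 = 0` means that it is never used. A common constant exists because only finitely
many `β` have length at most `k`. -/
theorem isSingleSymbol_of_reg {k : ℕ} {s : ℝ≥0} {m : ℝ} {M : ℕ∞} {f : E n × E n → ℂ}
    (h : ∀ c : Fin 3 → ℕ, c 0 ≤ k → (c 1 : ℕ∞) ≤ M → c 2 = 0 →
      Reg (singleDir n) (HolderBd s fun ξ : E n => japanese ξ ^ m) c f) :
    IsSingleSymbol k s m M fun x ξ => f (x, ξ) := by
  have hφ₀ : ∀ (ξ x : E n) j (t : ℝ), ((x + t • EuclideanSpace.single j 1, ξ) : E n × E n) =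
      (x, ξ) + t • singleDir n 0 j := fun ξ x j t => by simp [singleDir]
  have hφ₁ : ∀ (x ξ : E n) j (t : ℝ), ((x, ξ + t • EuclideanSpace.single j 1) : E n × E n) =
      (x, ξ) + t • singleDir n 1 j := fun ξ x j t => by simp [singleDir]
  have hα : ∀ α x ξ, multiDeriv α (fun ξ => f (x, ξ)) ξ =
      multiDerivAlong (singleDir n 1) α f (x, ξ) := fun α x =>
    multiDeriv_comp (φ := fun ξ => (x, ξ)) (hφ₁ x) α f
  have hβ : ∀ β (g : E n × E n → ℂ) x ξ, multiDeriv β (fun x => g (x, ξ)) x =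
      multiDerivAlong (singleDir n 0) β g (x, ξ) := fun β g x ξ =>
    multiDeriv_comp (φ := fun x => (x, ξ)) (hφ₀ ξ) β g x
  have hreg : ∀ (β α : Fin n → ℕ), multiLength β ≤ k → (multiLength α : ℕ∞) ≤ M →
      HolderBd s (fun ξ : E n => japanese ξ ^ m) (multiDerivAlong (singleDir n 0) β
        (multiDerivAlong (singleDir n 1) α f)) := fun β α hβk hαM => by
    refine (Reg.multiDerivAlong (c := 0) (Reg.multiDerivAlong (h _ ?_ ?_ ?_))).base
    · simpa using hβk
    · simpa using hαM
    · simp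
  have hbound : ∀ α : Fin n → ℕ, (multiLength α : ℕ∞) ≤ M → ∃ C : ℝ, ∀ ξ : E n,
      holderSpaceNorm k s (fun x => multiDeriv α (fun ξ => f (x, ξ)) ξ) ≤
        ENNReal.ofReal (C * japanese ξ ^ m) := by
    intro α hαM
    choose! C hC h1 h2 using fun β (hβk : multiLength β ≤ k) => (hreg β α hβk hαM).2
    obtain ⟨K, hK⟩ := ((finite_multiLength_le (n := n) k).image C).bddAbove
    have hK' : ∀ β, multiLength β ≤ k → C β ≤ K := fun β hβk => hK ⟨β, hβk, rfl⟩
    have hK0 : 0 ≤ K := (hC 0 (by simp [multiLength_zero])).trans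
      (hK' 0 (by simp [multiLength_zero]))
    refine ⟨2 * K, fun ξ => ?_⟩
    have hw := Real.rpow_nonneg (japanese_pos ξ).le m
    rw [mul_assoc]
    refine holderSpaceNorm_le (by positivity) (fun β hβk x => ?_) fun β hβk x y => ?_
    · simp only [hα, hβ]
      exact (h1 β hβk _).trans (mul_le_mul_of_nonneg_right (hK' β hβk) hw)
    · simp only [hα, hβ]
      refine (h2 β hβk x y ξ).trans ?_
      rw [← mul_assoc]
      have := hK' β hβk
      gcongr
  refine ⟨fun β hβk x => ?_, fun α hαM ξ => ⟨?_, ?_⟩, fun β α hβk hαM => ?_, hbound⟩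
  · rw [contDiff_iff_forall_nat_le]
    intro r hr
    simp only [hβ]
    refine Reg.contDiff_slice (d := singleDir n) (i := 1) (c := Pi.single 1 r)
      (fun f (hf : HolderBd s (fun ξ : E n => japanese ξ ^ m) f) => hf.1)
      (Reg.multiDerivAlong (h _ ?_ ?_ ?_)) (by simp) (by fun_prop) (hφ₁ x)
    · simpa using hβk
    · simpa using (by exact_mod_cast hr : (r : ℕ∞) ≤ M)
    · simp
  · simp only [hα]
    refine Reg.contDiff_slice (d := singleDir n) (i := 0) (c := Pi.single 0 k)
      (fun f (hf : HolderBd s (fun ξ : E n => japanese ξ ^ m) f) => hf.1)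
      (Reg.multiDerivAlong (h _ ?_ ?_ ?_)) (by simp) (by fun_prop) (hφ₀ ξ)
    · simp
    · simpa using hαM
    · simp
  · obtain ⟨C, hC⟩ := hbound α hαM
    exact (hC ξ).trans_lt ENNReal.ofReal_lt_top
  · simp only [symbolDeriv, hα, hβ]
    exact (hreg β α hβk hαM).1

end SingleSymbol

/-! ### Oscillatory integrals over `(y, η)` -/

section Lists

variable {n : ℕ} {ι Z : Type*}

theorem ibpCount_append [DecidableEq ι] (l l' : List ((Z → E n) × ι)) :
    ibpCount (l ++ l') = ibpCount l + ibpCount l' := by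
  induction l with
  | nil => simp [ibpCount]
  | cons o l ih => simp [ibpCount, ih, add_assoc]

theorem ibpCount_replicate [DecidableEq ι] (k : ℕ) (o : (Z → E n) × ι) :
    ibpCount (List.replicate k o) = Pi.single o.2 k := by
  induction k with
  | zero => simp [ibpCount]
  | succ k ih => rw [List.replicate_succ, ibpCount, ih, ← Pi.single_add, add_comm]

theorem ibpWeight_append (l l' : List ((Z → E n) × ι)) (z : Z) :
    ibpWeight (l ++ l') z = ibpWeight l z * ibpWeight l' z := by
  induction l with
  | nil => simp [ibpWeight]
  | cons o l ih => simp [ibpWeight, ih, mul_assoc]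

theorem ibpWeight_replicate (k : ℕ) (o : (Z → E n) × ι) (z : Z) :
    ibpWeight (List.replicate k o) z = (japanese (o.1 z))⁻¹ ^ k := by
  induction k with
  | zero => simp [ibpWeight]
  | succ k ih => rw [List.replicate_succ, ibpWeight, ih, pow_succ']

end Lists

/-! ### Peetre's inequality and integration by parts for the phase `y·η` -/

section Amplitudes

variable {n : ℕ}

theorem japanese_add_le (ξ η : E n) : japanese (ξ + η) ≤ 2 * japanese η * japanese ξ := by
  have h1 := japanese_pos ξ
  have h2 := japanese_pos η
  refine le_of_sq_le_sq ?_ (by positivity)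
  have h3 : ‖ξ + η‖ ^ 2 ≤ 2 * (‖ξ‖ ^ 2 + ‖η‖ ^ 2) := by
    have := norm_add_le ξ η
    nlinarith [sq_nonneg (‖ξ‖ - ‖η‖), norm_nonneg (ξ + η)]
  rw [mul_pow, mul_pow, japanese_sq, japanese_sq, japanese_sq]
  nlinarith [sq_nonneg ‖ξ‖, sq_nonneg ‖η‖, mul_nonneg (sq_nonneg ‖ξ‖) (sq_nonneg ‖η‖)]

/-- Peetre's inequality. -/
theorem japanese_rpow_add_le {m : ℝ} {μ : ℕ} (hμ : |m| ≤ μ) (ξ η : E n) :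
    japanese (ξ + η) ^ m ≤ 2 ^ μ * (japanese ξ ^ m * japanese η ^ μ) := by
  have h1 := japanese_pos ξ
  have h2 := one_le_japanese η
  have h3 := japanese_pos (ξ + η)
  have key : ∀ r : ℝ, 0 ≤ r → r ≤ μ → (2 * japanese η) ^ r ≤ 2 ^ μ * japanese η ^ μ :=
    fun r _ hr => by
      rw [← mul_pow, ← Real.rpow_natCast]
      exact Real.rpow_le_rpow_of_exponent_le (by linarith) hr
  rcases le_total 0 m with hm | hm
  · calc japanese (ξ + η) ^ m ≤ (2 * japanese η * japanese ξ) ^ m :=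
          Real.rpow_le_rpow h3.le (japanese_add_le ξ η) hm
      _ = (2 * japanese η) ^ m * japanese ξ ^ m := Real.mul_rpow (by positivity) h1.le
      _ ≤ 2 ^ μ * japanese η ^ μ * japanese ξ ^ m := by
          gcongr; exact key m hm ((le_abs_self m).trans hμ)
      _ = _ := by ring
  -- For nonpositive `m` write `ξ = (ξ + η) + (-η)`; raising to the power `m` reverses the
  -- inequality.
  · have h4 : japanese ξ ≤ 2 * japanese η * japanese (ξ + η) := by
      have := japanese_add_le (ξ + η) (-η)
      rwa [add_neg_cancel_right, show japanese (-η) = japanese η by simp [japanese]] at this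
    have h5 : (2 * japanese η) ^ m * japanese (ξ + η) ^ m ≤ japanese ξ ^ m := by
      rw [← Real.mul_rpow (by positivity) h3.le]
      exact Real.rpow_le_rpow_of_nonpos h1 h4 hm
    have h6 := key (-m) (by linarith) ((neg_le_abs m).trans hμ)
    have h7 : (2 * japanese η) ^ (-m) * (2 * japanese η) ^ m = 1 := by
      rw [← Real.rpow_add (by positivity), neg_add_cancel, Real.rpow_zero]
    calc japanese (ξ + η) ^ m
        = (2 * japanese η) ^ (-m) * ((2 * japanese η) ^ m * japanese (ξ + η) ^ m) := by
          rw [← mul_assoc, h7, one_mul]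
      _ ≤ (2 ^ μ * japanese η ^ μ) * japanese ξ ^ m := by gcongr
      _ = _ := by ring

theorem integrable_japanese_inv_pow : Integrable fun y : E n => (japanese y)⁻¹ ^ (n + 1) := by
  have := integrable_rpow_neg_one_add_norm_sq (E := E n) (μ := volume) (r := ((n + 1 : ℕ) : ℝ))
    (by simp)
  refine this.congr (Eventually.of_forall fun y => ?_)
  dsimp only
  rw [← japanese_sq, inv_pow, ← Real.rpow_natCast, ← Real.rpow_natCast,
    ← Real.rpow_mul (japanese_pos y).le, ← Real.rpow_neg (japanese_pos y).le]
  congr 1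
  push_cast
  ring

/-- The coordinate directions of `(y, η)`, with the indices of the corresponding variables of
a double symbol. -/
def ampDir (n : ℕ) : Fin 3 → Fin n → E n × E n :=
  ![fun _ => 0, fun j => (0, EuclideanSpace.single j 1), fun j => (EuclideanSpace.single j 1, 0)]

/-- The integrations by parts in an oscillatory integral over `(y, η)`: `n + 1` times in `η` and
`q` times in `y`. -/
def ampOps (n q : ℕ) : List ((E n × E n → E n) × Fin 3) :=
  List.replicate q (Prod.snd, 2) ++ List.replicate (n + 1) (Prod.fst, 1)

/-- `e^{-iy·η}` -/
def ampOsc (n : ℕ) (z : E n × E n) : ℂ := Complex.exp (-(Complex.I * (phase z.1 z.2 : ℂ)))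

theorem ampCount (n q : ℕ) : ibpCount (ampOps n q) = ![0, n + 1, q] := by
  rw [ampOps, ibpCount_append, ibpCount_replicate, ibpCount_replicate]
  ext i
  fin_cases i <;> simp

theorem ampWeight (n q : ℕ) (z : E n × E n) :
    ibpWeight (ampOps n q) z = (japanese z.2)⁻¹ ^ q * (japanese z.1)⁻¹ ^ (n + 1) := by
  rw [ampOps, ibpWeight_append, ibpWeight_replicate, ibpWeight_replicate]

theorem hasDerivAt_exp_neg_I_mul {u : ℝ → ℝ} {u' t : ℝ} (hu : HasDerivAt u u' t) :
    HasDerivAt (fun t => Complex.exp (-(Complex.I * (u t : ℂ))))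
      (-Complex.I * u' * Complex.exp (-(Complex.I * (u t : ℂ)))) t := by
  refine (HasDerivAt.cexp (f := fun t => -(Complex.I * (u t : ℂ)))
    ((hu.ofReal_comp.const_mul Complex.I).neg)).congr_deriv ?_
  ring

theorem norm_exp_neg_I_mul (r : ℝ) : ‖Complex.exp (-(Complex.I * (r : ℂ)))‖ = 1 := by
  rw [← mul_neg, ← Complex.ofReal_neg, mul_comm, Complex.norm_exp_ofReal_mul_I]

theorem affineAlong_of_linear {ι Z : Type*} [NormedAddCommGroup Z] [NormedSpace ℝ Z]
    (d : ι → Fin n → Z) (L : Z →L[ℝ] E n) : AffineAlong d L :=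
  ⟨L.continuous, fun i j => ⟨L (d i j), fun z t => by simp⟩⟩

theorem isOsc_ampOps (n q : ℕ) : IsOsc (ampDir n) (ampOps n q) (ampOsc n) where
  continuous := by unfold ampOsc phase; fun_prop
  norm_eq z := norm_exp_neg_I_mul _
  deriv o ho j z := by
    simp only [ampOps, List.mem_append, List.mem_replicate] at ho
    rcases ho with ⟨-, rfl⟩ | ⟨-, rfl⟩
    · have h : HasDerivAt (fun t : ℝ => phase (z + t • ampDir n 2 j).1 (z + t • ampDir n 2 j).2)
          (z.2 j) 0 := by
        simpa [phase, ampDir, inner_add_left, inner_smul_left, EuclideanSpace.inner_single_left]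
          using ((hasDerivAt_id (0 : ℝ)).mul_const (z.2 j)).const_add (inner ℝ z.1 z.2)
      simpa [HasLineDerivAt, ampOsc] using hasDerivAt_exp_neg_I_mul h
    · have h : HasDerivAt (fun t : ℝ => phase (z + t • ampDir n 1 j).1 (z + t • ampDir n 1 j).2)
          (z.1 j) 0 := by
        simpa [phase, ampDir, inner_add_right, inner_smul_right, EuclideanSpace.inner_single_right]
          using ((hasDerivAt_id (0 : ℝ)).mul_const (z.1 j)).const_add (inner ℝ z.1 z.2)
      simpa [HasLineDerivAt, ampOsc] using hasDerivAt_exp_neg_I_mul h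
  inv o ho j z t := by
    simp only [ampOps, List.mem_append, List.mem_replicate] at ho
    rcases ho with ⟨-, rfl⟩ | ⟨-, rfl⟩ <;> simp [ampDir]
  affine o ho := by
    simp only [ampOps, List.mem_append, List.mem_replicate] at ho
    rcases ho with ⟨-, rfl⟩ | ⟨-, rfl⟩
    · exact affineAlong_of_linear _ (ContinuousLinearMap.snd ℝ (E n) (E n))
    · exact affineAlong_of_linear _ (ContinuousLinearMap.fst ℝ (E n) (E n))

/-- The absolutely convergent integral over `(y, η)` which represents an oscillatory integral. -/
def ampIntegral (q : ℕ) (b : E n × E n → ℂ) : ℂ :=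
  ∫ z, ampOsc n z * ibpOps (ampDir n) (ampOps n q) b z

theorem integrable_ampWeight : Integrable fun z : E n × E n =>
    (japanese z.2)⁻¹ ^ (n + 1) * (japanese z.1)⁻¹ ^ (n + 1) := by
  have := (integrable_japanese_inv_pow (n := n)).mul_prod (integrable_japanese_inv_pow (n := n))
  rw [← Measure.volume_eq_prod] at this
  exact this.congr (Eventually.of_forall fun z => mul_comm _ _)

/-- The reason for `q = μ + (n + 1)`: `μ` powers cancel the growth `⟨η⟩^μ` of the amplitude and `n +
1` remain for integrability. -/
theorem ampWeight_mul (μ : ℕ) (z : E n × E n) :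
    ibpWeight (ampOps n (μ + (n + 1))) z * japanese z.2 ^ μ =
      (japanese z.2)⁻¹ ^ (n + 1) * (japanese z.1)⁻¹ ^ (n + 1) := by
  have h : (japanese z.2)⁻¹ ^ μ * japanese z.2 ^ μ = 1 := by
    rw [← mul_pow, inv_mul_cancel₀ (japanese_pos z.2).ne', one_pow]
  rw [ampWeight, pow_add]
  linear_combination ((japanese z.2)⁻¹ ^ (n + 1) * (japanese z.1)⁻¹ ^ (n + 1)) * h

instance isAddHaarMeasure_volume_prod {X Y : Type*} [NormedAddCommGroup X] [NormedSpace ℝ X]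
    [FiniteDimensional ℝ X] [MeasureSpace X] [BorelSpace X] [(volume : Measure X).IsAddHaarMeasure]
    [NormedAddCommGroup Y] [NormedSpace ℝ Y] [FiniteDimensional ℝ Y] [MeasureSpace Y]
    [BorelSpace Y] [(volume : Measure Y).IsAddHaarMeasure] :
    (volume : Measure (X × Y)).IsAddHaarMeasure := by
  rw [Measure.volume_eq_prod]
  infer_instance

/-! ### Amplitude integrals that depend on a parameter -/

section Family

variable {P : Type*} [NormedAddCommGroup P] [NormedSpace ℝ P] {ω : P → ℝ} {μ : ℕ}

theorem bd_ibpOps_ampOps (hω : ∀ p, 0 ≤ ω p) {F : P × E n × E n → ℂ}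
    (hF : Reg (liftDir P (ampDir n)) (Bd fun z => ω z.1 * japanese z.2.2 ^ μ)
      ![0, n + 1, μ + (n + 1)] F) :
    Bd (fun z : P × E n × E n => ω z.1 * ((japanese z.2.2)⁻¹ ^ (n + 1) * (japanese z.2.1)⁻¹ ^ (n + 1)))
      fun z => ampOsc n z.2 *
        ibpOps (ampDir n) (ampOps n (μ + (n + 1))) (fun w => F (z.1, w)) z.2 := by
  have ho := (isOsc_ampOps n (μ + (n + 1))).comp (φ := (Prod.snd : P × E n × E n → E n × E n))
    continuous_snd (snd_add_liftDir (P := P) (ampDir n))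
  have h1 := Reg.ibpOps (c := 0) _ ho.affine
    (fun z => mul_nonneg (hω z.1) (pow_nonneg (japanese_pos z.2.2).le μ))
    (F := F) (by rwa [zero_add, ibpCount_pullOps, ampCount])
  have h2 := (h1.base.bounded_mul ho.continuous fun z => (ho.norm_eq z).le).mono
    (W' := fun z => ω z.1 * ((japanese z.2.2)⁻¹ ^ (n + 1) * (japanese z.2.1)⁻¹ ^ (n + 1)))
    zero_le_one fun z => by
      rw [ibpWeight_pullOps, one_mul, mul_left_comm, ampWeight_mul]
  simpa only [← ibpOps_slice] using h2

theorem bd_ampIntegral (hω : ∀ p, 0 ≤ ω p) (hωc : Continuous ω) {F : P × E n × E n → ℂ}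
    (hF : Reg (liftDir P (ampDir n)) (Bd fun z => ω z.1 * japanese z.2.2 ^ μ)
      ![0, n + 1, μ + (n + 1)] F) :
    Bd ω fun p => ampIntegral (μ + (n + 1)) fun w => F (p, w) :=
  Bd.integral (bd_ibpOps_ampOps hω hF) (W := fun w : E n × E n =>
    (japanese w.2)⁻¹ ^ (n + 1) * (japanese w.1)⁻¹ ^ (n + 1)) hωc integrable_ampWeight fun _ =>
    mul_nonneg (pow_nonneg (japanese_inv_nonneg _) _) (pow_nonneg (japanese_inv_nonneg _) _)

/-- The derivative passes through the integrations by parts by `hasLineDerivAt_ibpOps` and through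
the integral by domination. The amplitude and its parameter derivative must both have the full
budget of `y`- and `η`-derivatives. -/
theorem hasLineDerivAt_ampIntegral (hω : ∀ p, 0 ≤ ω p) (hωc : Continuous ω)
    {F G : P × E n × E n → ℂ}
    (hF : Reg (liftDir P (ampDir n)) (Bd fun z => ω z.1 * japanese z.2.2 ^ μ)
      ![0, n + 1, μ + (n + 1)] F)
    (hG : Reg (liftDir P (ampDir n)) (Bd fun z => ω z.1 * japanese z.2.2 ^ μ)
      ![0, n + 1, μ + (n + 1)] G) {v : P} (hFG : ∀ z, HasLineDerivAt ℝ F (G z) z (v, 0)) (p : P) :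
    HasLineDerivAt ℝ (fun p => ampIntegral (μ + (n + 1)) fun w => F (p, w))
      (ampIntegral (μ + (n + 1)) fun w => G (p, w)) p v := by
  have ho := (isOsc_ampOps n (μ + (n + 1))).comp (φ := (Prod.snd : P × E n × E n → E n × E n))
    continuous_snd (snd_add_liftDir (P := P) (ampDir n))
  refine (bd_ibpOps_ampOps hω hF).hasLineDerivAt_integral (bd_ibpOps_ampOps hω hG) hωc
    integrable_ampWeight (fun w => mul_nonneg (pow_nonneg (japanese_inv_nonneg _) _)
      (pow_nonneg (japanese_inv_nonneg _) _)) (fun z => ?_) p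
  have hW : ∀ z : P × E n × E n, 0 ≤ ω z.1 * japanese z.2.2 ^ μ := fun z =>
    mul_nonneg (hω z.1) (pow_nonneg (japanese_pos z.2.2).le μ)
  have h1 := hasLineDerivAt_ibpOps (v := (v, 0)) ho.affine (fun o h z t => by
      simp only [pullOps, List.mem_map] at h
      obtain ⟨o, -, rfl⟩ := h
      simp) hW hW (by rwa [ibpCount_pullOps, ampCount]) (by rwa [ibpCount_pullOps, ampCount]) hFG z
  simp only [HasLineDerivAt, Prod.snd_add, Prod.smul_snd, smul_zero, add_zero, Prod.fst_add,
    Prod.smul_fst, ← ibpOps_slice] at h1 ⊢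
  convert! HasDerivAt.const_mul (ampOsc n z.2) h1 using 3 with t
  congr 1
  ext <;> simp

end Family

theorem hasOscIntegral_of_reg {μ : ℕ} {b : E n → E n → ℂ}
    (hb : Reg (ampDir n) (Bd fun z => japanese z.2 ^ μ) ![0, n + 1, μ + (n + 1)]
      fun z => b z.1 z.2) :
    HasOscIntegral phase b
      ((((2 * Real.pi) ^ n)⁻¹ : ℝ) * ampIntegral (μ + (n + 1)) fun z => b z.1 z.2) := by
  intro χ hχ
  have hW : ∀ z : E n × E n, japanese z.2 ^ μ ≤ 1 * (1 + ‖z‖) ^ μ := fun z => by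
    have h1 := japanese_pos z.2
    rw [one_mul]
    refine pow_le_pow_left₀ h1.le (le_of_sq_le_sq ?_ (by positivity)) μ
    have h2 : ‖z.2‖ ≤ ‖z‖ := le_max_right _ _
    rw [japanese_sq]
    nlinarith [norm_nonneg z.2]
  have := (isOsc_ampOps n (μ + (n + 1))).tendsto_regularisation (μ := volume)
    (fun z => pow_nonneg (japanese_pos z.2).le μ) zero_le_one hW
    (by simpa only [ampWeight_mul] using integrable_ampWeight) (by rwa [ampCount]) χ hχ
  refine ⟨this.1, ?_⟩
  rw [finrank_euclideanSpace_fin]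
  exact this.2.const_mul _

end Amplitudes

/-! ### The left symbol of a double symbol -/

section LeftSymbol

variable {n : ℕ}

theorem integrable_ampIntegrand {μ : ℕ} {b : E n × E n → ℂ}
    (hb : Reg (ampDir n) (Bd fun z => japanese z.2 ^ μ) ![0, n + 1, μ + (n + 1)] b) :
    Integrable fun z => ampOsc n z * ibpOps (ampDir n) (ampOps n (μ + (n + 1))) b z := by
  have ho := isOsc_ampOps n (μ + (n + 1))
  have h1 := Reg.ibpOps (c := 0) _ ho.affine (fun z => pow_nonneg (japanese_pos z.2).le μ)
    (F := b) (by rwa [zero_add, ampCount])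
  simp only [ampWeight_mul] at h1
  exact (h1.base.bounded_mul ho.continuous fun z => (ho.norm_eq z).le).integrable
    integrable_ampWeight

theorem ampIntegral_sub {μ : ℕ} {b b' : E n × E n → ℂ}
    (hb : Reg (ampDir n) (Bd fun z => japanese z.2 ^ μ) ![0, n + 1, μ + (n + 1)] b)
    (hb' : Reg (ampDir n) (Bd fun z => japanese z.2 ^ μ) ![0, n + 1, μ + (n + 1)] b') :
    ampIntegral (μ + (n + 1)) (fun z => b z - b' z) =
      ampIntegral (μ + (n + 1)) b - ampIntegral (μ + (n + 1)) b' := by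
  have hW : ∀ z : E n × E n, 0 ≤ japanese z.2 ^ μ := fun z => pow_nonneg (japanese_pos z.2).le μ
  rw [ampIntegral, ampIntegral, ampIntegral, ← integral_sub (integrable_ampIntegrand hb)
    (integrable_ampIntegrand hb')]
  refine integral_congr_ae (Eventually.of_forall fun z => ?_)
  dsimp only
  rw [ibpOps_sub (isOsc_ampOps n (μ + (n + 1))).affine hW hW (by rwa [ampCount])
    (by rwa [ampCount]), mul_sub]

variable {s : ℝ≥0} {m : ℝ} {μ : ℕ}

/-- The left symbol, expressed by an absolutely convergent integral; here the third variable of `f`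
is `x' - x`. -/
def leftSymbol (q : ℕ) (f : E n × E n × E n → ℂ) (p : E n × E n) : ℂ :=
  (((2 * Real.pi) ^ n)⁻¹ : ℝ) * ampIntegral q fun w => f (p.1, p.2 + w.2, w.1)

/-- Peetre's inequality separates the parameter weight `⟨ξ⟩^m` from the growth in `η`. Here `x` is
only a parameter, hence `c 0 = 0`. -/
theorem reg_amplitude (hμ : |m| ≤ μ) {c : Fin 3 → ℕ} (hc : c 0 = 0) {f : E n × E n × E n → ℂ}
    (hf : Reg (symbolDir n) (HolderBd s fun q : E n × E n => japanese q.1 ^ m) c f) :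
    Reg (liftDir (E n × E n) (ampDir n)) (Bd fun z => japanese z.1.2 ^ m * japanese z.2.2 ^ μ) c
      fun z => f (z.1.1, z.1.2 + z.2.2, z.2.1) := by
  refine hf.comp (φ := fun z : (E n × E n) × E n × E n => (z.1.1, z.1.2 + z.2.2, z.2.1))
    (fun i hi j z t => ?_) fun f hf => ?_
  · fin_cases i
    · exact absurd hi (by simp [hc])
    · simp [liftDir, ampDir, symbolDir, add_assoc]
    · simp [liftDir, ampDir, symbolDir]
  · obtain ⟨hcont, C, hC, hb, -⟩ := hf
    refine ⟨by fun_prop, C * 2 ^ μ, by positivity, fun z => (hb _).trans ?_⟩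
    rw [mul_assoc]
    exact mul_le_mul_of_nonneg_left (japanese_rpow_add_le hμ _ _) hC

/-- With `(x₁, x₂, ξ)` as the parameter, the difference is again an amplitude, whose weight carries
`|x₁ - x₂|^s`. The Hölder estimate of the left symbol thus becomes an instance of `bd_ampIntegral`.
-/
theorem reg_amplitude_sub (hμ : |m| ≤ μ) {c : Fin 3 → ℕ} (hc : c 0 = 0)
    {f : E n × E n × E n → ℂ}
    (hf : Reg (symbolDir n) (HolderBd s fun q : E n × E n => japanese q.1 ^ m) c f) :
    Reg (liftDir ((E n × E n) × E n) (ampDir n))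
      (Bd fun z => (japanese z.1.2 ^ m * ‖z.1.1.1 - z.1.1.2‖ ^ (s : ℝ)) * japanese z.2.2 ^ μ) c
      fun z => f (z.1.1.1, z.1.2 + z.2.2, z.2.1) - f (z.1.1.2, z.1.2 + z.2.2, z.2.1) := by
  refine hf.map (fun f (z : ((E n × E n) × E n) × E n × E n) =>
    f (z.1.1.1, z.1.2 + z.2.2, z.2.1) - f (z.1.1.2, z.1.2 + z.2.2, z.2.1))
    (σ := id) Function.injective_id (τ := fun _ => id) (fun f hf => ?_)
    fun f g i j hi _ _ hfg z => ?_
  · obtain ⟨hcont, C, hC, -, hh⟩ := hf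
    refine ⟨by fun_prop, C * 2 ^ μ, by positivity, fun z => (hh _ _ _).trans ?_⟩
    have := Real.rpow_nonneg (norm_nonneg (z.1.1.1 - z.1.1.2)) s
    calc C * (japanese (z.1.2 + z.2.2) ^ m * ‖z.1.1.1 - z.1.1.2‖ ^ (s : ℝ))
        ≤ C * ((2 ^ μ * (japanese z.1.2 ^ m * japanese z.2.2 ^ μ)) *
            ‖z.1.1.1 - z.1.1.2‖ ^ (s : ℝ)) := by
          gcongr; exact japanese_rpow_add_le hμ _ _
      _ = _ := by ring
  · have hφ : ∀ (x : E n) (t : ℝ), ((x, (z + t • liftDir ((E n × E n) × E n) (ampDir n) i j).1.2 +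
        (z + t • liftDir ((E n × E n) × E n) (ampDir n) i j).2.2,
        (z + t • liftDir ((E n × E n) × E n) (ampDir n) i j).2.1) : E n × E n × E n) =
        (x, z.1.2 + z.2.2, z.2.1) + t • symbolDir n i j := fun x t => by
      fin_cases i
      · exact absurd hi (by simp [hc])
      · simp [liftDir, ampDir, symbolDir, add_assoc]
      · simp [liftDir, ampDir, symbolDir]
    simp only [HasLineDerivAt, hφ]
    simp only [fst_add_liftDir]
    exact (hfg (z.1.1.1, z.1.2 + z.2.2, z.2.1)).sub (hfg (z.1.1.2, z.1.2 + z.2.2, z.2.1))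

theorem reg_amplitude_slice (hμ : |m| ≤ μ) {c : Fin 3 → ℕ} (hc : c 0 = 0)
    {f : E n × E n × E n → ℂ}
    (hf : Reg (symbolDir n) (HolderBd s fun q : E n × E n => japanese q.1 ^ m) c f) (x ξ : E n) :
    Reg (ampDir n) (Bd fun z => japanese z.2 ^ μ) c fun w => f (x, ξ + w.2, w.1) :=
  ((reg_amplitude hμ hc hf).comp (φ := fun w => ((x, ξ), w))
    (fun i _ j w t => slice_add (ampDir n) (x, ξ) i j w t)
    fun f hf => hf.comp (by fun_prop)).bd_mono (Real.rpow_nonneg (japanese_pos ξ).le m)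
      fun z => le_rfl

theorem holderBd_leftSymbol (hμ : |m| ≤ μ) {f : E n × E n × E n → ℂ}
    (hf : Reg (symbolDir n) (HolderBd s fun q : E n × E n => japanese q.1 ^ m)
      ![0, n + 1, μ + (n + 1)] f) :
    HolderBd s (fun ξ : E n => japanese ξ ^ m) (leftSymbol (μ + (n + 1)) f) := by
  have hj : ∀ ξ : E n, 0 ≤ japanese ξ ^ m := fun ξ => Real.rpow_nonneg (japanese_pos ξ).le m
  have hjc : Continuous fun ξ : E n => japanese ξ ^ m :=
    continuous_japanese.rpow_const fun ξ => Or.inl (japanese_pos ξ).ne'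
  obtain ⟨h1c, C₁, hC₁, h1⟩ := (bd_ampIntegral (P := E n × E n) (ω := fun p => japanese p.2 ^ m)
    (fun p => hj p.2) (hjc.comp continuous_snd) (reg_amplitude hμ rfl hf)).const_mul
      ((((2 * Real.pi) ^ n)⁻¹ : ℝ) : ℂ)
  obtain ⟨-, C₂, hC₂, h2⟩ := (bd_ampIntegral (P := (E n × E n) × E n)
    (ω := fun p => japanese p.2 ^ m * ‖p.1.1 - p.1.2‖ ^ (s : ℝ))
    (fun p => mul_nonneg (hj p.2) (Real.rpow_nonneg (norm_nonneg _) _))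
    ((hjc.comp continuous_snd).mul
      ((by fun_prop : Continuous fun p : (E n × E n) × E n => ‖p.1.1 - p.1.2‖).rpow_const
        fun p => Or.inr s.coe_nonneg)) (reg_amplitude_sub hμ rfl hf)).const_mul
      ((((2 * Real.pi) ^ n)⁻¹ : ℝ) : ℂ)
  refine ⟨h1c, C₁ + C₂, by positivity, fun p => (h1 p).trans ?_, fun x₁ x₂ ξ => ?_⟩
  · have := hj p.2
    gcongr
    linarith
  · have h3 := h2 ((x₁, x₂), ξ)
    dsimp only at h3
    rw [ampIntegral_sub (reg_amplitude_slice hμ rfl hf x₁ ξ) (reg_amplitude_slice hμ rfl hf x₂ ξ),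
      mul_sub] at h3
    refine h3.trans ?_
    have := mul_nonneg (hj ξ) (Real.rpow_nonneg (norm_nonneg (x₁ - x₂)) s)
    gcongr
    linarith

/-- Derivatives of the left symbol in `x` and `ξ` are left symbols of derivatives of `f`, since `ξ`
enters only through `ξ + η`. The surplus `![0, n + 1, μ + (n + 1)]` is what the integral itself
consumes. -/
theorem reg_leftSymbol (hμ : |m| ≤ μ) {c : Fin 3 → ℕ} (hc : c 2 = 0)
    {f : E n × E n × E n → ℂ}
    (hf : Reg (symbolDir n) (HolderBd s fun q : E n × E n => japanese q.1 ^ m)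
      (c + ![0, n + 1, μ + (n + 1)]) f) :
    Reg (singleDir n) (HolderBd s fun ξ : E n => japanese ξ ^ m) c
      (leftSymbol (μ + (n + 1)) f) := by
  refine hf.nest.map (leftSymbol (μ + (n + 1))) (σ := id) Function.injective_id
    (τ := fun _ => id) (fun f hf => holderBd_leftSymbol hμ hf) fun f g i j hi hf hg hfg p => ?_
  have hφ : ∀ (z : (E n × E n) × E n × E n) (t : ℝ),
      (((z + t • ((singleDir n i j, 0) : (E n × E n) × E n × E n)).1.1,
      (z + t • ((singleDir n i j, 0) : (E n × E n) × E n × E n)).1.2 +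
        (z + t • ((singleDir n i j, 0) : (E n × E n) × E n × E n)).2.2,
      (z + t • ((singleDir n i j, 0) : (E n × E n) × E n × E n)).2.1) : E n × E n × E n) =
      (z.1.1, z.1.2 + z.2.2, z.2.1) + t • symbolDir n i j := fun z t => by
    fin_cases i
    · simp [singleDir, symbolDir]
    · simp [singleDir, symbolDir, add_right_comm]
    · exact absurd hi (by simp [hc])
  have hFG : ∀ z : (E n × E n) × E n × E n,
      HasLineDerivAt ℝ (fun z : (E n × E n) × E n × E n => f (z.1.1, z.1.2 + z.2.2, z.2.1))
        (g (z.1.1, z.1.2 + z.2.2, z.2.1)) z (singleDir n i j, 0) := fun z => by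
    simp only [HasLineDerivAt, hφ]
    exact hfg _
  have key := hasLineDerivAt_ampIntegral (ω := fun p : E n × E n => japanese p.2 ^ m)
    (fun p => Real.rpow_nonneg (japanese_pos p.2).le m)
    ((continuous_japanese.rpow_const fun ξ => Or.inl (japanese_pos ξ).ne').comp continuous_snd)
    (reg_amplitude hμ rfl hf) (reg_amplitude hμ rfl hg) hFG p
  exact HasDerivAt.const_mul _ key

end LeftSymbol

/-! ### Products and integrations by parts -/

section Products

variable {n : ℕ} {ι Z : Type*} [DecidableEq ι] [NormedAddCommGroup Z] [NormedSpace ℝ Z]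

theorem ibpOps_append (d : ι → Fin n → Z) (l l' : List ((Z → E n) × ι)) (F : Z → ℂ) :
    ibpOps d (l ++ l') F = ibpOps d l (ibpOps d l' F) := by
  induction l with
  | nil => rfl
  | cons o l ih => simp only [List.cons_append, ibpOps, ih]

/-- Lets each group of integrations by parts act on only one factor of a product amplitude. -/
theorem ibpOps_invariant_mul {d : ι → Fin n → Z} {l : List ((Z → E n) × ι)} {A : Z → ℂ}
    (hA : ∀ o ∈ l, ∀ j z (t : ℝ), A (z + t • d o.2 j) = A z) (F : Z → ℂ) :
    ibpOps d l (fun z => A z * F z) = fun z => A z * ibpOps d l F z := by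
  induction l with
  | nil => rfl
  | cons o l ih =>
    have hd : ∀ j z, lineDeriv ℝ (fun z => A z * ibpOps d l F z) z (d o.2 j) =
        A z * lineDeriv ℝ (ibpOps d l F) z (d o.2 j) := fun j z => by
      simp only [lineDeriv, hA o (by simp)]
      rw [deriv_const_mul_field']
    ext z
    simp only [ibpOps, ibpOp, ih fun o ho => hA o (by simp [ho]), hd, mul_add, Finset.mul_sum]
    congr 1
    · ring
    · exact Finset.sum_congr rfl fun j _ => by ring

/-- Derivatives in the directions of a family along which the function is invariant vanish. -/
theorem Reg.add_invariant [Fintype ι] {d : ι → Fin n → Z} {B : (Z → ℂ) → Prop} {c : ι → ℕ}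
    {f : Z → ℂ} (h : Reg d B c f) (h0 : B fun _ => 0) {i : ι}
    (hinv : ∀ j z (t : ℝ), f (z + t • d i j) = f z) (r : ℕ) : Reg d B (c + Pi.single i r) f := by
  induction c using count_induction generalizing f r with
  | _ c ih =>
    refine of_hasLineDerivAt h.base fun k j hk => ?_
    by_cases hki : k = i
    · subst hki
      refine ⟨fun _ => 0, fun z => ?_, of_invariant h0 h0 (by simp) _⟩
      simp only [HasLineDerivAt, hinv]
      exact hasDerivAt_const _ _
    · have hck : 0 < c k := by simpa [hki] using hk
      refine ⟨_, fun z => h.hasLineDerivAt hck j z, ?_⟩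
      have h1 := ih k hck (h.step hck j) (fun j' z t => by
        simp only [lineDeriv, add_right_comm z (t • d i j'), hinv]) r
      refine h1.mono_count fun i' => ?_
      simp only [Pi.sub_apply, Pi.add_apply]
      omega

theorem reg_schwartz_comp [Fintype ι] (d : ι → Fin n → Z) (L : Z →L[ℝ] E n) (x : E n) (R : ℕ)
    (c : ι → ℕ) (u : 𝓢(E n, ℂ)) :
    Reg d (Bd fun z => (japanese (L z))⁻¹ ^ R) c fun z => u (x + L z) := by
  induction c using count_induction generalizing u with
  | _ c ih =>
    refine Reg.of_hasLineDerivAt ?_ fun i j hi =>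
      ⟨_, fun z => ?_, ih i hi (LineDeriv.lineDerivOp (L (d i j)) u)⟩
    · obtain ⟨C, hC, h⟩ := schwartz_le_one_add_norm u R
      refine ⟨u.continuous.comp (by fun_prop), C * (1 + ‖x‖) ^ R, by positivity, fun z => ?_⟩
      refine (h _).trans ?_
      rw [mul_assoc]
      refine mul_le_mul_of_nonneg_left ?_ hC
      have hj := japanese_pos (L z)
      have h1 : japanese (L z) ≤ (1 + ‖x‖) * (1 + ‖x + L z‖) := by
        have h2 : japanese (L z) ≤ 1 + ‖L z‖ := by
          refine le_of_sq_le_sq ?_ (by positivity)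
          rw [japanese_sq]
          nlinarith [norm_nonneg (L z)]
        have h3 : ‖L z‖ ≤ ‖x + L z‖ + ‖x‖ := by
          simpa using norm_sub_le (x + L z) x
        nlinarith [norm_nonneg x, norm_nonneg (x + L z)]
      dsimp only
      rw [inv_pow, ← div_eq_mul_inv, inv_le_comm₀ (by positivity) (by positivity), inv_div,
        div_le_iff₀ (by positivity), mul_comm, ← mul_pow]
      exact pow_le_pow_left₀ hj.le h1 R
    · have h1 : HasLineDerivAt ℝ u (LineDeriv.lineDerivOp (L (d i j)) u (x + L z)) (x + L z)
          (L (d i j)) := by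
        rw [SchwartzMap.lineDerivOp_apply]
        exact (u.differentiableAt).lineDifferentiableAt.hasLineDerivAt
      simpa [HasLineDerivAt, add_assoc] using h1

end Products

/-! ### The operator of a double symbol -/

section Operator

variable {n : ℕ}

/-- The directions of `ξ`, `y` and `w = y + y'` in the coordinates `((y, y'), (ξ, ξ'))`. -/
def opDir (n : ℕ) : Fin 3 → Fin n → (E n × E n) × E n × E n :=
  ![fun j => ((0, EuclideanSpace.single j 1), 0), fun j => (0, (EuclideanSpace.single j 1, 0)),
    fun j => ((EuclideanSpace.single j 1, -EuclideanSpace.single j 1), 0)]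

/-- `(ξ', (y, ξ - ξ'))` as a function of `((y, y'), (ξ, ξ'))`. -/
def opParam (z : (E n × E n) × E n × E n) : E n × E n × E n :=
  (z.2.2, (z.1.1, z.2.1 - z.2.2))

/-- The integrations by parts for the operator of a double symbol. -/
def opOps (n q : ℕ) : List (((E n × E n) × E n × E n → E n) × Fin 3) :=
  pullOps (fun z => (opParam z).2) (ampOps n q) ++ List.replicate q (fun z => z.2.2, 0)

/-- `e^{-i(y·ξ + y'·ξ')}` -/
def opOsc (n : ℕ) (z : (E n × E n) × E n × E n) : ℂ :=
  Complex.exp (-(Complex.I * (phase₂ z.1 z.2 : ℂ)))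

theorem opCount (n q : ℕ) : ibpCount (opOps n q) = ![0, n + 1, q] + Pi.single 0 q := by
  rw [opOps, ibpCount_append, ibpCount_pullOps, ampCount, ibpCount_replicate]

theorem opWeight (n q : ℕ) (z : (E n × E n) × E n × E n) :
    ibpWeight (opOps n q) z = (japanese (z.2.1 - z.2.2))⁻¹ ^ q * (japanese z.1.1)⁻¹ ^ (n + 1) *
      (japanese z.2.2)⁻¹ ^ q := by
  rw [opOps, ibpWeight_append, ibpWeight_pullOps, ampWeight, ibpWeight_replicate]
  rfl

theorem mem_opOps {q : ℕ} {o : ((E n × E n) × E n × E n → E n) × Fin 3} (ho : o ∈ opOps n q) :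
    o = (fun z => z.2.1 - z.2.2, 2) ∨ o = (fun z => z.1.1, 1) ∨ o = (fun z => z.2.2, 0) := by
  simp only [opOps, pullOps, ampOps, List.map_append, List.map_replicate, List.mem_append,
    List.mem_replicate] at ho
  rcases ho with (⟨-, rfl⟩ | ⟨-, rfl⟩) | ⟨-, rfl⟩
  · exact Or.inl rfl
  · exact Or.inr (Or.inl rfl)
  · exact Or.inr (Or.inr rfl)

/-- In terms of `w = y + y'` the phase is `y·(ξ - ξ') + w·ξ'`. Differentiating along `y` with `w`
fixed (the direction `(e_j, -e_j)`), along `ξ`, and along `w` with `y` fixed brings down `ξ - ξ'`,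
`y` and `ξ'` respectively. -/
theorem isOsc_opOps (n q : ℕ) : IsOsc (opDir n) (opOps n q) (opOsc n) where
  continuous := by unfold opOsc phase₂; fun_prop
  norm_eq z := norm_exp_neg_I_mul _
  deriv o ho j z := by
    have key : ∀ i (r : ℝ), (∀ t : ℝ, phase₂ (z + t • opDir n i j).1 (z + t • opDir n i j).2 =
        phase₂ z.1 z.2 + t * r) →
        HasLineDerivAt ℝ (opOsc n) (-Complex.I * r * opOsc n z) z (opDir n i j) := fun i r h => by
      have h1 : HasDerivAt (fun t : ℝ => phase₂ (z + t • opDir n i j).1 (z + t • opDir n i j).2)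
          r 0 := by
        simp only [h]
        simpa using ((hasDerivAt_id (0 : ℝ)).mul_const r).const_add (phase₂ z.1 z.2)
      simpa [HasLineDerivAt, opOsc] using hasDerivAt_exp_neg_I_mul h1
    rcases mem_opOps ho with rfl | rfl | rfl
    · refine key 2 _ fun t => ?_
      simp [phase₂, opDir, inner_add_left, inner_smul_left, EuclideanSpace.inner_single_left]
      ring
    · refine key 1 _ fun t => ?_
      simp [phase₂, opDir, inner_add_right, inner_smul_right, EuclideanSpace.inner_single_right]
      ring
    · refine key 0 _ fun t => ?_
      simp [phase₂, opDir, inner_add_left, inner_smul_left, EuclideanSpace.inner_single_left]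
      ring
  inv o ho j z t := by
    rcases mem_opOps ho with rfl | rfl | rfl <;> simp [opDir]
  affine o ho := by
    rcases mem_opOps ho with rfl | rfl | rfl
    · exact affineAlong_of_linear _ ((ContinuousLinearMap.fst ℝ (E n) (E n) -
        ContinuousLinearMap.snd ℝ (E n) (E n)).comp (ContinuousLinearMap.snd ℝ (E n × E n) (E n × E n)))
    · exact affineAlong_of_linear _ ((ContinuousLinearMap.fst ℝ (E n) (E n)).comp
        (ContinuousLinearMap.fst ℝ (E n × E n) (E n × E n)))
    · exact affineAlong_of_linear _ ((ContinuousLinearMap.snd ℝ (E n) (E n)).comp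
        (ContinuousLinearMap.snd ℝ (E n × E n) (E n × E n)))

/-- The coordinates `((y, η), (w, ξ'))` with `η = ξ - ξ'`, `w = y + y'`. -/
def opCoord (v : (E n × E n) × E n × E n) : (E n × E n) × E n × E n :=
  ((v.1.1, -v.1.1 + v.2.1), (v.1.2 + v.2.2, v.2.2))

theorem measurePreserving_prodProdProdComm {α β γ δ : Type*} [MeasureSpace α] [MeasureSpace β]
    [MeasureSpace γ] [MeasureSpace δ] [SFinite (volume : Measure α)] [SFinite (volume : Measure β)]
    [SFinite (volume : Measure γ)] [SFinite (volume : Measure δ)] :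
    MeasurePreserving fun z : (α × β) × γ × δ => ((z.1.1, z.2.1), (z.1.2, z.2.2)) := by
  have h1 : MeasurePreserving (MeasurableEquiv.prodAssoc : (α × β) × γ × δ ≃ᵐ α × β × γ × δ) :=
    volume_preserving_prodAssoc
  have h2 : MeasurePreserving (MeasurableEquiv.prodAssoc : (β × γ) × δ ≃ᵐ β × γ × δ) :=
    volume_preserving_prodAssoc
  have h3 : MeasurePreserving (MeasurableEquiv.prodAssoc : (γ × β) × δ ≃ᵐ γ × β × δ) :=
    volume_preserving_prodAssoc
  have h4 : MeasurePreserving (MeasurableEquiv.prodAssoc : (α × γ) × β × δ ≃ᵐ α × γ × β × δ) :=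
    volume_preserving_prodAssoc
  have h5 : MeasurePreserving (Prod.map Prod.swap id : (β × γ) × δ → (γ × β) × δ) :=
    Measure.measurePreserving_swap.prod (MeasurePreserving.id volume)
  have h6 := (h3.comp h5).comp (h2.symm _)
  exact ((h4.symm _).comp ((MeasurePreserving.id volume).prod h6)).comp h1

theorem measurePreserving_opCoord : MeasurePreserving (opCoord (n := n)) := by
  have h1 := (measurePreserving_prod_neg_add (volume : Measure (E n)) (volume : Measure (E n))).prod
    (measurePreserving_add_prod (volume : Measure (E n)) (volume : Measure (E n)))
  exact h1.comp (measurePreserving_prodProdProdComm (α := E n) (β := E n) (γ := E n) (δ := E n))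

end Operator

/-! ### Comparison of the operators -/

section Comparison

variable {n : ℕ} {s : ℝ≥0} {m : ℝ} {μ : ℕ}

/-- The direction of `w` in the coordinates `(w, ξ')`. -/
def waveDir (n : ℕ) : Fin 3 → Fin n → E n × E n :=
  ![fun j => (EuclideanSpace.single j 1, 0), fun _ => 0, fun _ => 0]

/-- The factor of the integrand which depends on `(w, ξ')`. -/
def waveFactor (q : ℕ) (u : 𝓢(E n, ℂ)) (x : E n) : E n × E n → ℂ :=
  ibpOps (waveDir n) (List.replicate q (Prod.snd, 0)) fun v => u (x + v.1)

/-- For fixed `ξ` the decay of `u` makes the integrations by parts in `w` exact, so they can be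
undone; translation by `x` then yields the Fourier transform. -/
theorem integral_waveFactor (q : ℕ) (u : 𝓢(E n, ℂ)) (x ξ : E n) :
    ∫ w, ampOsc n (w, ξ) * waveFactor q u x (w, ξ) =
      Complex.exp (Complex.I * (inner ℝ x ξ : ℝ)) * fourierHat u ξ := by
  let d : Fin 3 → Fin n → E n := ![fun j => EuclideanSpace.single j 1, fun _ => 0, fun _ => 0]
  let l : List ((E n → E n) × Fin 3) := List.replicate q (fun _ => ξ, 0)
  have ho : IsOsc d l fun w => ampOsc n (w, ξ) := by
    have hl : ∀ o ∈ l, o = (fun _ => ξ, 0) := fun o ho => (List.mem_replicate.1 ho).2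
    refine ⟨(isOsc_ampOps n 0).continuous.comp (by fun_prop), fun w => norm_exp_neg_I_mul _,
      fun o h j w => ?_, fun o h j w t => ?_, fun o h => ?_⟩
    · rw [hl o h]
      have h1 : HasDerivAt (fun t : ℝ => phase (w + t • EuclideanSpace.single j (1 : ℝ)) ξ)
          (ξ j) 0 := by
        simpa [phase, inner_add_left, inner_smul_left, EuclideanSpace.inner_single_left]
          using ((hasDerivAt_id (0 : ℝ)).mul_const (ξ j)).const_add (inner ℝ w ξ)
      simpa [HasLineDerivAt, ampOsc, d] using hasDerivAt_exp_neg_I_mul h1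
    · rw [hl o h]
    · rw [hl o h]
      exact ⟨continuous_const, fun i j => ⟨0, fun z t => by simp⟩⟩
  have hslice : ∀ w, waveFactor q u x (w, ξ) = ibpOps d l (fun w => u (x + w)) w := fun w => by
    have := ibpOps_pullOps (d := waveDir n) (d' := d) (φ := fun w => (w, ξ))
      (l := List.replicate q (Prod.snd, 0)) (fun o ho j w t => by
        rw [(List.mem_replicate.1 ho).2]
        simp [waveDir, d]) (fun v => u (x + v.1)) w
    rw [waveFactor, ← this, pullOps, List.map_replicate]
    rfl
  have hW := integrable_japanese_inv_pow (n := n)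
  have h1 := ho.integral_ibpOps hW (fun w => pow_nonneg (japanese_inv_nonneg _) _)
    (F := fun w => u (x + w)) (reg_schwartz_comp d (ContinuousLinearMap.id ℝ (E n)) x (n + 1) _ u)
  simp only [hslice]
  rw [← h1, fourierHat, ← integral_const_mul,
    ← integral_add_left_eq_self (fun y => Complex.exp (Complex.I * (inner ℝ x ξ : ℝ)) *
      (Complex.exp (-(Complex.I * (inner ℝ y ξ : ℝ))) * u y)) x]
  refine integral_congr_ae (Eventually.of_forall fun w => ?_)
  dsimp only
  rw [← mul_assoc, ← Complex.exp_add, ampOsc, phase, inner_add_left]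
  congr 2
  push_cast
  ring

/-- The Schwartz function supplies decay in `w`, so no integration by parts in `ξ'` is required. The
growth `⟨ξ⟩^μ` is distributed over `ξ - ξ'` and `ξ'`, the two variables in which decay is gained. -/
theorem reg_opAmplitude (hμ : |m| ≤ μ) {f : E n × E n × E n → ℂ}
    (hf : Reg (symbolDir n) (HolderBd s fun q : E n × E n => japanese q.1 ^ m)
      ![0, n + 1, μ + (n + 1)] f) (u : 𝓢(E n, ℂ)) (x : E n) :
    Reg (opDir n) (Bd fun z => (japanese (z.2.1 - z.2.2) ^ μ * japanese z.2.2 ^ μ) *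
      (japanese (z.1.1 + z.1.2))⁻¹ ^ (n + 1)) (ibpCount (opOps n (μ + (n + 1))))
      fun z => f (x, z.2.1, z.1.1) * u (x + (z.1.1 + z.1.2)) := by
  rw [opCount]
  have hU := reg_schwartz_comp (opDir n)
    ((ContinuousLinearMap.fst ℝ (E n) (E n) + ContinuousLinearMap.snd ℝ (E n) (E n)).comp
      (ContinuousLinearMap.fst ℝ (E n × E n) (E n × E n))) x (n + 1)
    (![0, n + 1, μ + (n + 1)] + Pi.single 0 (μ + (n + 1))) u
  have hA : Reg (opDir n) (Bd fun z : (E n × E n) × E n × E n => japanese z.2.1 ^ μ)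
      ![0, n + 1, μ + (n + 1)] fun z => f (x, z.2.1, z.1.1) := by
    have h := (reg_amplitude_slice hμ rfl hf x 0).comp (d' := opDir n)
      (φ := fun z : (E n × E n) × E n × E n => (z.1.1, z.2.1)) (fun i hi j z t => by
        fin_cases i
        · exact absurd hi (by simp)
        · simp [opDir, ampDir]
        · simp [opDir, ampDir]) fun f hf => hf.comp (by fun_prop)
    simpa only [zero_add] using h
  -- The symbol factor does not depend on `y'`, so derivatives in family `0` are free; all of them
  -- fall on `u`.
  have hA' := hA.add_invariant (i := 0)
    (Bd.zero fun z => pow_nonneg (japanese_pos z.2.1).le μ)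
    (fun j z t => by simp [opDir]) (μ + (n + 1))
  refine (hA'.bd_mul hU).bd_mono (K := 2 ^ μ) (by positivity) fun z => ?_
  have h1 : japanese z.2.1 ^ μ ≤ 2 ^ μ * (japanese (z.2.1 - z.2.2) ^ μ * japanese z.2.2 ^ μ) := by
    have := japanese_add_le z.2.2 (z.2.1 - z.2.2)
    rw [add_sub_cancel] at this
    rw [← mul_pow, ← mul_pow, ← mul_assoc]
    exact pow_le_pow_left₀ (japanese_pos _).le this μ
  rw [← mul_assoc]
  exact mul_le_mul_of_nonneg_right h1 (pow_nonneg (japanese_inv_nonneg _) _)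

theorem opWeight_mul (μ : ℕ) (z : (E n × E n) × E n × E n) :
    ibpWeight (opOps n (μ + (n + 1))) z *
      ((japanese (z.2.1 - z.2.2) ^ μ * japanese z.2.2 ^ μ) *
        (japanese (z.1.1 + z.1.2))⁻¹ ^ (n + 1)) =
      ((japanese z.1.1)⁻¹ ^ (n + 1) * (japanese (z.1.1 + z.1.2))⁻¹ ^ (n + 1)) *
        ((japanese (z.2.1 - z.2.2))⁻¹ ^ (n + 1) * (japanese z.2.2)⁻¹ ^ (n + 1)) := by
  have h : ∀ ξ : E n, (japanese ξ)⁻¹ ^ (μ + (n + 1)) * japanese ξ ^ μ =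
      (japanese ξ)⁻¹ ^ (n + 1) := fun ξ => by
    rw [pow_add, mul_right_comm, ← mul_pow, inv_mul_cancel₀ (japanese_pos ξ).ne', one_pow, one_mul]
  rw [opWeight, ← h (z.2.1 - z.2.2), ← h z.2.2]
  ring

theorem integrable_opWeight : Integrable fun z : (E n × E n) × E n × E n =>
    ((japanese z.1.1)⁻¹ ^ (n + 1) * (japanese (z.1.1 + z.1.2))⁻¹ ^ (n + 1)) *
      ((japanese (z.2.1 - z.2.2))⁻¹ ^ (n + 1) * (japanese z.2.2)⁻¹ ^ (n + 1)) := by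
  have h := (integrable_japanese_inv_pow (n := n)).mul_prod (integrable_japanese_inv_pow (n := n))
  have h1 := (measurePreserving_prod_add (volume : Measure (E n))
    (volume : Measure (E n))).integrable_comp_of_integrable h
  have h2 := (measurePreserving_sub_prod (volume : Measure (E n))
    (volume : Measure (E n))).integrable_comp_of_integrable h
  exact h1.mul_prod h2

theorem tendsto_opAmplitude (hμ : |m| ≤ μ) {f : E n × E n × E n → ℂ}
    (hf : Reg (symbolDir n) (HolderBd s fun q : E n × E n => japanese q.1 ^ m)
      ![0, n + 1, μ + (n + 1)] f) (u : 𝓢(E n, ℂ)) (x : E n) :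
    HasOscIntegral (V := E n × E n) phase₂
      (fun y ξ => f (x, ξ.1, y.1) * u (x + (y.1 + y.2)))
      ((((2 * Real.pi) ^ (n + n))⁻¹ : ℝ) * ∫ z, opOsc n z * ibpOps (opDir n)
        (opOps n (μ + (n + 1))) (fun z => f (x, z.2.1, z.1.1) * u (x + (z.1.1 + z.1.2))) z) := by
  intro χ hχ
  have hj : ∀ z : (E n × E n) × E n × E n, japanese (z.2.1 - z.2.2) ≤ 2 * (1 + ‖z‖) ∧
      japanese z.2.2 ≤ 1 * (1 + ‖z‖) := fun z => by
    have h1 : ‖z.2.1‖ ≤ ‖z‖ := (norm_fst_le z.2).trans (norm_snd_le z)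
    have h2 : ‖z.2.2‖ ≤ ‖z‖ := (norm_snd_le z.2).trans (norm_snd_le z)
    have h3 := norm_sub_le z.2.1 z.2.2
    constructor
    · refine le_of_sq_le_sq ?_ (by positivity)
      rw [japanese_sq]
      nlinarith [norm_nonneg (z.2.1 - z.2.2), norm_nonneg z]
    · refine le_of_sq_le_sq ?_ (by positivity)
      rw [japanese_sq]
      nlinarith [norm_nonneg z.2.2, norm_nonneg z]
  have hW : ∀ z : (E n × E n) × E n × E n, (japanese (z.2.1 - z.2.2) ^ μ * japanese z.2.2 ^ μ) *
      (japanese (z.1.1 + z.1.2))⁻¹ ^ (n + 1) ≤ 2 ^ μ * (1 + ‖z‖) ^ (μ + μ) := fun z => by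
    have h1 := pow_le_pow_left₀ (japanese_pos _).le (hj z).1 μ
    have h2 := pow_le_pow_left₀ (japanese_pos _).le (hj z).2 μ
    have h3 := pow_le_one₀ (n := n + 1) (japanese_inv_nonneg (z.1.1 + z.1.2))
      (japanese_inv_le_one _)
    have h4 := pow_nonneg (japanese_pos z.2.2).le μ
    have h5 := pow_nonneg (japanese_pos (z.2.1 - z.2.2)).le μ
    calc _ ≤ (japanese (z.2.1 - z.2.2) ^ μ * japanese z.2.2 ^ μ) * 1 := by gcongr
      _ ≤ ((2 * (1 + ‖z‖)) ^ μ * (1 * (1 + ‖z‖)) ^ μ) * 1 := by gcongr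
      _ = _ := by rw [mul_one, one_mul, mul_pow, pow_add, mul_assoc]
  have : (volume : Measure (E n × E n)).IsAddHaarMeasure := isAddHaarMeasure_volume_prod
  have : (volume : Measure ((E n × E n) × E n × E n)).IsAddHaarMeasure :=
    isAddHaarMeasure_volume_prod
  have := (isOsc_opOps n (μ + (n + 1))).tendsto_regularisation (μ := volume)
    (fun z => mul_nonneg (mul_nonneg (pow_nonneg (japanese_pos _).le μ)
      (pow_nonneg (japanese_pos _).le μ)) (pow_nonneg (japanese_inv_nonneg _) _))
    (by positivity) hW (by simpa only [opWeight_mul] using integrable_opWeight)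
    (reg_opAmplitude hμ hf u x) χ hχ
  refine ⟨this.1, ?_⟩
  rw [Module.finrank_prod, finrank_euclideanSpace_fin]
  exact this.2.const_mul _

/-- The integrations by parts in `w` see only `u(x + w)`, and those in `y` (with `w` fixed) and `ξ`
see only the symbol. The transformed integrand therefore remains a product in the variables `(y, η)`
and `(w, ξ')`. -/
theorem opIntegrand_opCoord (q : ℕ) (f : E n × E n × E n → ℂ) (u : 𝓢(E n, ℂ)) (x : E n)
    (v : (E n × E n) × E n × E n) :
    opOsc n (opCoord v) * ibpOps (opDir n) (opOps n q)
        (fun z => f (x, z.2.1, z.1.1) * u (x + (z.1.1 + z.1.2))) (opCoord v) =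
      (ampOsc n v.1 * ibpOps (ampDir n) (ampOps n q) (fun w => f (x, v.2.2 + w.2, w.1)) v.1) *
        (ampOsc n v.2 * waveFactor q u x v.2) := by
  have h1 : ibpOps (opDir n) (List.replicate q (fun z => z.2.2, 0))
      (fun z => u (x + (z.1.1 + z.1.2))) =
      fun z => waveFactor q u x (z.1.1 + z.1.2, z.2.2) := by
    ext z
    rw [waveFactor, ← ibpOps_pullOps (d' := opDir n)
      (φ := fun z : (E n × E n) × E n × E n => (z.1.1 + z.1.2, z.2.2)) (fun o ho j z t => by
        rw [(List.mem_replicate.1 ho).2]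
        simp [waveDir, opDir, add_assoc]), pullOps, List.map_replicate]
    rfl
  have h2 : ∀ z, ibpOps (opDir n) (pullOps (fun z => (opParam z).2) (ampOps n q))
      (fun z => f (x, z.2.1, z.1.1)) z =
      ibpOps (ampDir n) (ampOps n q) (fun w => f (x, z.2.2 + w.2, w.1)) (z.1.1, z.2.1 - z.2.2) := by
    intro z
    have h3 := ibpOps_pullOps (d := liftDir (E n) (ampDir n)) (d' := opDir n) (φ := opParam)
      (l := pullOps Prod.snd (ampOps n q)) (fun o ho j z t => by
        simp only [pullOps, ampOps, List.map_append, List.map_replicate, List.mem_append,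
          List.mem_replicate] at ho
        rcases ho with ⟨-, rfl⟩ | ⟨-, rfl⟩ <;>
          simp [opParam, liftDir, ampDir, opDir, add_sub_right_comm])
      (fun p : E n × E n × E n => f (x, p.1 + p.2.2, p.2.1)) z
    rw [opParam, ibpOps_slice] at h3
    rw [← h3]
    simp only [pullOps, List.map_map, opParam, add_sub_cancel]
    rfl
  rw [opOps, ibpOps_append, ibpOps_invariant_mul, h1]
  · simp only [mul_comm (f _)]
    rw [ibpOps_invariant_mul]
    · simp only [h2]
      have hosc : opOsc n (opCoord v) = ampOsc n v.1 * ampOsc n v.2 := by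
        rw [opOsc, ampOsc, ampOsc, ← Complex.exp_add, phase₂, phase, phase, opCoord]
        congr 1
        simp only [inner_add_left, inner_add_right, inner_neg_left]
        push_cast
        ring
      rw [hosc]
      simp only [opCoord, add_neg_cancel_left, add_sub_cancel_right]
      ring
    · intro o ho j z t
      simp only [pullOps, ampOps, List.map_append, List.map_replicate, List.mem_append,
        List.mem_replicate] at ho
      rcases ho with ⟨-, rfl⟩ | ⟨-, rfl⟩ <;> simp [opDir]
      congr 2
      abel
  · intro o ho j z t
    rw [(List.mem_replicate.1 ho).2]
    simp [opDir]

/-- After the measure-preserving change of variables, Fubini is applied twice: integrate over `(y,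
η)`, then over `w`. Integrability of the remaining function of `ξ'` also comes from Fubini, and it
yields the absolute convergence of `a_L(x, D_x) u(x)`. -/
theorem integral_opAmplitude (hμ : |m| ≤ μ) {f : E n × E n × E n → ℂ}
    (hf : Reg (symbolDir n) (HolderBd s fun q : E n × E n => japanese q.1 ^ m)
      ![0, n + 1, μ + (n + 1)] f) (u : 𝓢(E n, ℂ)) (x : E n) :
    Integrable (fun ξ => ampIntegral (μ + (n + 1)) (fun w => f (x, ξ + w.2, w.1)) *
        (Complex.exp (Complex.I * (inner ℝ x ξ : ℝ)) * fourierHat u ξ)) ∧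
      ∫ z, opOsc n z * ibpOps (opDir n) (opOps n (μ + (n + 1)))
        (fun z => f (x, z.2.1, z.1.1) * u (x + (z.1.1 + z.1.2))) z =
      ∫ ξ, ampIntegral (μ + (n + 1)) (fun w => f (x, ξ + w.2, w.1)) *
        (Complex.exp (Complex.I * (inner ℝ x ξ : ℝ)) * fourierHat u ξ) := by
  have ho := isOsc_opOps n (μ + (n + 1))
  have hreg := Reg.ibpOps (c := 0) _ ho.affine
    (fun z => mul_nonneg (mul_nonneg (pow_nonneg (japanese_pos _).le μ)
      (pow_nonneg (japanese_pos _).le μ)) (pow_nonneg (japanese_inv_nonneg _) _))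
    (by simpa only [zero_add] using reg_opAmplitude hμ hf u x)
  simp only [opWeight_mul] at hreg
  have hB := hreg.base.bounded_mul ho.continuous fun z => (ho.norm_eq z).le
  have hint := hB.integrable integrable_opWeight
  have hmp := measurePreserving_opCoord (n := n)
  have hintc := hmp.integrable_comp_of_integrable hint
  have hintegral : ∀ g : (E n × E n) × E n × E n → ℂ, Continuous g →
      ∫ z, g z = ∫ v, g (opCoord v) := fun g hg => by
    conv_lhs => rw [← hmp.map_eq]
    exact integral_map hmp.measurable.aemeasurable hg.aestronglyMeasurable
  rw [hintegral _ hB.1]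
  simp only [Function.comp_def, opIntegrand_opCoord] at hintc ⊢
  rw [Measure.volume_eq_prod] at hintc ⊢
  have h1 := hintc.integral_prod_right
  rw [integral_prod_symm _ hintc]
  simp only [integral_mul_const] at h1 ⊢
  simp only [← ampIntegral.eq_def] at h1 ⊢
  have h2 := h1.integral_prod_right
  rw [Measure.volume_eq_prod, integral_prod_symm _ h1]
  simp only [integral_const_mul, integral_waveFactor] at h2 ⊢
  exact ⟨h2, trivial⟩

end Comparison

/-! ### Reduction of double symbols -/

theorem double_symbol_reduction {n : ℕ} {N : ℕ∞} (hN : (n : ℕ∞) < N) {k : ℕ} {s : ℝ≥0}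
    (hs1 : s < 1) {m : ℝ} {a : E n → E n → E n → ℂ} (ha : IsDoubleSymbol k s m N a) :
    ∃ aL : E n → E n → ℂ,
      (∀ x ξ : E n, HasOscIntegral phase (fun y η => a x (ξ + η) (x + y)) (aL x ξ)) ∧
      IsSingleSymbol k s m (N - ((n : ℕ∞) + 1)) aL ∧
      ∀ (u : 𝓢(E n, ℂ)) (x : E n),
        Integrable (singleOpIntegrand aL u x) ∧
        HasDoubleOpValue (fun x ξ x' _ => a x ξ x') u x (singleOp aL u x) := by
  have hμ : |m| ≤ (⌈|m|⌉₊ : ℕ) := Nat.le_ceil _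
  set μ := ⌈|m|⌉₊
  have hN' : (n : ℕ∞) + 1 ≤ N := Order.add_one_le_of_lt hN
  -- The third variable becomes `y = x' - x`, so that the integration variables no longer involve
  -- `x`.
  let f : E n × E n × E n → ℂ := fun z => a z.1 z.2.1 (z.1 + z.2.2)
  have hf : ∀ c : Fin 3 → ℕ, c 0 ≤ k → (c 1 : ℕ∞) ≤ N →
      Reg (symbolDir n) (HolderBd s fun q : E n × E n => japanese q.1 ^ m) c f :=
    fun c h0 h1 => Reg.shift hs1 (ha.reg (by simpa using h0) (by simpa using h1))
  have hf0 := hf ![0, n + 1, μ + (n + 1)] (Nat.zero_le k) (by simpa using hN')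
  refine ⟨fun x ξ => leftSymbol (μ + (n + 1)) f (x, ξ), fun x ξ => ?_, ?_, fun u x => ?_⟩
  · exact hasOscIntegral_of_reg (reg_amplitude_slice hμ rfl hf0 x ξ)
  · refine isSingleSymbol_of_reg fun c h0 h1 h2 => reg_leftSymbol hμ h2 (hf _ (by simpa using h0) ?_)
    -- The loss of derivatives: `c 1` derivatives of the left symbol in `ξ` require `c 1 + (n + 1) ≤
    -- N` of the double symbol.
    simpa using add_le_of_le_tsub_right_of_le hN' h1
  · obtain ⟨h1, h2⟩ := integral_opAmplitude hμ hf0 u x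
    have h3 : ∀ ξ, singleOpIntegrand (fun x ξ => leftSymbol (μ + (n + 1)) f (x, ξ)) u x ξ =
        (((2 * Real.pi) ^ n)⁻¹ : ℝ) *
          (ampIntegral (μ + (n + 1)) (fun w => f (x, ξ + w.2, w.1)) *
            (Complex.exp (Complex.I * (inner ℝ x ξ : ℝ)) * fourierHat u ξ)) := fun ξ => by
      rw [singleOpIntegrand, leftSymbol]
      ring
    refine ⟨(h1.const_mul _).congr (Eventually.of_forall fun ξ => (h3 ξ).symm), ?_⟩
    have h4 := tendsto_opAmplitude hμ hf0 u x
    rw [h2] at h4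
    have h5 : singleOp (fun x ξ => leftSymbol (μ + (n + 1)) f (x, ξ)) u x =
        (((2 * Real.pi) ^ (n + n))⁻¹ : ℝ) * ∫ ξ,
          ampIntegral (μ + (n + 1)) (fun w => f (x, ξ + w.2, w.1)) *
            (Complex.exp (Complex.I * (inner ℝ x ξ : ℝ)) * fourierHat u ξ) := by
      simp only [singleOp, h3]
      rw [integral_const_mul, ← mul_assoc, ← Complex.ofReal_mul, pow_add, mul_inv]
    rw [HasDoubleOpValue, h5]
    simpa only [add_assoc] using h4

end PsiDO

end

theorem theorem4p11 (n : ℕ) (hn : 1 ≤ n) (N : ℕ∞) (hN : (n : ℕ∞) < N)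
    (k : ℕ) (s : ℝ≥0) (hs0 : 0 < s) (hs1 : s < 1) (m : ℝ)
    (a : PsiDO.E n → PsiDO.E n → PsiDO.E n → ℂ) (ha : PsiDO.IsDoubleSymbol k s m N a) :
    ∃ aL : PsiDO.E n → PsiDO.E n → ℂ,
      (∀ x ξ : PsiDO.E n,
        PsiDO.HasOscIntegral PsiDO.phase (fun y η => a x (ξ + η) (x + y)) (aL x ξ)) ∧
      PsiDO.IsSingleSymbol k s m (N - ((n : ℕ∞) + 1)) aL ∧
      ∀ (u : 𝓢(PsiDO.E n, ℂ)) (x : PsiDO.E n),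
        Integrable (PsiDO.singleOpIntegrand aL u x) ∧
        PsiDO.HasDoubleOpValue (fun x ξ x' _ => a x ξ x') u x (PsiDO.singleOp aL u x) :=
  PsiDO.double_symbol_reduction hN hs1 ha
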